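/- **Setting.** Let $\beta>1$ be a Pisot unit of degree $d$: a real algebraic integer whose minimal polynomial $f$ over $\mathbb{Z}$ has constant term $\pm1$ and whose other Galois conjugates $\beta_2,\dots,\beta_d\in\mathbb{C}$ satisfy $|\beta_j|<1$; put $\beta_1=\beta$. Let $A\subset\mathbb{Z}[\beta]$ be finite, let $X_a=\bigcup_{i\in I_a}[\ell_i,r_i)$, $a\in A$, be non-empty, pairwise disjoint finite unions of intervals, let $X=\bigcup_{a\in A} X_a$, and assume $\bigcup_{a\in A}(\beta X_a-a)=X$. Let $T:X\to X$, $Tx=\beta x-a$ for $x\in X_a$. For $x\in X$ let $b(x)=b_1(x)b_2(x)\cdots\in A^{\mathbb{N}}$ be its $T$-expansion, i.e. $T^{k-1}x\in X_{b_k(x)}$ for all $k\ge1$. Put $\widetilde X_a=\bigcup_{i\in I_a}(\ell_i,r_i]$, $\widetilde X=\bigcup_a\widetilde X_a$, and $\widetilde T:\widetilde X\to\widetilde X$, $\widetilde Tx=\beta x-a$ for $x\in\widetilde X_a$. For $x\in X\cap\widetilde X$ let $m_x\in\{1,2,\dots\}\cup\{\infty\}$ be the least $m\ge1$ with $\widetilde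 T^mx=T^mx$ ($\infty$ if there is none), and let $$\mathcal V=(X\setminus\widetilde X)\cup\bigcup_{x\in X\cap\widetilde X}\ \bigcup_{1\le k<m_x}\{T^kx,\widetilde T^kx\}\cap X .$$ Let $\Gamma_j:\mathbb{Q}(\beta)\to\mathbb{Q}(\beta_j)$ be the isomorphism with $\Gamma_j(\beta)=\beta_j$, and let $\mathbf v_j=\nu_j(\beta_j^{d-1},\dots,\beta_j,1)^t$, where $\nu_j\in\mathbb{C}$ are such that $\mathbf v_1+\dots+\mathbf v_d=(1,0,\dots,0)^t$ (that is, $\nu_j=1/f'(\beta_j)$). Let $H\subset\mathbb{R}^d$ be the hyperplane spanned by the real and imaginary parts of $\mathbf v_2,\dots,\mathbf v_d$, let $\Phi(x)=\sum_{j=2}^d\Gamma_j(x)\mathbf v_j\in H$ for $x\in\mathbb{Q}(\beta)$, and let $\pi_1:\mathbb{R}^d=\mathbb{R}\mathbf v_1\oplus H\to\mathbb{R}$, $\pi_1(x\mathbf v_1+\mathbf y)=x$. Let $\mathcal S$ be the set of two-sided sequences $u=(u_k)_{k\in\mathbb{Z}}$ such that, for every $k\in\mathbb{Z}$, $u_ku_{k+1}\cdots=b(x)$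 for some $x\in X$. For $u\in\mathcal S$ put $\varphi(\cdots u_{-1}u_0)=\sum_{k\le0}\Phi(u_k\beta^{-k})$ and $\psi(u)=\sum_{k\ge1}u_k\beta^{-k}\,\mathbf v_1-\varphi(\cdots u_{-1}u_0)$. Let $\widehat X=\psi(\mathcal S)$, and let $\mu$ be the measure $\mu(E)=\lambda^d(\widehat X\cap\pi_1^{-1}(E))$ on $\mathbb{R}$, where $\lambda^d$ is Lebesgue measure. For $x\in X$ let $\mathcal D_x=\{\varphi(\cdots u_{-1}u_0):u\in\mathcal S,\ u_1u_2\cdots=b(x)\}$, and for $x\in\mathbb{Z}[\beta]\cap X$ let $\mathcal T_x=\Phi(x)+\mathcal D_x$. The family $\{\mathcal T_x\}_{x\in\mathbb{Z}[\beta]\cap X}$ is a *multiple tiling* of $H$ with covering degree $m\ge1$ if: there are only finitely many different sets $\mathcal D_x$, $x\in\mathbb{Z}[\beta]\cap X$, and they are compact; every point of $H$ has a ball around it that meets $\mathcal T_x$ for only finitely many $x$; the $\mathcal T_x$ cover $H$; each $\mathcal D_x$, $x\in\mathbb{Z}[\beta]\cap X$, is the closure of its interior in $H$; and, for Lebesgue-almost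 every $\mathbf y\in H$, there are exactly $m$ indices $x\in\mathbb{Z}[\beta]\cap X$ with $\mathbf y\in\mathcal T_x$. It is a *tiling* if it is a multiple tiling with $m=1$. An *exclusive point* of $\mathcal T_x$ is a point of $\mathcal T_x$ that lies in no $\mathcal T_{x'}$ with $x'\ne x$. Let $P$ be the (finite) set of $x\in\mathbb{Z}[\beta]\cap X$ with $T^nx=x$ for some $n\ge1$, and let $$\varepsilon=\beta\cdot\min_{y\in P}\bigl(\min\{z>y: z\notin X_{b_1(y)}\}-y\bigr).$$ **Statement.** Assume that $\mathcal V$ is finite. 1. For every $x\in P$, the tile $\mathcal T_x$ contains an exclusive point if and only if for every $y\in P$ there are $z\in\mathbb{Z}[\beta]\cap[0,\varepsilon)$ and $k\ge0$ with $T^k(y+z)=T^k(x+z)=x$. 2. Assume moreover that the support of $\mu$ is $X$ (that is, the closed support of $\mu$ in $\mathbb{R}$ is the closure of $X$). Then $\{\mathcal T_x\}_{x\in\mathbb{Z}[\beta]\cap X}$ is a tiling of $H$ if and only if the following property (W) holds: there is $x\in P$ such that for every $y\in P$ there are $z\in\mathbb{Z}[\beta]\cap[0,\varepsilon)$ and $k\ge0$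 with $T^k(y+z)=T^k(x+z)=x$. -/

import Mathlib

noncomputable section

namespace BetaTiling

open Polynomial MeasureTheory

/-- A Pisot unit: a real algebraic integer `β > 1` whose minimal polynomial over `ℤ` has constant
term `±1` and all of whose Galois conjugates different from `β` have modulus `< 1`. -/
structure PisotUnit where
  val : ℝ
  one_lt : 1 < val
  isIntegral : IsIntegral ℤ val
  unit : |(minpoly ℤ val).coeff 0| = 1
  pisot : ∀ z : ℂ, aeval z (minpoly ℤ val) = 0 → z ≠ (val : ℂ) → ‖z‖ < 1

namespace PisotUnit

variable (β : PisotUnit)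

/-- The field `ℚ(β)`, as a subfield of `ℝ`. -/
abbrev K : IntermediateField ℚ ℝ := IntermediateField.adjoin ℚ {β.val}

/-- The ring `ℤ[β]`, as a subring of `ℝ`. -/
abbrev ring : Subalgebra ℤ ℝ := Algebra.adjoin ℤ {β.val}

/-- `β` as an element of `ℚ(β)`. -/
abbrev gen : β.K := IntermediateField.AdjoinSimple.gen ℚ β.val

theorem isIntegralQ : IsIntegral ℚ β.val := β.isIntegral.tower_top

instance : FiniteDimensional ℚ β.K :=
  IntermediateField.adjoin.finiteDimensional β.isIntegralQ

/-- The minimal polynomial of `β` over `ℚ`. -/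
abbrev poly : ℚ[X] := minpoly ℚ β.val

/-- The degree `d` of `β`. -/
abbrev deg : ℕ := β.poly.natDegree

/-- The isomorphisms `Γ_j : ℚ(β) → ℚ(β_j)`, `1 ≤ j ≤ d`, are the embeddings of `ℚ(β)` into `ℂ`. -/
abbrev Emb : Type := β.K →ₐ[ℚ] ℂ

/-- The embedding `Γ_1`, which is the inclusion `ℚ(β) ⊂ ℝ ⊂ ℂ`. -/
def emb₁ : β.Emb := (Complex.ofRealAm.restrictScalars ℚ).comp β.K.val

/-- The right eigenvector `v_j = ν_j (β_j^{d-1}, …, β_j, 1)` of the companion matrix, where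
`β_j = Γ_j(β)` and `ν_j = 1 / f'(β_j)` with `f` the minimal polynomial of `β`. This is the
normalization for which `v_1 + ⋯ + v_d = e_1`, see `sum_eigvec`. -/
def eigvec (σ : β.Emb) (i : Fin β.deg) : ℂ :=
  (aeval (σ β.gen) (derivative β.poly))⁻¹ * σ β.gen ^ (β.deg - 1 - (i : ℕ))

/-- The real part of `v_j`. -/
def reVec (σ : β.Emb) : EuclideanSpace ℝ (Fin β.deg) :=
  WithLp.toLp 2 fun i => (β.eigvec σ i).re

/-- The imaginary part of `v_j`. -/
def imVec (σ : β.Emb) : EuclideanSpace ℝ (Fin β.deg) :=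
  WithLp.toLp 2 fun i => (β.eigvec σ i).im

/-- The vector `v_1`, which is real. -/
def v₁ : EuclideanSpace ℝ (Fin β.deg) := β.reVec β.emb₁

/-- The contracting hyperplane `H`, spanned by the real and imaginary parts of `v_2, …, v_d`. -/
def H : Submodule ℝ (EuclideanSpace ℝ (Fin β.deg)) :=
  Submodule.span ℝ (⋃ σ ∈ {σ : β.Emb | σ ≠ β.emb₁}, {β.reVec σ, β.imVec σ})

theorem reVec_mem {σ : β.Emb} (h : σ ≠ β.emb₁) : β.reVec σ ∈ β.H :=
  Submodule.subset_span (Set.mem_biUnion h (by simp))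

theorem imVec_mem {σ : β.Emb} (h : σ ≠ β.emb₁) : β.imVec σ ∈ β.H :=
  Submodule.subset_span (Set.mem_biUnion h (by simp))

open Classical in
/-- The vector `∑_{j ≥ 2} Γ_j(x) v_j` of `ℝ^d`. The sum is real (see `coe_phiVec`), so it is the sum
of the real parts `Re Γ_j(x) • Re v_j - Im Γ_j(x) • Im v_j` of its terms. -/
def phiVec (x : β.K) : EuclideanSpace ℝ (Fin β.deg) :=
  ∑ σ : β.Emb with σ ≠ β.emb₁, ((σ x).re • β.reVec σ - (σ x).im • β.imVec σ)

theorem phiVec_mem (x : β.K) : β.phiVec x ∈ β.H := by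
  classical
  refine Submodule.sum_mem _ fun σ hσ => ?_
  have h : σ ≠ β.emb₁ := by simpa using hσ
  exact Submodule.sub_mem _ (Submodule.smul_mem _ _ (β.reVec_mem h))
    (Submodule.smul_mem _ _ (β.imVec_mem h))

/-- The map `Φ : ℚ(β) → H`, `Φ(x) = ∑_{j ≥ 2} Γ_j(x) v_j`. -/
def Phi (x : β.K) : β.H := ⟨β.phiVec x, β.phiVec_mem x⟩

/-- The projection `π_1 : ℝ^d → ℝ` with `π_1(x v_1 + y) = x` for `x ∈ ℝ`, `y ∈ H` (see `proj_v₁` and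
`proj_H`), in coordinates: it is given by the left eigenvector of the companion matrix whose
entries are the coefficients of the polynomial `f(X) / (X - β)`. -/
def proj : EuclideanSpace ℝ (Fin β.deg) →ₗ[ℝ] ℝ :=
  ∑ i : Fin β.deg, (minpolyDiv ℚ β.val).coeff (β.deg - 1 - (i : ℕ)) •
    (EuclideanSpace.proj i : EuclideanSpace ℝ (Fin β.deg) →L[ℝ] ℝ).toLinearMap

/-- Lebesgue measure `λ^{d-1}` on the Euclidean space `H`. -/
def lebesgueH : Measure β.H := (stdOrthonormalBasis ℝ β.H).toBasis.addHaar

/- Facts which confirm the explicit formulas above. -/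

theorem minpoly_gen : minpoly ℚ β.gen = β.poly :=
  IntermediateField.minpoly_gen ℚ β.val

theorem sum_eigvec (i : Fin β.deg) :
    ∑ σ : β.Emb, β.eigvec σ i = if (i : ℕ) = 0 then 1 else 0 := by
  have hd : Module.finrank ℚ β.K = β.deg := IntermediateField.adjoin.finrank β.isIntegralQ
  have hint : IsIntegral ℚ β.gen := Algebra.IsIntegral.isIntegral _
  have hr : β.deg - 1 - (i : ℕ) < Module.finrank ℚ β.K := by rw [hd]; have := i.2; omega
  have htop : Algebra.adjoin ℚ {β.gen} = ⊤ := by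
    have h := (IntermediateField.adjoin.powerBasis β.isIntegralQ).adjoin_gen_eq_top
    rwa [IntermediateField.adjoin.powerBasis_gen] at h
  have key := congrArg (fun p : ℂ[X] => p.coeff (β.deg - 1))
    (sum_smul_minpolyDiv_eq_X_pow (K := ℚ) ℂ (x := β.gen) htop hr)
  have hc : (minpolyDiv ℚ β.gen).coeff (β.deg - 1) = 1 := by
    have h := (minpolyDiv_monic hint).coeff_natDegree
    rwa [natDegree_minpolyDiv, minpoly_gen] at h
  simp only [finsetSum_coeff, coeff_map, coeff_smul, hc, coeff_X_pow, smul_eq_mul, mul_one,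
    minpoly_gen] at key
  have hterm : ∀ σ : β.Emb, β.eigvec σ i =
      σ (β.gen ^ (β.deg - 1 - (i : ℕ)) / aeval β.gen (derivative β.poly)) := fun σ => by
    rw [eigvec, map_div₀, map_pow, ← aeval_algHom_apply, div_eq_inv_mul]
  have hi : (β.deg - 1 = β.deg - 1 - (i : ℕ)) ↔ (i : ℕ) = 0 := by have := i.2; omega
  simp only [hi] at key
  rw [← key]
  exact Finset.sum_congr rfl fun σ _ => hterm σ

theorem coe_v₁ (i : Fin β.deg) : ((β.v₁ i : ℝ) : ℂ) = β.eigvec β.emb₁ i := by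
  have h : β.eigvec β.emb₁ i = (((aeval β.val (derivative β.poly))⁻¹ *
      β.val ^ (β.deg - 1 - (i : ℕ)) : ℝ) : ℂ) := by
    have h1 : β.emb₁ β.gen = algebraMap ℝ ℂ β.val := rfl
    rw [eigvec, h1, aeval_algebraMap_apply]
    push_cast
    rfl
  rw [v₁, reVec, PiLp.toLp_apply, h, Complex.ofReal_re]

/-- Complex conjugation permutes the conjugates. -/
def conjEmb (σ : β.Emb) : β.Emb := (Complex.conjAe.restrictScalars ℚ).toAlgHom.comp σ

theorem conjEmb_apply (σ : β.Emb) (x : β.K) :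
    β.conjEmb σ x = (starRingEnd ℂ) (σ x) := rfl

theorem eigvec_conjEmb (σ : β.Emb) (i : Fin β.deg) :
    β.eigvec (β.conjEmb σ) i = (starRingEnd ℂ) (β.eigvec σ i) := by
  have h : aeval (β.conjEmb σ β.gen) (derivative β.poly) =
      (starRingEnd ℂ) (aeval (σ β.gen) (derivative β.poly)) :=
    aeval_algHom_apply (Complex.conjAe.restrictScalars ℚ).toAlgHom (σ β.gen) (derivative β.poly)
  rw [eigvec, h, conjEmb_apply, eigvec, map_mul, map_inv₀, map_pow]

theorem conjEmb_conjEmb (σ : β.Emb) : β.conjEmb (β.conjEmb σ) = σ :=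
  AlgHom.ext fun x => by simp [conjEmb_apply]

theorem conjEmb_emb₁ : β.conjEmb β.emb₁ = β.emb₁ :=
  AlgHom.ext fun _ => Complex.conj_ofReal _

open Classical in
theorem coe_phiVec (x : β.K) (i : Fin β.deg) :
    ((β.phiVec x i : ℝ) : ℂ) = ∑ σ : β.Emb with σ ≠ β.emb₁, σ x * β.eigvec σ i := by
  have hre : β.phiVec x i = (∑ σ : β.Emb with σ ≠ β.emb₁, σ x * β.eigvec σ i).re := by
    simp [phiVec, reVec, imVec, Complex.mul_re]
  have hconj : (starRingEnd ℂ) (∑ σ : β.Emb with σ ≠ β.emb₁, σ x * β.eigvec σ i) =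
      ∑ σ : β.Emb with σ ≠ β.emb₁, σ x * β.eigvec σ i := by
    rw [map_sum]
    refine Finset.sum_bij' (fun σ _ => β.conjEmb σ) (fun σ _ => β.conjEmb σ) ?_ ?_ ?_ ?_ ?_
    · intro σ hσ
      simp only [Finset.mem_filter, Finset.mem_univ, true_and] at hσ ⊢
      exact fun h => hσ (by rw [← β.conjEmb_conjEmb σ, h, conjEmb_emb₁])
    · intro σ hσ
      simp only [Finset.mem_filter, Finset.mem_univ, true_and] at hσ ⊢
      exact fun h => hσ (by rw [← β.conjEmb_conjEmb σ, h, conjEmb_emb₁])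
    · exact fun σ _ => β.conjEmb_conjEmb σ
    · exact fun σ _ => β.conjEmb_conjEmb σ
    · intro σ _
      rw [map_mul, conjEmb_apply, eigvec_conjEmb]
  rw [hre, Complex.conj_eq_iff_re.mp hconj]

open Classical in
/-- `π_1` on the complex eigenvectors. -/
theorem sum_coeff_eigvec (σ : β.Emb) :
    ∑ i : Fin β.deg, ((minpolyDiv ℚ β.val).coeff (β.deg - 1 - (i : ℕ)) : ℂ) * β.eigvec σ i =
      if σ = β.emb₁ then 1 else 0 := by
  have hroot : aeval (σ β.gen) β.poly = 0 := by
    rw [aeval_algHom_apply, ← minpoly_gen, minpoly.aeval, map_zero]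
  have h1 := eval₂_minpolyDiv_of_eval₂_eq_zero (R := ℚ) (x := β.val) (y := σ β.gen)
    Complex.ofRealHom (by
      rw [aeval_def] at hroot
      rwa [Subsingleton.elim (Complex.ofRealHom.comp (algebraMap ℚ ℝ)) (algebraMap ℚ ℂ)])
  have hiff : Complex.ofRealHom β.val = σ β.gen ↔ σ = β.emb₁ := by
    constructor
    · intro h
      exact IntermediateField.algHom_ext_of_eq_adjoin ℚ rfl fun x hx => by
        obtain rfl : x = β.val := hx
        exact h.symm
    · rintro rfl
      rfl
  have hlt : (minpolyDiv ℚ β.val).natDegree < β.deg := natDegree_minpolyDiv_lt β.isIntegralQ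
  have hne : aeval (σ β.gen) (derivative β.poly) ≠ 0 :=
    (minpoly.irreducible β.isIntegralQ).separable.aeval_derivative_ne_zero hroot
  rw [eval₂_eq_sum_range' _ hlt, ← Finset.sum_range_reflect, Finset.sum_range] at h1
  have h2 : ∑ i : Fin β.deg, ((minpolyDiv ℚ β.val).coeff (β.deg - 1 - (i : ℕ)) : ℂ) *
      β.eigvec σ i = (aeval (σ β.gen) (derivative β.poly))⁻¹ *
        ∑ i : Fin β.deg, Complex.ofRealHom ((minpolyDiv ℚ β.val).coeff (β.deg - 1 - (i : ℕ))) *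
          σ β.gen ^ (β.deg - 1 - (i : ℕ)) := by
    rw [Finset.mul_sum]
    refine Finset.sum_congr rfl fun i _ => ?_
    rw [eigvec, Complex.ofRealHom_eq_coe]
    ring
  rw [h2, h1]
  by_cases hσ : σ = β.emb₁
  · have h3 : Complex.ofRealHom (aeval β.val (derivative β.poly)) =
        aeval (σ β.gen) (derivative β.poly) := by
      rw [← hiff.mpr hσ]
      exact (aeval_algebraMap_apply ℂ β.val (derivative β.poly)).symm
    rw [if_pos (hiff.mpr hσ), if_pos hσ, h3, inv_mul_cancel₀ hne]
  · rw [if_neg (fun h => hσ (hiff.mp h)), if_neg hσ, mul_zero]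

theorem proj_apply (x : EuclideanSpace ℝ (Fin β.deg)) :
    β.proj x = ∑ i : Fin β.deg, (minpolyDiv ℚ β.val).coeff (β.deg - 1 - (i : ℕ)) * x i := by
  simp [proj]

theorem proj_v₁ : β.proj β.v₁ = 1 := by
  have h := congrArg Complex.re (β.sum_coeff_eigvec β.emb₁)
  simpa [proj_apply, v₁, reVec] using h

theorem proj_H (y : β.H) : β.proj y = 0 := by
  have : β.H ≤ LinearMap.ker β.proj := by
    rw [H, Submodule.span_le]
    intro v hv
    simp only [Set.mem_iUnion, Set.mem_ofPred_eq, Set.mem_insert_iff, Set.mem_singleton_iff] at hv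
    obtain ⟨σ, hσ, rfl | rfl⟩ := hv
    · have h := congrArg Complex.re (β.sum_coeff_eigvec σ)
      simpa [proj_apply, reVec, hσ] using h
    · have h := congrArg Complex.im (β.sum_coeff_eigvec σ)
      simpa [proj_apply, imVec, hσ] using h
  exact this y.2

end PisotUnit

/-- A right-continuous `β`-transformation for a Pisot unit `β`, with a finite digit set
`A ⊂ ℚ(β)`: for every digit `a ∈ A`, `I a` is the finite set of (pairs of endpoints of) intervals
`[ℓ, r)` whose union is the non-empty set `X_a`; the sets `X_a` are pairwise disjoint, and
`⋃_a (β X_a - a) = ⋃_a X_a`. -/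
structure BetaTransformation (β : PisotUnit) where
  A : Finset β.K
  I : β.K → Finset (ℝ × ℝ)
  endpoints_lt : ∀ a ∈ A, ∀ p ∈ I a, p.1 < p.2
  nonempty : ∀ a ∈ A, (I a).Nonempty
  disjoint : ∀ a ∈ A, ∀ a' ∈ A, a ≠ a' →
    Disjoint (⋃ p ∈ I a, Set.Ico p.1 p.2) (⋃ p ∈ I a', Set.Ico p.1 p.2)
  image_eq : (⋃ a ∈ A, (fun x : ℝ => β.val * x - (a : ℝ)) '' ⋃ p ∈ I a, Set.Ico p.1 p.2) =
    ⋃ a ∈ A, ⋃ p ∈ I a, Set.Ico p.1 p.2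

namespace BetaTransformation

variable {β : PisotUnit} (T : BetaTransformation β)

/-- `X_a`. -/
def piece (a : β.K) : Set ℝ := ⋃ p ∈ T.I a, Set.Ico p.1 p.2

/-- `X̃_a`. -/
def piece' (a : β.K) : Set ℝ := ⋃ p ∈ T.I a, Set.Ioc p.1 p.2

/-- `X`. -/
def X : Set ℝ := ⋃ a ∈ T.A, T.piece a

/-- `X̃`. -/
def X' : Set ℝ := ⋃ a ∈ T.A, T.piece' a

open Classical in
/-- The first digit `b_1(x)` of `x ∈ X`: the unique `a ∈ A` with `x ∈ X_a` (and `0` off `X`). -/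
def digit (x : ℝ) : β.K := if h : ∃ a ∈ T.A, x ∈ T.piece a then h.choose else 0

open Classical in
/-- The unique `a ∈ A` with `x ∈ X̃_a`, for `x ∈ X̃` (and `0` off `X̃`). -/
def digit' (x : ℝ) : β.K := if h : ∃ a ∈ T.A, x ∈ T.piece' a then h.choose else 0

/-- The map `T`. Only its values on `X`, which it maps to `X`, matter. -/
def map (x : ℝ) : ℝ := β.val * x - (T.digit x : ℝ)

/-- The corresponding left-continuous map `T̃`. Only its values on `X̃`, which it maps to `X̃`,
matter. -/
def map' (x : ℝ) : ℝ := β.val * x - (T.digit' x : ℝ)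

/-- The `T`-expansion `b(x) = b_1(x) b_2(x) ⋯` of `x ∈ X`, with `b_{n+1}(x)` at index `n`. -/
def expansion (x : ℝ) (n : ℕ) : β.K := T.digit (T.map^[n] x)

/-- The set `𝒮` of two-sided sequences `u` such that `u_k u_{k+1} ⋯` is the `T`-expansion of some
`x ∈ X`, for every `k ∈ ℤ`. -/
def S : Set (ℤ → β.K) :=
  {u | ∀ k : ℤ, ∃ x ∈ T.X, ∀ n : ℕ, u (k + n) = T.expansion x n}

/-- The value `∑_{k ≥ 1} u_k β^{-k}` of the right half of `u`. -/
def value (u : ℤ → β.K) : ℝ := ∑' n : ℕ, (u (n + 1) : ℝ) * (β.val ^ (n + 1))⁻¹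

/-- `φ(⋯ u_{-1} u_0) = ∑_{k ≤ 0} Φ(u_k β^{-k})`. -/
def phi (u : ℤ → β.K) : β.H := ∑' n : ℕ, β.Phi (u (-n) * β.gen ^ n)

/-- `ψ(u) = (∑_{k ≥ 1} u_k β^{-k}) v_1 - φ(⋯ u_{-1} u_0)`. -/
def psi (u : ℤ → β.K) : EuclideanSpace ℝ (Fin β.deg) := value u • β.v₁ - (phi u : _)

/-- The natural extension domain `X̂ = ψ(𝒮)`. -/
def natExt : Set (EuclideanSpace ℝ (Fin β.deg)) := psi '' T.S

/-- The invariant measure `μ = λ^d ∘ π⁻¹`, where `π` is the restriction of `π_1` to `X̂`. -/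
def mu : Measure ℝ := (volume.restrict T.natExt).map β.proj

/-- `m_x`: the minimal `m ≥ 1` with `T̃^m x = T^m x`, or `∞` if there is none. -/
def meet (x : ℝ) : ℕ∞ := ⨅ (m : ℕ) (_ : 1 ≤ m ∧ T.map'^[m] x = T.map^[m] x), (m : ℕ∞)

/-- The set `𝒱`. -/
def V : Set ℝ :=
  (T.X \ T.X') ∪ ⋃ x ∈ T.X ∩ T.X', ⋃ k ∈ {k : ℕ | 1 ≤ k ∧ (k : ℕ∞) < T.meet x},
    {T.map^[k] x, T.map'^[k] x} ∩ T.X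

/-- `𝒟_x = {φ(w) : w · b(x) ∈ 𝒮}`. -/
def D (x : ℝ) : Set β.H := {h | ∃ u ∈ T.S, (∀ n : ℕ, u (n + 1) = T.expansion x n) ∧ phi u = h}

/-- The index set `ℤ[β] ∩ X` of the family of tiles. -/
def index : Set β.K := {x | (x : ℝ) ∈ β.ring ∧ (x : ℝ) ∈ T.X}

/-- The tile `𝒯_x = Φ(x) + 𝒟_x`. -/
def tile (x : β.K) : Set β.H := (fun h => β.Phi x + h) '' T.D x

/-- The family `{𝒯_x}`, `x ∈ ℤ[β] ∩ X`, is a multiple tiling of `H` with covering degree `m`. Tiles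
are counted as members of the family, i.e. by their indices `x`. -/
structure IsMultipleTiling (m : ℕ) : Prop where
  finite : {D | ∃ x ∈ T.index, T.D x = D}.Finite
  compact : ∀ x ∈ T.index, IsCompact (T.D x)
  locally_finite : ∀ y : β.H, ∃ r > 0, {x ∈ T.index | (T.tile x ∩ Metric.ball y r).Nonempty}.Finite
  covering : ∀ y : β.H, ∃ x ∈ T.index, y ∈ T.tile x
  closure_interior : ∀ x ∈ T.index, closure (interior (T.D x)) = T.D x
  one_le : 1 ≤ m
  degree : ∀ᵐ y ∂β.lebesgueH, {x ∈ T.index | y ∈ T.tile x}.encard = m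

/-- A tiling is a multiple tiling with covering degree `1`. -/
def IsTiling : Prop := T.IsMultipleTiling 1

/-- The tile `𝒯_x` contains an exclusive point, i.e. a point lying in no other tile. -/
def HasExclusivePoint (x : β.K) : Prop :=
  ∃ y ∈ T.tile x, ∀ x' ∈ T.index, y ∈ T.tile x' → x' = x

/-- The set `P` of points of `ℤ[β] ∩ X` with purely periodic `T`-expansion. -/
def P : Set β.K := {x ∈ T.index | ∃ n : ℕ, 1 ≤ n ∧ T.map^[n] x = x}

/-- `min {z > y : z ∉ X_{b_1(y)}} - y` (the minimum exists for `y ∈ X`). -/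
def gap (y : ℝ) : ℝ := sInf {z : ℝ | y < z ∧ z ∉ T.piece (T.digit y)} - y

/-- `ε = min_{y ∈ P} (min {z > y : z ∉ X_{b_1(y)}} - y) β` (`P` is finite and, if `A` is
non-empty, non-empty). -/
def eps : ℝ := sInf ((fun y : β.K => T.gap y) '' T.P) * β.val

/-- The condition in (W) on a point `x`. Note that `y + z ∈ X` for all `y ∈ P`, `z ∈ [0, ε)`. -/
def WeakFinitenessAt (x : β.K) : Prop :=
  ∀ y ∈ T.P, ∃ z ∈ (β.ring : Set ℝ) ∩ Set.Ico 0 T.eps, ∃ k : ℕ,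
    T.map^[k] (y + z) = x ∧ T.map^[k] (x + z) = x

/-- The generalized weak finiteness property (W). -/
def WeakFiniteness : Prop := ∃ x ∈ T.P, T.WeakFinitenessAt x

end BetaTransformation

end BetaTiling

end

/-! ### The companion operator and the lattice embedding of ℚ(β) -/

noncomputable section

namespace BetaTiling

open Polynomial MeasureTheory Filter Topology

namespace PisotUnit

variable (β : PisotUnit)

/-! Multiplication by β acts on H as a map M = `contr` with MΦ(x) = Φ(βx) and ‖Mⁿ‖ ≤ Cρⁿ, ρ < 1, and
x ↦ x v_1 + Φ(x) sends ℤ[β] to a lattice of ℝ^d. Hence only finitely many x ∈ ℤ[β] have x and Φ(x)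
both bounded (`finite_bounded`), while the points Φ(z) with 0 ≤ z ∈ ℤ[β] are dense in H
(`exists_Phi_near`). The tiles satisfy 𝒯_x = ⋃ M𝒯_y over the T-preimages y of x (`mem_tile_iff`).

Tiles and orbits are linked as follows. For z ≥ 0 the tile of Tⁿ(y + zβ⁻ⁿ) comes close to Φ(z) as n
grows (`eventually_mem_tile_near`). Conversely, if Φ(z) ∈ 𝒯_x, then for all large n some y ∈ P has
Tⁿ(y + zβ⁻ⁿ) = x (`eventually_exists_P`). Near an exclusive point of 𝒯_x there is no other tile;
choosing Φ(z) there gives Tⁿ(y + zβ⁻ⁿ) = x for every y ∈ P and large n, so zβ⁻ⁿ is the required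
translation. In the other direction, an induction over the finite set P finds one z and one k that
send all y + z to x (`exists_common`), and then Φ(βᵏz) lies in 𝒯_x only.

Taking z = 0 shows that 0 ∈ 𝒯_x exactly for x ∈ P (`zero_mem_tile_iff`). So in a tiling almost every
point near 0 is an exclusive point of a tile with index in P, and (W) follows.

For the converse, finiteness of 𝒱 makes x ↦ 𝒟_x locally constant to the right (`D_eq_of_disjoint_V`,
`D_right`). Integrating the measures in the set equation then shows that its union is disjoint in
measure (`vol_eq_sum`, `ae_unique_preimage`). Any bounded patch of tiles reappears translated by
Φ(zβ⁻ⁿ) for large n, and Mⁿ carries that copy into the neighbourhood of an exclusive point.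
Uniqueness pulls back along Mⁿ, so almost every point lies in one tile (`ae_mem_uniqueSet`). The
support hypothesis gives 𝒟_x positive measure, which then forces it to be the closure of its
interior. -/

theorem pos : 0 < β.val := zero_lt_one.trans β.one_lt

theorem coe_gen : ((β.gen : β.K) : ℝ) = β.val := rfl

theorem gen_ne_zero : β.gen ≠ 0 := fun h => β.pos.ne' (congrArg (fun x : β.K => (x : ℝ)) h)

theorem coe_emb₁ (x : β.K) : β.emb₁ x = ((x : ℝ) : ℂ) := rfl

theorem val_mem_ring : β.val ∈ β.ring := Algebra.subset_adjoin rfl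

theorem poly_eq : β.poly = (minpoly ℤ β.val).map (Int.castRingHom ℚ) :=
  minpoly.isIntegrallyClosed_eq_field_fractions' ℚ β.isIntegral

theorem deg_pos : 0 < β.deg := minpoly.natDegree_pos β.isIntegralQ

/-- The constant term of f is ±1, so f(β) = 0 can be solved for β⁻¹. This is what keeps T-preimages
and translations zβ⁻ⁿ inside ℤ[β]. -/
theorem inv_val_mem_ring : β.val⁻¹ ∈ β.ring := by
  have h := minpoly.aeval ℤ β.val
  rw [← divX_mul_X_add (minpoly ℤ β.val)] at h
  simp only [map_add, map_mul, aeval_X, eq_intCast] at h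
  have hq : aeval β.val (minpoly ℤ β.val).divX ∈ β.ring := aeval_mem_adjoin_singleton ℤ β.val
  set q := aeval β.val (minpoly ℤ β.val).divX with hq'
  have h0 := β.pos.ne'
  rcases (abs_eq zero_le_one).mp β.unit with h1 | h1
  · have : β.val⁻¹ = -q := by
      rw [h1, Int.cast_one, map_one] at h
      field_simp; linarith
    rw [this]; exact neg_mem hq
  · have : β.val⁻¹ = q := by
      rw [h1, Int.cast_neg, Int.cast_one, map_neg, map_one] at h
      field_simp; linarith
    rw [this]; exact hq

theorem ring_le_K {x : ℝ} (hx : x ∈ β.ring) : x ∈ β.K := by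
  have : β.ring ≤ β.K.toSubalgebra.restrictScalars ℤ :=
    Algebra.adjoin_le (by simp)
  exact this hx

theorem pow_mem_ring (n : ℕ) : β.val ^ n ∈ β.ring := pow_mem β.val_mem_ring n

theorem inv_pow_mem_ring (n : ℕ) : (β.val ^ n)⁻¹ ∈ β.ring := by
  rw [← inv_pow]; exact pow_mem β.inv_val_mem_ring n

theorem emb_norm_lt_one {σ : β.Emb} (h : σ ≠ β.emb₁) : ‖σ β.gen‖ < 1 := by
  refine β.pisot _ ?_ ?_
  · have h1 : aeval (σ β.gen) β.poly = 0 := by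
      rw [aeval_algHom_apply, ← minpoly_gen, minpoly.aeval, map_zero]
    rw [poly_eq] at h1
    rwa [aeval_def, eval₂_map, Subsingleton.elim ((algebraMap ℚ ℂ).comp (Int.castRingHom ℚ))
      (algebraMap ℤ ℂ), ← aeval_def] at h1
  · intro h1
    exact h (IntermediateField.algHom_ext_of_eq_adjoin ℚ rfl fun x hx => by
        obtain rfl : x = β.val := hx
        exact h1)

/-! ### The companion operator -/

/-- The companion matrix of the minimal polynomial, as an operator. -/
def companion : EuclideanSpace ℝ (Fin β.deg) →ₗ[ℝ] EuclideanSpace ℝ (Fin β.deg) where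
  toFun w := WithLp.toLp 2 fun i => if (i : ℕ) = 0 then
      -∑ j : Fin β.deg, (β.poly.coeff j : ℝ) * w (Fin.rev j)
    else w ⟨i - 1, (Nat.sub_le _ _).trans_lt i.2⟩
  map_add' u v := by
    ext i
    by_cases h : (i : ℕ) = 0
    · simp [h, mul_add, Finset.sum_add_distrib]; ring
    · simp [h]
  map_smul' c v := by
    ext i
    by_cases h : (i : ℕ) = 0
    · simp only [PiLp.smul_apply, smul_eq_mul, h, if_true, RingHom.id_apply, mul_neg,
        Finset.mul_sum]
      congr 1
      exact Finset.sum_congr rfl fun j _ => by ring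
    · simp [h]

theorem companion_apply (w : EuclideanSpace ℝ (Fin β.deg)) (i : Fin β.deg) :
    β.companion w i = if (i : ℕ) = 0 then
      -∑ j : Fin β.deg, (β.poly.coeff j : ℝ) * w (Fin.rev j)
    else w ⟨i - 1, (Nat.sub_le _ _).trans_lt i.2⟩ := rfl

theorem companion_eigvec (σ : β.Emb) (i : Fin β.deg) :
    (if (i : ℕ) = 0 then -∑ j : Fin β.deg, (β.poly.coeff j : ℂ) * β.eigvec σ (Fin.rev j)
      else β.eigvec σ ⟨i - 1, (Nat.sub_le _ _).trans_lt i.2⟩) = σ β.gen * β.eigvec σ i := by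
  split_ifs with h
  · have hroot : aeval (σ β.gen) β.poly = 0 := by
      rw [aeval_algHom_apply, ← minpoly_gen, minpoly.aeval, map_zero]
    have hm : β.poly.coeff β.deg = 1 := (minpoly.monic β.isIntegralQ).coeff_natDegree
    rw [aeval_eq_sum_range, Finset.sum_range_succ, hm, one_smul, Finset.sum_range] at hroot
    have hp : σ β.gen ^ β.deg = σ β.gen * σ β.gen ^ (β.deg - 1 - (i : ℕ)) := by
      rw [h, ← pow_succ']; congr 1; have := β.deg_pos; omega
    have : ∀ j : Fin β.deg, (β.poly.coeff j : ℂ) * β.eigvec σ (Fin.rev j) =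
        (aeval (σ β.gen) (derivative β.poly))⁻¹ * (β.poly.coeff j • σ β.gen ^ (j : ℕ)) := by
      intro j
      rw [eigvec, Algebra.smul_def, Fin.val_rev]
      have : β.deg - 1 - (β.deg - (↑j + 1)) = j := by have := j.2; omega
      rw [this, eq_ratCast]; ring
    rw [Finset.sum_congr rfl fun j _ => this j, ← Finset.mul_sum, eq_neg_of_add_eq_zero_left hroot,
      eigvec, mul_neg, neg_neg, hp]
    ring
  · rw [eigvec, eigvec]
    have : β.deg - 1 - ((i : ℕ) - 1) = β.deg - 1 - (i : ℕ) + 1 := by have := i.2; omega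
    simp only [this]
    ring

theorem companion_reVec (σ : β.Emb) : β.companion (β.reVec σ) =
    (σ β.gen).re • β.reVec σ - (σ β.gen).im • β.imVec σ := by
  ext i
  have h := congrArg Complex.re (β.companion_eigvec σ i)
  simp only [Complex.mul_re] at h
  rw [companion_apply]
  simp only [reVec, imVec, PiLp.sub_apply, PiLp.smul_apply, smul_eq_mul]
  rw [← h]
  split_ifs with h0
  · simp [Complex.mul_re]
  · rfl

theorem companion_imVec (σ : β.Emb) : β.companion (β.imVec σ) =
    (σ β.gen).re • β.imVec σ + (σ β.gen).im • β.reVec σ := by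
  ext i
  have h := congrArg Complex.im (β.companion_eigvec σ i)
  simp only [Complex.mul_im] at h
  rw [companion_apply]
  simp only [reVec, imVec, PiLp.add_apply, PiLp.smul_apply, smul_eq_mul]
  rw [← h]
  split_ifs with h0
  · simp [Complex.mul_im]
  · rfl

theorem companion_v₁ : β.companion β.v₁ = β.val • β.v₁ := by
  rw [v₁, companion_reVec]
  simp [coe_emb₁]

theorem companion_phiVec (x : β.K) : β.companion (β.phiVec x) = β.phiVec (β.gen * x) := by
  classical
  simp only [phiVec, map_sum, map_sub, map_smul, companion_reVec, companion_imVec, map_mul,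
    Complex.mul_re, Complex.mul_im]
  refine Finset.sum_congr rfl fun σ _ => ?_
  module

theorem companion_mem {h : EuclideanSpace ℝ (Fin β.deg)} (hh : h ∈ β.H) :
    β.companion h ∈ β.H := by
  suffices β.H ≤ β.H.comap β.companion from this hh
  conv_lhs => rw [H]
  rw [Submodule.span_le]
  intro v hv
  simp only [Set.mem_iUnion, Set.mem_ofPred_eq, Set.mem_insert_iff, Set.mem_singleton_iff] at hv
  obtain ⟨σ, hσ, rfl | rfl⟩ := hv
  · simp only [Submodule.comap_coe, Set.mem_preimage, companion_reVec]
    exact sub_mem (Submodule.smul_mem _ _ (β.reVec_mem hσ)) (Submodule.smul_mem _ _ (β.imVec_mem hσ))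
  · simp only [Submodule.comap_coe, Set.mem_preimage, companion_imVec]
    exact add_mem (Submodule.smul_mem _ _ (β.imVec_mem hσ)) (Submodule.smul_mem _ _ (β.reVec_mem hσ))

/-- The contraction of `H` induced by multiplication by `β`. -/
def contr : β.H →ₗ[ℝ] β.H := β.companion.restrict fun _ => β.companion_mem

theorem contr_Phi (x : β.K) : β.contr (β.Phi x) = β.Phi (β.gen * x) :=
  Subtype.ext (β.companion_phiVec x)

theorem Phi_add (x y : β.K) : β.Phi (x + y) = β.Phi x + β.Phi y := by
  classical
  refine Subtype.ext ?_
  change β.phiVec (x + y) = β.phiVec x + β.phiVec y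
  rw [phiVec, phiVec, phiVec, ← Finset.sum_add_distrib]
  refine Finset.sum_congr rfl fun σ _ => ?_
  rw [map_add, Complex.add_re, Complex.add_im]
  module

/-- `Φ` as an additive homomorphism. -/
def PhiHom : β.K →+ β.H := AddMonoidHom.mk' β.Phi β.Phi_add

theorem Phi_zero : β.Phi 0 = 0 := map_zero β.PhiHom

theorem Phi_sub (x y : β.K) : β.Phi (x - y) = β.Phi x - β.Phi y := map_sub β.PhiHom x y

theorem contr_pow_Phi (n : ℕ) (x : β.K) : (β.contr ^ n) (β.Phi x) = β.Phi (β.gen ^ n * x) := by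
  induction n with
  | zero => simp
  | succ n ih => rw [pow_succ', Module.End.mul_apply, ih, contr_Phi, ← mul_assoc, pow_succ']

/-! ### The lattice -/

/-- The vector `x v_1 + Φ(x)`. -/
def latticeVec (x : β.K) : EuclideanSpace ℝ (Fin β.deg) := (x : ℝ) • β.v₁ + β.phiVec x

theorem latticeVec_add (x y : β.K) :
    β.latticeVec (x + y) = β.latticeVec x + β.latticeVec y := by
  have := congrArg Subtype.val (β.Phi_add x y)
  change β.phiVec (x + y) = β.phiVec x + β.phiVec y at this
  rw [latticeVec, latticeVec, latticeVec, this]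
  push_cast
  module

/-- `x ↦ x v_1 + Φ(x)` as a `ℚ`-linear map. -/
def latticeMap : β.K →ₗ[ℚ] EuclideanSpace ℝ (Fin β.deg) :=
  (AddMonoidHom.mk' β.latticeVec β.latticeVec_add).toRatLinearMap

theorem latticeMap_apply (x : β.K) : β.latticeMap x = β.latticeVec x := rfl

theorem companion_latticeMap (x : β.K) :
    β.companion (β.latticeMap x) = β.latticeMap (β.gen * x) := by
  simp only [latticeMap_apply, latticeVec, map_add, map_smul, companion_v₁, companion_phiVec]
  push_cast
  rw [coe_gen]
  module

theorem coe_latticeMap (x : β.K) (i : Fin β.deg) :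
    ((β.latticeMap x i : ℝ) : ℂ) = ∑ σ : β.Emb, σ x * β.eigvec σ i := by
  classical
  rw [latticeMap_apply, latticeVec, PiLp.add_apply, PiLp.smul_apply, Complex.ofReal_add,
    coe_phiVec, smul_eq_mul, Complex.ofReal_mul, coe_v₁, ← coe_emb₁,
    ← Finset.add_sum_erase _ _ (Finset.mem_univ β.emb₁)]
  congr 2
  ext σ; simp

/-- The entries of v_j are consecutive powers of β_j, so the factor β_j^k only shifts the index; the
sum over j becomes coordinate i - k of v_1 + ⋯ + v_d = e_1. -/
theorem latticeMap_gen_pow {i k : Fin β.deg} (h : k ≤ i) :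
    β.latticeMap (β.gen ^ (k : ℕ)) i = if i = k then 1 else 0 := by
  have hk : (k : ℕ) ≤ i := h
  have h1 := β.sum_eigvec ⟨i - k, (Nat.sub_le _ _).trans_lt i.2⟩
  have h2 := β.coe_latticeMap (β.gen ^ (k : ℕ)) i
  have h3 : ∀ σ : β.Emb, σ (β.gen ^ (k : ℕ)) * β.eigvec σ i =
      β.eigvec σ ⟨i - k, (Nat.sub_le _ _).trans_lt i.2⟩ := fun σ => by
    rw [eigvec, eigvec, map_pow]
    have : β.deg - 1 - ((i : ℕ) - k) = k + (β.deg - 1 - i) := by have := i.2; omega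
    simp only [this, pow_add]
    ring
  rw [Finset.sum_congr rfl fun σ _ => h3 σ, h1] at h2
  have h4 : ((i : ℕ) - k = 0) ↔ i = k := by rw [Fin.ext_iff]; omega
  simp only [h4] at h2
  split_ifs at h2 ⊢
  · simpa using h2
  · simpa using h2

/-- The coordinate matrix is triangular with ones on the diagonal. -/
theorem linearIndependent_latticeMap :
    LinearIndependent ℝ fun k : Fin β.deg => β.latticeMap (β.gen ^ (k : ℕ)) := by
  let B : Matrix (Fin β.deg) (Fin β.deg) ℝ :=
    Matrix.of fun k i => β.latticeMap (β.gen ^ (k : ℕ)) i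
  have hdet : B.det ≠ 0 := by
    rw [Matrix.det_of_isLowerTriangular B (fun k i h => ?_)]
    · refine Finset.prod_ne_zero_iff.mpr fun i _ => ?_
      simp [B, β.latticeMap_gen_pow le_rfl]
    · have h' : k < i := h
      simp [B, β.latticeMap_gen_pow h'.le, h'.ne']
  have h := Matrix.linearIndependent_rows_of_det_ne_zero hdet
  exact LinearIndependent.of_comp (WithLp.linearEquiv 2 ℝ (Fin β.deg → ℝ)).toLinearMap h

/-- The basis of `ℝ^d` formed by the lattice vectors of `1, β, …, β^{d-1}`. -/
def latticeBasis : Module.Basis (Fin β.deg) ℝ (EuclideanSpace ℝ (Fin β.deg)) :=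
  have : Nonempty (Fin β.deg) := ⟨⟨0, β.deg_pos⟩⟩
  basisOfLinearIndependentOfCardEqFinrank β.linearIndependent_latticeMap (by simp)

theorem latticeBasis_apply (k : Fin β.deg) :
    β.latticeBasis k = β.latticeMap (β.gen ^ (k : ℕ)) := by
  simp [latticeBasis]

end PisotUnit
end BetaTiling

/-! ### The splitting ℝ v_1 ⊕ H, determinants, finiteness and density -/

namespace BetaTiling

open Polynomial MeasureTheory Filter Topology

namespace PisotUnit

variable (β : PisotUnit)

theorem proj_latticeMap (x : β.K) : β.proj (β.latticeMap x) = x := by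
  have h : β.proj (β.phiVec x) = 0 := β.proj_H (β.Phi x)
  rw [latticeMap_apply, latticeVec, map_add, map_smul, proj_v₁, h]
  simp

theorem latticeMap_injective : Function.Injective β.latticeMap := fun x y h =>
  Subtype.ext (by rw [← β.proj_latticeMap x, h, proj_latticeMap])

/-- By linearity it is enough to look at the lattice basis, where the difference is Φ(βᵏ). -/
theorem sub_proj_mem (w : EuclideanSpace ℝ (Fin β.deg)) : w - β.proj w • β.v₁ ∈ β.H := by
  have h : β.H.mkQ ∘ₗ (LinearMap.id - β.proj.smulRight β.v₁) = 0 := by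
    refine β.latticeBasis.ext fun k => ?_
    simp only [LinearMap.comp_apply, LinearMap.sub_apply, LinearMap.id_apply,
      LinearMap.smulRight_apply, LinearMap.zero_apply, latticeBasis_apply, proj_latticeMap,
      Submodule.mkQ_apply, Submodule.Quotient.mk_eq_zero]
    rw [latticeMap_apply, latticeVec, add_sub_cancel_left]
    exact β.phiVec_mem _
  exact (Submodule.Quotient.mk_eq_zero _).mp (LinearMap.congr_fun h w)

/-- The decomposition `ℝ^d = ℝ v_1 ⊕ H`. -/
def decomp : (ℝ × β.H) ≃ₗ[ℝ] EuclideanSpace ℝ (Fin β.deg) where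
  toFun p := p.1 • β.v₁ + p.2
  map_add' p q := by simp only [Prod.fst_add, Prod.snd_add, Submodule.coe_add]; module
  map_smul' c p := by
    simp only [Prod.smul_fst, Prod.smul_snd, Submodule.coe_smul, RingHom.id_apply, smul_eq_mul]
    module
  invFun w := (β.proj w, ⟨w - β.proj w • β.v₁, β.sub_proj_mem w⟩)
  left_inv p := by
    have h : β.proj (p.1 • β.v₁ + p.2) = p.1 := by
      rw [map_add, map_smul, proj_v₁, proj_H]; simp
    ext1
    · exact h
    · ext1; simp only [h]; abel
  right_inv w := by simp

theorem decomp_apply (p : ℝ × β.H) : β.decomp p = p.1 • β.v₁ + p.2 := rfl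

/-- In the lattice basis the companion operator has the matrix of multiplication by β on ℚ(β), so
its determinant is the norm of β, a unit. -/
theorem det_companion : |LinearMap.det β.companion| = 1 := by
  classical
  let pb := IntermediateField.adjoin.powerBasis β.isIntegralQ
  have hgen : pb.gen = β.gen := IntermediateField.adjoin.powerBasis_gen β.isIntegralQ
  have hdim : pb.dim = β.deg := rfl
  let B : Module.Basis (Fin β.deg) ℚ β.K := pb.basis.reindex (finCongr hdim)
  have hB : ∀ j, B j = β.gen ^ (j : ℕ) := fun j => by
    rw [Module.Basis.reindex_apply, pb.basis_eq_pow, hgen]; rfl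
  have hmat : LinearMap.toMatrix β.latticeBasis β.latticeBasis β.companion =
      (Algebra.leftMulMatrix B β.gen).map (algebraMap ℚ ℝ) := by
    ext i k
    have h1 : β.gen * B k = ∑ j, (Algebra.leftMulMatrix B β.gen j k) • B j := by
      simp only [Algebra.leftMulMatrix_eq_repr_mul]
      exact (B.sum_repr _).symm
    have h2 : ∀ j, β.latticeMap (B j) = β.latticeBasis j := fun j => by
      rw [latticeBasis_apply, hB]
    have h3 : β.companion (β.latticeBasis k) =
        ∑ j, (algebraMap ℚ ℝ (Algebra.leftMulMatrix B β.gen j k)) • β.latticeBasis j := by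
      rw [← h2, companion_latticeMap, h1, map_sum]
      refine Finset.sum_congr rfl fun j _ => ?_
      rw [map_smul, h2, algebraMap_smul]
    rw [LinearMap.toMatrix_apply, h3, Matrix.map_apply, Module.Basis.repr_sum_self]
  have hnorm : Algebra.norm ℚ β.gen = (-1) ^ β.deg * (β.poly.coeff 0) := by
    have := Algebra.PowerBasis.norm_gen_eq_coeff_zero_minpoly pb
    rw [hgen, hdim] at this
    exact this.trans (congrArg (fun p : ℚ[X] => (-1) ^ β.deg * p.coeff 0) β.minpoly_gen)
  rw [← LinearMap.det_toMatrix β.latticeBasis, hmat]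
  have hdet : ((Algebra.leftMulMatrix B β.gen).map (algebraMap ℚ ℝ)).det =
      algebraMap ℚ ℝ (Algebra.norm ℚ β.gen) := by
    rw [Algebra.norm_eq_matrix_det B, RingHom.map_det]; rfl
  have hc : |((minpoly ℤ β.val).coeff 0 : ℝ)| = 1 := by exact_mod_cast β.unit
  refine (congrArg abs hdet).trans ?_
  rw [hnorm, poly_eq, coeff_map]
  simpa [abs_mul, abs_pow] using hc

/-- The line ℝ v_1 accounts for the factor β of the total determinant ±1. -/
theorem det_contr : |LinearMap.det β.contr| = β.val⁻¹ := by
  have h : β.companion = β.decomp.toLinearMap ∘ₗ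
      (LinearMap.prodMap (β.val • LinearMap.id) β.contr) ∘ₗ β.decomp.symm.toLinearMap := by
    refine LinearMap.ext fun w => ?_
    obtain ⟨p, rfl⟩ := β.decomp.surjective w
    simp only [LinearMap.comp_apply, LinearEquiv.coe_coe, LinearEquiv.symm_apply_apply]
    simp only [decomp_apply, map_add, map_smul, companion_v₁, LinearMap.prodMap_apply,
      LinearMap.smul_apply, LinearMap.id_apply, smul_eq_mul, contr, LinearMap.coe_restrict_apply]
    module
  have h1 := β.det_companion
  rw [h, LinearMap.det_conj, LinearMap.det_prodMap, LinearMap.det_smul, LinearMap.det_id] at h1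
  simp only [Module.finrank_self, pow_one, mul_one, abs_mul, abs_of_pos β.pos] at h1
  exact eq_inv_of_mul_eq_one_right h1

theorem contr_injective : Function.Injective β.contr := by
  rw [← LinearMap.ker_eq_bot]
  by_contra hne
  have h0 : LinearMap.det β.contr = 0 := by
    by_contra h
    exact hne (LinearMap.ker_eq_bot.mpr (LinearMap.equivOfDetNeZero β.contr h).injective)
  have := β.det_contr
  rw [h0, abs_zero] at this
  exact (inv_pos.mpr β.pos).ne this

theorem contr_surjective : Function.Surjective β.contr :=
  LinearMap.injective_iff_surjective.mp β.contr_injective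

theorem contr_pow_injective (n : ℕ) : Function.Injective (β.contr ^ n) := by
  rw [Module.End.coe_pow]; exact β.contr_injective.iterate n

theorem contr_pow_surjective (n : ℕ) : Function.Surjective (β.contr ^ n) := by
  rw [Module.End.coe_pow]; exact β.contr_surjective.iterate n

/-! ### Contraction -/

theorem companion_pow_reVec (σ : β.Emb) (n : ℕ) :
    (β.companion ^ n) (β.reVec σ) =
      (σ β.gen ^ n).re • β.reVec σ - (σ β.gen ^ n).im • β.imVec σ ∧
    (β.companion ^ n) (β.imVec σ) =
      (σ β.gen ^ n).re • β.imVec σ + (σ β.gen ^ n).im • β.reVec σ := by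
  induction n with
  | zero => simp
  | succ n ih =>
    rw [pow_succ', Module.End.mul_apply, Module.End.mul_apply, ih.1, ih.2, pow_succ', Complex.mul_re,
      Complex.mul_im]
    simp only [map_add, map_sub, map_smul, companion_reVec, companion_imVec]
    constructor <;> module

theorem exists_rho : ∃ ρ : ℝ, 0 < ρ ∧ ρ < 1 ∧ ∀ σ : β.Emb, σ ≠ β.emb₁ → ‖σ β.gen‖ ≤ ρ := by
  classical
  let s : Finset ℝ := insert (1 / 2) ((Finset.univ.filter fun σ : β.Emb => σ ≠ β.emb₁).image
    fun σ => ‖σ β.gen‖)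
  have hs : s.Nonempty := Finset.insert_nonempty _ _
  refine ⟨s.max' hs, ?_, ?_, ?_⟩
  · exact lt_of_lt_of_le (by norm_num) (s.le_max' (1 / 2) (Finset.mem_insert_self _ _))
  · rw [Finset.max'_lt_iff]
    intro y hy
    rcases Finset.mem_insert.mp hy with rfl | hy
    · norm_num
    · obtain ⟨σ, hσ, rfl⟩ := Finset.mem_image.mp hy
      exact β.emb_norm_lt_one (by simpa using hσ)
  · intro σ hσ
    exact s.le_max' _ (Finset.mem_insert_of_mem (Finset.mem_image_of_mem _ (by simpa using hσ)))

theorem coe_contr_pow (n : ℕ) (h : β.H) :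
    (((β.contr ^ n) h : β.H) : EuclideanSpace ℝ (Fin β.deg)) = (β.companion ^ n) h := by
  induction n with
  | zero => rfl
  | succ n ih =>
    rw [pow_succ', pow_succ', Module.End.mul_apply, Module.End.mul_apply, ← ih]; rfl

/-- Vectors whose orbit decays like ρⁿ form a subspace, and it contains the generators of H.
Banach–Steinhaus makes the constant uniform. A constant C is needed because a single application of
M need not shrink the Euclidean norm. -/
theorem exists_contr_bound : ∃ C ρ : ℝ, 0 < C ∧ 0 < ρ ∧ ρ < 1 ∧
    ∀ (n : ℕ) (h : β.H), ‖(β.contr ^ n) h‖ ≤ C * ρ ^ n * ‖h‖ := by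
  obtain ⟨ρ, h0, h1, hρ⟩ := β.exists_rho
  let W : Submodule ℝ (EuclideanSpace ℝ (Fin β.deg)) :=
    { carrier := {w | ∃ C : ℝ, ∀ n : ℕ, ‖(β.companion ^ n) w‖ ≤ C * ρ ^ n}
      add_mem' := by
        rintro u v ⟨C, hC⟩ ⟨C', hC'⟩
        refine ⟨C + C', fun n => ?_⟩
        rw [map_add, add_mul]
        exact (norm_add_le _ _).trans (add_le_add (hC n) (hC' n))
      zero_mem' := ⟨0, fun n => by simp⟩
      smul_mem' := by
        rintro c v ⟨C, hC⟩
        refine ⟨‖c‖ * C, fun n => ?_⟩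
        rw [map_smul, norm_smul, mul_assoc]
        exact mul_le_mul_of_nonneg_left (hC n) (norm_nonneg _) }
  have hW : β.H ≤ W := by
    rw [H, Submodule.span_le]
    intro v hv
    simp only [Set.mem_iUnion, Set.mem_ofPred_eq, Set.mem_insert_iff, Set.mem_singleton_iff] at hv
    obtain ⟨σ, hσ, hv⟩ := hv
    have hn : ∀ n, ‖σ β.gen ^ n‖ ≤ ρ ^ n := fun n => by
      rw [norm_pow]; exact pow_le_pow_left₀ (norm_nonneg _) (hρ σ hσ) n
    have key : ∀ (n : ℕ) (a b : EuclideanSpace ℝ (Fin β.deg)),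
        ‖(σ β.gen ^ n).re • a‖ + ‖(σ β.gen ^ n).im • b‖ ≤ (‖a‖ + ‖b‖) * ρ ^ n := fun n a b => by
      rw [norm_smul, norm_smul, add_mul, mul_comm, mul_comm ‖b‖, Real.norm_eq_abs, Real.norm_eq_abs,
        mul_comm ‖a‖, mul_comm ‖a‖]
      gcongr
      · exact (Complex.abs_re_le_norm _).trans (hn n)
      · exact (Complex.abs_im_le_norm _).trans (hn n)
    rcases hv with rfl | rfl
    · refine ⟨‖β.reVec σ‖ + ‖β.imVec σ‖, fun n => ?_⟩
      rw [(β.companion_pow_reVec σ n).1]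
      exact (norm_sub_le _ _).trans (key n _ _)
    · refine ⟨‖β.imVec σ‖ + ‖β.reVec σ‖, fun n => ?_⟩
      rw [(β.companion_pow_reVec σ n).2]
      exact (norm_add_le _ _).trans (key n _ _)
  obtain ⟨C, hC⟩ := banach_steinhaus
    (g := fun n : ℕ => (ρ ^ n)⁻¹ • LinearMap.toContinuousLinearMap (β.contr ^ n)) (fun h => by
      obtain ⟨C, hC⟩ := hW h.2
      refine ⟨C, fun n => ?_⟩
      have hp : 0 < ρ ^ n := pow_pos h0 n
      have h2 := hC n
      rw [← coe_contr_pow] at h2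
      rw [smul_apply, norm_smul, norm_inv, Real.norm_of_nonneg hp.le,
        inv_mul_le_iff₀ hp, mul_comm]
      exact h2)
  refine ⟨max C 1, ρ, by positivity, h0, h1, fun n h => ?_⟩
  have hp : 0 < ρ ^ n := pow_pos h0 n
  have h2 := ContinuousLinearMap.le_of_opNorm_le _ ((hC n).trans (le_max_left C 1)) h
  rw [smul_apply, norm_smul, norm_inv, Real.norm_of_nonneg hp.le,
        inv_mul_le_iff₀ hp] at h2
  refine h2.trans_eq ?_
  ring

/-! ### Finiteness and density -/

theorem mem_ring_iff (z : EuclideanSpace ℝ (Fin β.deg)) :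
    z ∈ Submodule.span ℤ (Set.range β.latticeBasis) ↔
      ∃ x : β.K, (x : ℝ) ∈ β.ring ∧ β.latticeMap x = z := by
  let pb := Algebra.adjoin.powerBasis' β.isIntegral
  have hdim : pb.dim = β.deg := by
    rw [Algebra.adjoin.powerBasis'_dim, deg, poly_eq, natDegree_map_eq_of_injective]
    exact Int.cast_injective
  constructor
  · intro hz
    induction hz using Submodule.span_induction with
    | mem x hx =>
      obtain ⟨k, rfl⟩ := hx
      exact ⟨β.gen ^ (k : ℕ), by push_cast; exact β.pow_mem_ring k, (β.latticeBasis_apply k).symm⟩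
    | zero => exact ⟨0, by simp, map_zero _⟩
    | add u v _ _ hu hv =>
      obtain ⟨x, hx, rfl⟩ := hu
      obtain ⟨y, hy, rfl⟩ := hv
      exact ⟨x + y, by push_cast; exact add_mem hx hy, map_add _ _ _⟩
    | smul c u _ hu =>
      obtain ⟨x, hx, rfl⟩ := hu
      exact ⟨c • x, by push_cast; exact zsmul_mem hx c, map_zsmul _ _ _⟩
  · rintro ⟨x, hx, rfl⟩
    have h1 := pb.basis.sum_repr ⟨x, hx⟩
    have h2 : x = ∑ i, (pb.basis.repr ⟨x, hx⟩ i) • β.gen ^ (i : ℕ) := by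
      refine Subtype.ext ?_
      have h3 := congrArg (fun y : β.ring => (y : ℝ)) h1
      simp only [PowerBasis.coe_basis] at h3
      refine h3.symm.trans ?_
      push_cast
      simp only [pb, Algebra.adjoin.powerBasis'_gen]
      rfl
    rw [h2, map_sum]
    refine Submodule.sum_mem _ fun i _ => ?_
    rw [map_zsmul]
    refine Submodule.smul_mem _ _ (Submodule.subset_span ⟨Fin.cast hdim i, ?_⟩)
    rw [latticeBasis_apply]; rfl

/-- These are the points of the lattice in a ball. -/
theorem finite_bounded (R R' : ℝ) :
    {x : β.K | (x : ℝ) ∈ β.ring ∧ |(x : ℝ)| ≤ R ∧ ‖β.Phi x‖ ≤ R'}.Finite := by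
  have hb : Bornology.IsBounded
      (Metric.closedBall (0 : EuclideanSpace ℝ (Fin β.deg)) (R * ‖β.v₁‖ + R')) :=
    Metric.isBounded_closedBall
  refine Set.Finite.of_finite_image ((ZSpan.setFinite_inter β.latticeBasis hb).subset ?_)
    β.latticeMap_injective.injOn
  rintro _ ⟨x, ⟨hx, h1, h2⟩, rfl⟩
  refine ⟨?_, (β.mem_ring_iff _).mpr ⟨x, hx, rfl⟩⟩
  rw [mem_closedBall_zero_iff, latticeMap_apply, latticeVec]
  refine (norm_add_le _ _).trans (add_le_add ?_ h2)
  rw [norm_smul]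
  exact mul_le_mul_of_nonneg_right h1 (norm_nonneg _)

theorem exists_dense_aux : ∃ c : ℝ, ∀ h : β.H, ∃ z : β.K, (z : ℝ) ∈ β.ring ∧ 0 ≤ (z : ℝ) ∧
    ‖β.Phi z - h‖ ≤ c := by
  let B := ∑ i, ‖β.latticeBasis i‖
  let e := β.decomp.symm.toContinuousLinearEquiv.toContinuousLinearMap
  refine ⟨‖e‖ * B, fun h => ?_⟩
  -- The first coordinate is the largest error that rounding to the lattice can cause there, so the
  -- rounded point has z ≥ 0.
  let w := β.decomp (‖e‖ * B, h)
  obtain ⟨z, hz, hzw⟩ := (β.mem_ring_iff _).mp (ZSpan.floor β.latticeBasis w).2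
  have hf : ‖w - β.latticeMap z‖ ≤ B := by
    rw [hzw]; exact ZSpan.norm_fract_le β.latticeBasis w
  have hd : β.latticeMap z = β.decomp ((z : ℝ), β.Phi z) := rfl
  have he : e (w - β.latticeMap z) = (‖e‖ * B - z, h - β.Phi z) := by
    rw [hd, ← map_sub]
    exact β.decomp.symm_apply_apply _
  have hle : ‖e (w - β.latticeMap z)‖ ≤ ‖e‖ * B :=
    (e.le_opNorm _).trans (mul_le_mul_of_nonneg_left hf (norm_nonneg e))
  rw [he] at hle
  refine ⟨z, hz, ?_, ?_⟩
  · have := (norm_fst_le _).trans hle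
    simp only [Real.norm_eq_abs] at this
    have := (le_abs_self _).trans this
    linarith
  · rw [norm_sub_rev]; exact (norm_snd_le _).trans hle

/-- Approximate M⁻ⁿh up to a fixed error and multiply by βⁿ: the error shrinks by Cρⁿ. -/
theorem exists_Phi_near (h : β.H) {ε : ℝ} (hε : 0 < ε) : ∃ z : β.K, (z : ℝ) ∈ β.ring ∧
    0 ≤ (z : ℝ) ∧ ‖β.Phi z - h‖ < ε := by
  obtain ⟨c, hc⟩ := β.exists_dense_aux
  obtain ⟨C, ρ, hC, h0, h1, hb⟩ := β.exists_contr_bound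
  have ht : Tendsto (fun n : ℕ => C * ρ ^ n * c) atTop (𝓝 0) := by
    simpa using ((tendsto_pow_atTop_nhds_zero_of_lt_one h0.le h1).const_mul C).mul_const c
  obtain ⟨n, hn⟩ := (ht.eventually (gt_mem_nhds hε)).exists
  obtain ⟨h', rfl⟩ := β.contr_pow_surjective n h
  obtain ⟨z, hz, hz0, hzh⟩ := hc h'
  refine ⟨β.gen ^ n * z, ?_, ?_, ?_⟩
  · push_cast; exact mul_mem (β.pow_mem_ring n) hz
  · push_cast; exact mul_nonneg (pow_nonneg β.pos.le n) hz0
  · rw [← contr_pow_Phi, ← map_sub]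
    refine lt_of_le_of_lt ((hb n _).trans ?_) hn
    exact mul_le_mul_of_nonneg_left hzh (by positivity)

end PisotUnit
end BetaTiling

/-! ### One-sided continuity of T and T̃, and backward orbits -/

namespace BetaTiling

open MeasureTheory Filter Topology

theorem eventually_mem_Ico_right (l r x : ℝ) :
    ∀ᶠ y in 𝓝[≥] x, (y ∈ Set.Ico l r ↔ x ∈ Set.Ico l r) := by
  have hge : ∀ᶠ y in 𝓝[≥] x, x ≤ y := self_mem_nhdsWithin
  by_cases hr : r ≤ x
  · filter_upwards [hge] with y hy
    simp only [Set.mem_Ico]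
    constructor <;> intro h <;> linarith [h.2]
  · have hlt : ∀ᶠ y in 𝓝[≥] x, y < r := nhdsWithin_le_nhds (gt_mem_nhds (not_le.mp hr))
    by_cases hl : l ≤ x
    · filter_upwards [hge, hlt] with y hy hy'
      simp only [Set.mem_Ico]
      exact ⟨fun _ => ⟨hl, not_le.mp hr⟩, fun _ => ⟨hl.trans hy, hy'⟩⟩
    · have hlt' : ∀ᶠ y in 𝓝[≥] x, y < l := nhdsWithin_le_nhds (gt_mem_nhds (not_le.mp hl))
      filter_upwards [hlt'] with y hy
      simp only [Set.mem_Ico]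
      constructor <;> intro h <;> linarith [h.1]

theorem eventually_mem_Ico_left (l r x : ℝ) :
    ∀ᶠ y in 𝓝[<] x, (y ∈ Set.Ico l r ↔ x ∈ Set.Ioc l r) := by
  have hlt : ∀ᶠ y in 𝓝[<] x, y < x := self_mem_nhdsWithin
  by_cases hl : x ≤ l
  · filter_upwards [hlt] with y hy
    simp only [Set.mem_Ico, Set.mem_Ioc]
    constructor <;> intro h <;> linarith [h.1]
  · have hgt : ∀ᶠ y in 𝓝[<] x, l < y := nhdsWithin_le_nhds (lt_mem_nhds (not_le.mp hl))
    by_cases hr : x ≤ r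
    · filter_upwards [hlt, hgt] with y hy hy'
      simp only [Set.mem_Ico, Set.mem_Ioc]
      exact ⟨fun _ => ⟨not_le.mp hl, hr⟩, fun _ => ⟨hy'.le, hy.trans_le hr⟩⟩
    · have hgt' : ∀ᶠ y in 𝓝[<] x, r < y := nhdsWithin_le_nhds (lt_mem_nhds (not_le.mp hr))
      filter_upwards [hgt'] with y hy
      simp only [Set.mem_Ico, Set.mem_Ioc]
      constructor <;> intro h <;> linarith [h.2]

theorem tendsto_affine_right (x c k : ℝ) (hk : 0 < k) :
    Tendsto (fun y => c + k * (y - x)) (𝓝[≥] x) (𝓝[≥] c) := by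
  refine tendsto_nhdsWithin_iff.mpr ⟨?_, ?_⟩
  · have h : ContinuousAt (fun y => c + k * (y - x)) x := by fun_prop
    have := h.tendsto.mono_left (nhdsWithin_le_nhds (s := Set.Ici x))
    simpa using this
  · filter_upwards [self_mem_nhdsWithin] with y hy
    have : 0 ≤ y - x := sub_nonneg.mpr hy
    simp only [Set.mem_Ici]; nlinarith

theorem tendsto_affine_left (x c k : ℝ) (hk : 0 < k) :
    Tendsto (fun y => c + k * (y - x)) (𝓝[<] x) (𝓝[<] c) := by
  refine tendsto_nhdsWithin_iff.mpr ⟨?_, ?_⟩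
  · have h : ContinuousAt (fun y => c + k * (y - x)) x := by fun_prop
    have := h.tendsto.mono_left (nhdsWithin_le_nhds (s := Set.Iio x))
    simpa using this
  · filter_upwards [self_mem_nhdsWithin] with y hy
    have : y - x < 0 := sub_neg.mpr hy
    simp only [Set.mem_Iio]; nlinarith

/-- A backward orbit of `f` which stays in a finite set is periodic. -/
theorem exists_period_of_backward {α : Type*} {f : α → α} {w : ℕ → α}
    (hw : ∀ n, f (w (n + 1)) = w n) (hfin : (Set.range w).Finite) :
    ∃ N, 1 ≤ N ∧ w N = w 0 := by
  have hit : ∀ i k, f^[i] (w (i + k)) = w k := by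
    intro i
    induction i with
    | zero => intro k; simp
    | succ i ih => intro k; rw [Function.iterate_succ_apply, add_right_comm, hw, ih]
  have hex : ∃ i j, i < j ∧ w i = w j := by
    obtain ⟨i, -, j, -, hne, h⟩ := Set.infinite_univ.exists_ne_map_eq_of_mapsTo
      (f := w) (t := Set.range w) (fun n _ => Set.mem_range_self n) hfin
    rcases hne.lt_or_gt with h1 | h1
    · exact ⟨i, j, h1, h⟩
    · exact ⟨j, i, h1, h.symm⟩
  obtain ⟨i, j, hij, h⟩ := hex
  refine ⟨j - i, by omega, ?_⟩
  have h1 := hit i 0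
  rw [add_zero, h, show j = i + (j - i) by omega, hit] at h1
  exact h1

theorem iterate_backward {α : Type*} {f : α → α} {w : ℕ → α}
    (hw : ∀ n, f (w (n + 1)) = w n) (i k : ℕ) : f^[i] (w (i + k)) = w k := by
  induction i generalizing k with
  | zero => simp
  | succ i ih => rw [Function.iterate_succ_apply, add_right_comm, hw, ih]

theorem exists_backward {α : Type*} {f : α → α} {Y : Set α}
    (hf : ∀ x ∈ Y, ∃ y ∈ Y, f y = x) {x : α} (hx : x ∈ Y) :
    ∃ w : ℕ → α, w 0 = x ∧ (∀ n, w n ∈ Y) ∧ ∀ n, f (w (n + 1)) = w n := by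
  choose g hg hfg using hf
  let w : ℕ → Y := fun n => Nat.rec ⟨x, hx⟩ (fun _ y => ⟨g y y.2, hg y y.2⟩) n
  exact ⟨fun n => (w n).1, rfl, fun n => (w n).2, fun n => hfg (w n).1 (w n).2⟩

/-- If `f` maps `Y` onto `Y` and `Y \ Z` is finite, then every point of `Y \ Z` whose orbit meets
`Z` lies in the forward orbit of a point of `Y ∩ Z`. -/
theorem exists_iterate_eq_of_mem_inter {α : Type*} {f : α → α} {Y Z : Set α}
    (hf : ∀ x ∈ Y, ∃ y ∈ Y, f y = x) (hfin : (Y \ Z).Finite) {q : α} (hq : q ∈ Y) {n : ℕ}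
    (hn : f^[n] q ∈ Z) : ∃ k, ∃ q' ∈ Y ∩ Z, f^[k] q' = q := by
  obtain ⟨w, rfl, hwY, hw⟩ := exists_backward hf hq
  -- A backward orbit that avoids Z stays in the finite set Y \ Z and is therefore a cycle. The
  -- forward orbit of q runs through the same cycle and would never reach Z.
  by_contra! hcon
  have hwZ : ∀ k, w k ∉ Z := fun k hk => hcon k (w k) ⟨hwY k, hk⟩ (by
    have := iterate_backward hw k 0
    simpa using this)
  obtain ⟨N, hN, hper⟩ := exists_period_of_backward hw
    (hfin.subset (by rintro _ ⟨k, rfl⟩; exact ⟨hwY k, hwZ k⟩))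
  have : ∀ n, ∃ k, f^[n] (w 0) = w k := by
    intro n
    induction n with
    | zero => exact ⟨0, rfl⟩
    | succ n ih =>
      obtain ⟨k, hk⟩ := ih
      rw [Function.iterate_succ_apply', hk]
      rcases k with _ | k
      · refine ⟨N - 1, ?_⟩
        rw [← hper, show N = N - 1 + 1 by omega, hw]; simp
      · exact ⟨k, hw k⟩
  obtain ⟨k, hk⟩ := this n
  exact hwZ k (hk ▸ hn)

namespace BetaTransformation

variable {β : PisotUnit} (T : BetaTransformation β)

theorem mem_X {x : ℝ} : x ∈ T.X ↔ ∃ a ∈ T.A, x ∈ T.piece a := by simp [X]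

theorem mem_X' {x : ℝ} : x ∈ T.X' ↔ ∃ a ∈ T.A, x ∈ T.piece' a := by simp [X']

theorem mem_piece {x : ℝ} {a : β.K} : x ∈ T.piece a ↔ ∃ p ∈ T.I a, x ∈ Set.Ico p.1 p.2 := by
  simp only [piece, Set.mem_iUnion, exists_prop]

theorem mem_piece' {x : ℝ} {a : β.K} : x ∈ T.piece' a ↔ ∃ p ∈ T.I a, x ∈ Set.Ioc p.1 p.2 := by
  simp only [piece', Set.mem_iUnion, exists_prop]

theorem piece_right (a : β.K) (x : ℝ) : ∀ᶠ y in 𝓝[≥] x, (y ∈ T.piece a ↔ x ∈ T.piece a) := by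
  have : ∀ᶠ y in 𝓝[≥] x, ∀ p ∈ T.I a, (y ∈ Set.Ico p.1 p.2 ↔ x ∈ Set.Ico p.1 p.2) :=
    (Filter.eventually_all_finset _).mpr fun p _ => eventually_mem_Ico_right _ _ _
  filter_upwards [this] with y hy
  rw [mem_piece, mem_piece]
  exact exists_congr fun p => and_congr_right fun hp => hy p hp

theorem piece_left (a : β.K) (x : ℝ) : ∀ᶠ y in 𝓝[<] x, (y ∈ T.piece a ↔ x ∈ T.piece' a) := by
  have : ∀ᶠ y in 𝓝[<] x, ∀ p ∈ T.I a, (y ∈ Set.Ico p.1 p.2 ↔ x ∈ Set.Ioc p.1 p.2) :=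
    (Filter.eventually_all_finset _).mpr fun p _ => eventually_mem_Ico_left _ _ _
  filter_upwards [this] with y hy
  rw [mem_piece, mem_piece']
  exact exists_congr fun p => and_congr_right fun hp => hy p hp

theorem X_right (x : ℝ) : ∀ᶠ y in 𝓝[≥] x, (y ∈ T.X ↔ x ∈ T.X) := by
  have : ∀ᶠ y in 𝓝[≥] x, ∀ a ∈ T.A, (y ∈ T.piece a ↔ x ∈ T.piece a) :=
    (Filter.eventually_all_finset _).mpr fun a _ => T.piece_right _ _
  filter_upwards [this] with y hy
  rw [mem_X, mem_X]
  exact exists_congr fun p => and_congr_right fun hp => hy p hp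

theorem X_left (x : ℝ) : ∀ᶠ y in 𝓝[<] x, (y ∈ T.X ↔ x ∈ T.X') := by
  have : ∀ᶠ y in 𝓝[<] x, ∀ a ∈ T.A, (y ∈ T.piece a ↔ x ∈ T.piece' a) :=
    (Filter.eventually_all_finset _).mpr fun a _ => T.piece_left _ _
  filter_upwards [this] with y hy
  rw [mem_X, mem_X']
  exact exists_congr fun p => and_congr_right fun hp => hy p hp

theorem eq_of_mem_piece {x : ℝ} {a a' : β.K} (ha : a ∈ T.A) (ha' : a' ∈ T.A)
    (hx : x ∈ T.piece a) (hx' : x ∈ T.piece a') : a = a' := by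
  by_contra hne
  exact Set.disjoint_left.mp (T.disjoint a ha a' ha' hne) hx hx'

theorem digit_spec {x : ℝ} (hx : x ∈ T.X) : T.digit x ∈ T.A ∧ x ∈ T.piece (T.digit x) := by
  have h := T.mem_X.mp hx
  rw [digit, dif_pos h]
  exact h.choose_spec

theorem digit_eq {x : ℝ} {a : β.K} (ha : a ∈ T.A) (hx : x ∈ T.piece a) : T.digit x = a :=
  have h := T.digit_spec (T.mem_X.mpr ⟨a, ha, hx⟩)
  T.eq_of_mem_piece h.1 ha h.2 hx

theorem digit'_spec {x : ℝ} (hx : x ∈ T.X') : T.digit' x ∈ T.A ∧ x ∈ T.piece' (T.digit' x) := by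
  have h := T.mem_X'.mp hx
  rw [digit', dif_pos h]
  exact h.choose_spec

/-- The sets X̃_a inherit disjointness from the X_a: points just to the left of x lie in X_a exactly
when x lies in X̃_a. -/
theorem digit'_eq {x : ℝ} {a : β.K} (ha : a ∈ T.A) (hx : x ∈ T.piece' a) : T.digit' x = a := by
  have h := T.digit'_spec (T.mem_X'.mpr ⟨a, ha, hx⟩)
  obtain ⟨y, h1, h2⟩ := ((T.piece_left a x).and (T.piece_left (T.digit' x) x)).exists
  exact T.eq_of_mem_piece h.1 ha (h2.mpr h.2) (h1.mpr hx)

theorem digit_mem (x : ℝ) : T.digit x ∈ insert 0 (T.A : Set β.K) := by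
  by_cases h : x ∈ T.X
  · exact Or.inr (T.digit_spec h).1
  · left; rw [digit, dif_neg (fun h' => h (T.mem_X.mpr h'))]

theorem digit'_mem (x : ℝ) : T.digit' x ∈ insert 0 (T.A : Set β.K) := by
  by_cases h : x ∈ T.X'
  · exact Or.inr (T.digit'_spec h).1
  · left; rw [digit', dif_neg (fun h' => h (T.mem_X'.mpr h'))]

theorem digit_right {x : ℝ} (hx : x ∈ T.X) :
    ∀ᶠ y in 𝓝[≥] x, y ∈ T.X ∧ T.digit y = T.digit x := by
  have h := T.digit_spec hx
  filter_upwards [T.piece_right (T.digit x) x] with y hy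
  have h2 := hy.mpr h.2
  exact ⟨T.mem_X.mpr ⟨_, h.1, h2⟩, T.digit_eq h.1 h2⟩

theorem digit_left {x : ℝ} (hx : x ∈ T.X') :
    ∀ᶠ y in 𝓝[<] x, y ∈ T.X ∧ T.digit y = T.digit' x := by
  have h := T.digit'_spec hx
  filter_upwards [T.piece_left (T.digit' x) x] with y hy
  have h2 := hy.mpr h.2
  exact ⟨T.mem_X.mpr ⟨_, h.1, h2⟩, T.digit_eq h.1 h2⟩

theorem map_mem {x : ℝ} (hx : x ∈ T.X) : T.map x ∈ T.X := by
  have h := T.digit_spec hx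
  have h1 : T.map x ∈ ⋃ a ∈ T.A, (fun x : ℝ => β.val * x - (a : ℝ)) ''
      ⋃ p ∈ T.I a, Set.Ico p.1 p.2 :=
    Set.mem_biUnion h.1 ⟨x, h.2, rfl⟩
  rw [T.image_eq] at h1
  exact h1

theorem exists_map_eq {x : ℝ} (hx : x ∈ T.X) : ∃ y ∈ T.X, T.map y = x := by
  have h1 : x ∈ ⋃ a ∈ T.A, ⋃ p ∈ T.I a, Set.Ico p.1 p.2 := hx
  rw [← T.image_eq] at h1
  simp only [Set.mem_iUnion₂] at h1
  obtain ⟨a, ha, y, hy, rfl⟩ := h1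
  refine ⟨y, T.mem_X.mpr ⟨a, ha, hy⟩, ?_⟩
  rw [map, T.digit_eq ha hy]

theorem iterate_mem {x : ℝ} (hx : x ∈ T.X) (n : ℕ) : T.map^[n] x ∈ T.X := by
  induction n with
  | zero => exact hx
  | succ n ih => rw [Function.iterate_succ_apply']; exact T.map_mem ih

theorem iterate_right {x : ℝ} (hx : x ∈ T.X) (n : ℕ) :
    ∀ᶠ y in 𝓝[≥] x, T.map^[n] y = T.map^[n] x + β.val ^ n * (y - x) := by
  induction n generalizing x with
  | zero => exact Eventually.of_forall fun y => by simp
  | succ n ih =>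
    have h1 := (tendsto_affine_right x (T.map x) β.val β.pos).eventually (ih (T.map_mem hx))
    filter_upwards [h1, T.digit_right hx] with y hy hd
    have h2 : T.map y = T.map x + β.val * (y - x) := by rw [map, map, hd.2]; ring
    rw [Function.iterate_succ_apply, Function.iterate_succ_apply, h2, hy]
    ring

theorem map'_left {x : ℝ} (hx : x ∈ T.X') :
    ∀ᶠ y in 𝓝[<] x, T.map y = T.map' x + β.val * (y - x) := by
  filter_upwards [T.digit_left hx] with y hd
  rw [map, map', hd.2]; ring

/-- T̃ is the left limit of T, so invariance of X passes to X̃ through points slightly to the left.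
-/
theorem map'_mem {x : ℝ} (hx : x ∈ T.X') : T.map' x ∈ T.X' := by
  have h1 := (tendsto_affine_left x (T.map' x) β.val β.pos).eventually (T.X_left (T.map' x))
  obtain ⟨y, h1, h2, h3⟩ := (h1.and ((T.map'_left hx).and (T.digit_left hx))).exists
  rw [← h1, ← h2]
  exact T.map_mem h3.1

theorem iterate'_mem {x : ℝ} (hx : x ∈ T.X') (n : ℕ) : T.map'^[n] x ∈ T.X' := by
  induction n with
  | zero => exact hx
  | succ n ih => rw [Function.iterate_succ_apply']; exact T.map'_mem ih

/-- A point y slightly to the left of x has a T-preimage with some digit a; then (x + a)/β lies in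
X̃_a. -/
theorem exists_map'_eq {x : ℝ} (hx : x ∈ T.X') : ∃ y ∈ T.X', T.map' y = x := by
  have h1 : ∀ᶠ y in 𝓝[<] x, ∀ a ∈ T.A, ((x + a) / β.val + β.val⁻¹ * (y - x) ∈ T.piece a ↔
      (x + a) / β.val ∈ T.piece' a) := (Filter.eventually_all_finset _).mpr fun a _ =>
    (tendsto_affine_left x ((x + a) / β.val) β.val⁻¹ (inv_pos.mpr β.pos)).eventually
      (T.piece_left a _)
  obtain ⟨y, h1, h2⟩ := (h1.and (T.X_left x)).exists
  obtain ⟨z, hz, hzy⟩ := T.exists_map_eq (h2.mpr hx)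
  have hd := T.digit_spec hz
  have h0 := β.pos.ne'
  have h3 := (h1 _ hd.1).mp (by
    convert hd.2 using 1
    rw [map] at hzy
    rw [← hzy]; field_simp; ring)
  refine ⟨_, T.mem_X'.mpr ⟨_, hd.1, h3⟩, ?_⟩
  rw [map', T.digit'_eq hd.1 h3]
  field_simp; ring

theorem iterate_left {x : ℝ} (hx : x ∈ T.X') (n : ℕ) :
    ∀ᶠ y in 𝓝[<] x, T.map^[n] y = T.map'^[n] x + β.val ^ n * (y - x) := by
  induction n generalizing x with
  | zero => exact Eventually.of_forall fun y => by simp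
  | succ n ih =>
    have h1 := (tendsto_affine_left x (T.map' x) β.val β.pos).eventually (ih (T.map'_mem hx))
    filter_upwards [h1, T.map'_left hx] with y hy h2
    rw [Function.iterate_succ_apply, Function.iterate_succ_apply, h2, hy]
    ring

theorem X_sdiff_finite : (T.X \ T.X').Finite := by
  refine (T.A.finite_toSet.biUnion fun a _ => ((T.I a).finite_toSet.image Prod.fst)).subset ?_
  rintro x ⟨hx, hx'⟩
  obtain ⟨a, ha, h⟩ := T.mem_X.mp hx
  obtain ⟨p, hp, h⟩ := T.mem_piece.mp h
  refine Set.mem_biUnion ha ⟨p, hp, ?_⟩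
  by_contra hne
  exact hx' (T.mem_X'.mpr ⟨a, ha, T.mem_piece'.mpr ⟨p, hp, h.1.lt_of_ne hne, h.2.le⟩⟩)

theorem X'_sdiff_finite : (T.X' \ T.X).Finite := by
  refine (T.A.finite_toSet.biUnion fun a _ => ((T.I a).finite_toSet.image Prod.snd)).subset ?_
  rintro x ⟨hx, hx'⟩
  obtain ⟨a, ha, h⟩ := T.mem_X'.mp hx
  obtain ⟨p, hp, h⟩ := T.mem_piece'.mp h
  refine Set.mem_biUnion ha ⟨p, hp, ?_⟩
  by_contra hne
  exact hx' (T.mem_X.mpr ⟨a, ha, T.mem_piece.mpr ⟨p, hp, h.1.le, h.2.lt_of_ne' hne⟩⟩)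

theorem exists_bound_X : ∃ R : ℝ, 0 ≤ R ∧ ∀ x ∈ T.X, |x| ≤ R := by
  have h : Bornology.IsBounded T.X := by
    rw [X, Bornology.isBounded_biUnion_finset]
    intro a _
    rw [piece, Bornology.isBounded_biUnion_finset]
    exact fun p _ => Metric.isBounded_Ico _ _
  obtain ⟨R, hR⟩ := h.exists_norm_le
  exact ⟨max R 0, le_max_right _ _, fun x hx => (hR x hx).trans (le_max_left _ _)⟩

theorem measurableSet_piece (a : β.K) : MeasurableSet (T.piece a) :=
  Finset.measurableSet_biUnion _ fun _ _ => measurableSet_Ico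

theorem measurableSet_X : MeasurableSet T.X :=
  Finset.measurableSet_biUnion _ fun a _ => T.measurableSet_piece a

/-- The expansion determines the point. -/
theorem expansion_injOn {x y : ℝ} (hx : x ∈ T.X) (hy : y ∈ T.X)
    (h : ∀ n, T.expansion x n = T.expansion y n) : x = y := by
  have key : ∀ n, T.map^[n] x - T.map^[n] y = β.val ^ n * (x - y) := by
    intro n
    induction n with
    | zero => simp
    | succ n ih =>
      have := h n
      rw [expansion, expansion] at this
      rw [Function.iterate_succ_apply', Function.iterate_succ_apply', map, map, this, pow_succ',
        mul_assoc, ← ih]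
      ring
  obtain ⟨R, -, hR⟩ := T.exists_bound_X
  by_contra hne
  have hpos : 0 < |x - y| := abs_pos.mpr (sub_ne_zero.mpr hne)
  obtain ⟨n, hn⟩ := pow_unbounded_of_one_lt ((R + R) / |x - y|) β.one_lt
  rw [div_lt_iff₀ hpos] at hn
  have h1 := abs_sub (T.map^[n] x) (T.map^[n] y)
  rw [key, abs_mul, abs_of_pos (pow_pos β.pos n)] at h1
  linarith [hR _ (T.iterate_mem hx n), hR _ (T.iterate_mem hy n)]

end BetaTransformation
end BetaTiling

/-! ### The sets 𝒟_x through backward orbits: set equation and compactness -/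

namespace BetaTiling

open MeasureTheory Filter Topology

namespace PisotUnit

variable (β : PisotUnit)

/-- A constant `C` with `‖M^n‖ ≤ C ρ^n`. -/
def contrConst : ℝ := β.exists_contr_bound.choose

/-- A contraction ratio `ρ < 1` with `‖M^n‖ ≤ C ρ^n`. -/
def rho : ℝ := β.exists_contr_bound.choose_spec.choose

theorem contrConst_pos : 0 < β.contrConst := β.exists_contr_bound.choose_spec.choose_spec.1

theorem rho_pos : 0 < β.rho := β.exists_contr_bound.choose_spec.choose_spec.2.1

theorem rho_lt_one : β.rho < 1 := β.exists_contr_bound.choose_spec.choose_spec.2.2.1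

theorem norm_contr_pow_le (n : ℕ) (h : β.H) :
    ‖(β.contr ^ n) h‖ ≤ β.contrConst * β.rho ^ n * ‖h‖ :=
  β.exists_contr_bound.choose_spec.choose_spec.2.2.2 n h

theorem norm_contr_pow_le_of_le {n : ℕ} {h : β.H} {B : ℝ} (hB : ‖h‖ ≤ B) :
    ‖(β.contr ^ n) h‖ ≤ β.contrConst * β.rho ^ n * B :=
  (β.norm_contr_pow_le n h).trans (mul_le_mul_of_nonneg_left hB
    (mul_nonneg β.contrConst_pos.le (pow_nonneg β.rho_pos.le n)))

theorem tendsto_contrConst_mul (B : ℝ) :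
    Tendsto (fun n : ℕ => β.contrConst * β.rho ^ n * B) atTop (𝓝 0) := by
  simpa using ((tendsto_pow_atTop_nhds_zero_of_lt_one β.rho_pos.le β.rho_lt_one).const_mul
    β.contrConst).mul_const B

/-- A bound for sequences which satisfy a contracting recursion with bounded perturbations. -/
theorem norm_le_of_recursion {h c : ℕ → β.H} {B : ℝ}
    (hrec : ∀ k, h (k + 1) = β.contr (h k) + c k) (hc : ∀ k, ‖c k‖ ≤ B) (k : ℕ) :
    ‖h k‖ ≤ β.contrConst * ‖h 0‖ + β.contrConst * B / (1 - β.rho) := by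
  have hC := β.contrConst_pos
  have h0 := β.rho_pos
  have h1 := β.rho_lt_one
  have hB : 0 ≤ B := (norm_nonneg _).trans (hc 0)
  -- The extra power Mᵐ is carried along because iterating a one-step estimate would accumulate
  -- powers of C.
  have key : ∀ k m, ‖(β.contr ^ m) (h k)‖ ≤ β.contrConst * β.rho ^ (m + k) * ‖h 0‖ +
      β.contrConst * B * ∑ j ∈ Finset.range k, β.rho ^ (m + j) := by
    intro k
    induction k with
    | zero => intro m; simpa using β.norm_contr_pow_le m (h 0)
    | succ k ih =>
      intro m
      have e : (β.contr ^ m) (h (k + 1)) = (β.contr ^ (m + 1)) (h k) + (β.contr ^ m) (c k) := by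
        rw [hrec, map_add, pow_succ, Module.End.mul_apply]
      rw [e, Finset.sum_range_succ', add_zero]
      have i1 := ih (m + 1)
      have i2 := β.norm_contr_pow_le_of_le (n := m) (hc k)
      have e2 : ∀ j, m + 1 + j = m + (j + 1) := fun j => by ring
      simp only [e2] at i1
      calc _ ≤ _ := norm_add_le _ _
        _ ≤ _ := add_le_add i1 i2
        _ = _ := by ring
  have hk := key k 0
  simp only [pow_zero, Module.End.one_apply, zero_add] at hk
  refine hk.trans (add_le_add ?_ ?_)
  · have : β.rho ^ k ≤ 1 := pow_le_one₀ h0.le h1.le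
    calc _ ≤ β.contrConst * 1 * ‖h 0‖ := by gcongr
      _ = _ := by ring
  · rw [div_eq_mul_inv]
    gcongr
    rw [← tsum_geometric_of_lt_one h0.le h1]
    exact (summable_geometric_of_lt_one h0.le h1).sum_le_tsum _ fun _ _ => by positivity

theorem continuous_contr : Continuous β.contr :=
  LinearMap.continuous_of_finiteDimensional _

end PisotUnit

namespace BetaTransformation

variable {β : PisotUnit} (T : BetaTransformation β)

theorem exists_bound_digit : ∃ B : ℝ, ∀ a ∈ insert 0 (T.A : Set β.K), ‖β.Phi a‖ ≤ B :=
  have ⟨B, hB⟩ := ((T.A.finite_toSet.insert 0).image fun a => ‖β.Phi a‖).bddAbove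
  ⟨B, fun a ha => hB ⟨a, ha, rfl⟩⟩

/-- A bound of `‖Φ(a)‖` for the digits `a`. -/
def digitBound : ℝ := T.exists_bound_digit.choose

theorem norm_digit_le (x : ℝ) : ‖β.Phi (T.digit x)‖ ≤ T.digitBound :=
  T.exists_bound_digit.choose_spec _ (T.digit_mem x)

theorem norm_digit'_le (x : ℝ) : ‖β.Phi (T.digit' x)‖ ≤ T.digitBound :=
  T.exists_bound_digit.choose_spec _ (T.digit'_mem x)

theorem norm_le_digitBound {a : β.K} (ha : a ∈ T.A) : ‖β.Phi a‖ ≤ T.digitBound :=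
  T.exists_bound_digit.choose_spec _ (Or.inr ha)

/-- A bound for the norms of the elements of the sets `𝒟_x`. -/
def radius : ℝ := β.contrConst * T.digitBound / (1 - β.rho)

theorem summable_bound : HasSum (fun n : ℕ => β.contrConst * β.rho ^ n * T.digitBound) T.radius := by
  have h := ((hasSum_geometric_of_lt_one β.rho_pos.le β.rho_lt_one).mul_left
    β.contrConst).mul_right T.digitBound
  have e : T.radius = β.contrConst * (1 - β.rho)⁻¹ * T.digitBound := by
    unfold radius; ring
  rwa [e]

theorem summable_digits {a : ℕ → β.K} (ha : ∀ n, ‖β.Phi (a n)‖ ≤ T.digitBound) :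
    Summable fun n => (β.contr ^ n) (β.Phi (a n)) :=
  T.summable_bound.summable.of_norm_bounded fun n => β.norm_contr_pow_le_of_le (ha n)

theorem norm_tsum_digits_le {a : ℕ → β.K} (ha : ∀ n, ‖β.Phi (a n)‖ ≤ T.digitBound) :
    ‖∑' n, (β.contr ^ n) (β.Phi (a n))‖ ≤ T.radius :=
  tsum_of_norm_bounded T.summable_bound fun n => β.norm_contr_pow_le_of_le (ha n)

/-- Backward orbits of `T` in `X`. -/
def IsOrbit (w : ℕ → ℝ) : Prop := ∀ n, w n ∈ T.X ∧ T.map (w (n + 1)) = w n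

/-- The point of `𝒟_{w_0}` which is given by the backward orbit `w`. -/
def orbitSum (w : ℕ → ℝ) : β.H := ∑' n, (β.contr ^ n) (β.Phi (T.digit (w (n + 1))))

/-- Expansions determine points, so extending b(x) to the left within 𝒮 is the same as choosing
successive T-preimages of x. -/
theorem mem_D_iff {x : ℝ} (hx : x ∈ T.X) {h : β.H} :
    h ∈ T.D x ↔ ∃ w, T.IsOrbit w ∧ w 0 = x ∧ T.orbitSum w = h := by
  constructor
  · rintro ⟨u, hu, hux, rfl⟩
    choose p hpX hp using hu
    -- The right half of u starts at index 1, so w_n is the point with expansion u_{1-n} u_{2-n} ⋯.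
    refine ⟨fun n => p (1 - n), fun n => ⟨hpX _, ?_⟩, ?_, ?_⟩
    · refine T.expansion_injOn (T.map_mem (hpX _)) (hpX _) fun m => ?_
      have h1 := hp (1 - n) m
      have h2 := hp (1 - ((n + 1 : ℕ) : ℤ)) (m + 1)
      rw [← h1]
      rw [expansion, ← Function.iterate_succ_apply, ← expansion, ← h2]
      congr 1; push_cast; ring
    · refine T.expansion_injOn (hpX _) hx fun m => ?_
      rw [← hux, ← hp]
      congr 1; push_cast; ring
    · rw [orbitSum, phi]
      refine tsum_congr fun n => ?_
      rw [β.contr_pow_Phi, mul_comm]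
      congr 2
      have h1 := hp (1 - ((n + 1 : ℕ) : ℤ)) 0
      rw [expansion, Function.iterate_zero, id] at h1
      rw [← h1]
      congr 1; push_cast; ring
  · rintro ⟨w, hw, rfl, rfl⟩
    let u : ℤ → β.K := fun k => if 1 ≤ k then T.expansion (w 0) (k - 1).toNat
      else T.digit (w ((-k).toNat + 1))
    have hit : ∀ m n : ℕ, u (1 - (m : ℤ) + n) = T.expansion (w m) n := by
      intro m
      induction m with
      | zero =>
        intro n
        have : (1 : ℤ) ≤ 1 - ((0 : ℕ) : ℤ) + n := by push_cast; omega
        simp only [u, if_pos this]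
        congr 1; push_cast; omega
      | succ m ih =>
        intro n
        rcases n with _ | n
        · have : ¬ (1 : ℤ) ≤ 1 - ((m + 1 : ℕ) : ℤ) + (0 : ℕ) := by push_cast; omega
          simp only [u, if_neg this, expansion, Function.iterate_zero, id]
          congr 2; push_cast; omega
        · rw [expansion, Function.iterate_succ_apply, (hw m).2, ← expansion, ← ih]
          congr 1; push_cast; ring
    refine ⟨u, fun k => ?_, fun n => ?_, ?_⟩
    · by_cases hk : 1 ≤ k
      · refine ⟨T.map^[(k - 1).toNat] (w 0), T.iterate_mem (hw 0).1 _, fun n => ?_⟩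
        have : (1 : ℤ) ≤ k + n := by omega
        simp only [u, if_pos this, expansion, ← Function.iterate_add_apply]
        congr 2; omega
      · refine ⟨w (1 - k).toNat, (hw _).1, fun n => ?_⟩
        rw [← hit]
        congr 1; omega
    · rw [← hit]; congr 1; push_cast; ring
    · rw [orbitSum, phi]
      refine tsum_congr fun n => ?_
      rw [β.contr_pow_Phi, mul_comm]
      congr 2
      have := hit (n + 1) 0
      rw [expansion, Function.iterate_zero, id] at this
      rw [← this]
      congr 1; push_cast; ring

theorem D_nonempty {x : ℝ} (hx : x ∈ T.X) : (T.D x).Nonempty := by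
  obtain ⟨w, h0, hX, hw⟩ := exists_backward (fun x => T.exists_map_eq) hx
  exact ⟨_, (T.mem_D_iff hx).mpr ⟨w, fun n => ⟨hX n, hw n⟩, h0, rfl⟩⟩

theorem norm_le_radius {x : ℝ} (hx : x ∈ T.X) {h : β.H} (hh : h ∈ T.D x) : ‖h‖ ≤ T.radius := by
  obtain ⟨w, -, -, rfl⟩ := (T.mem_D_iff hx).mp hh
  exact T.norm_tsum_digits_le fun n => T.norm_digit_le _

theorem mem_D_iff_exists_preimage {x : ℝ} (hx : x ∈ T.X) {h : β.H} :
    h ∈ T.D x ↔ ∃ y ∈ T.X, T.map y = x ∧ ∃ h' ∈ T.D y, β.Phi (T.digit y) + β.contr h' = h := by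
  have hsum : ∀ w, T.orbitSum w = β.Phi (T.digit (w 1)) + β.contr (T.orbitSum fun n => w (n + 1)) := by
    intro w
    rw [orbitSum, (T.summable_digits fun n => T.norm_digit_le _).tsum_eq_zero_add, pow_zero,
      Module.End.one_apply, orbitSum]
    congr 1
    have h1 := (LinearMap.toContinuousLinearMap β.contr).map_tsum
      (T.summable_digits (a := fun n => T.digit (w (n + 1 + 1))) fun n => T.norm_digit_le _)
    rw [LinearMap.coe_toContinuousLinearMap'] at h1
    rw [h1]
    exact tsum_congr fun n => by rw [pow_succ', Module.End.mul_apply]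
  rw [T.mem_D_iff hx]
  constructor
  · rintro ⟨w, hw, rfl, rfl⟩
    exact ⟨w 1, (hw 1).1, (hw 0).2, _, (T.mem_D_iff (hw 1).1).mpr
      ⟨fun n => w (n + 1), fun n => hw (n + 1), rfl, rfl⟩, (hsum w).symm⟩
  · rintro ⟨y, hy, rfl, h', hh', rfl⟩
    obtain ⟨w, hw, rfl, rfl⟩ := (T.mem_D_iff hy).mp hh'
    let v : ℕ → ℝ := fun n => Nat.casesOn n (T.map (w 0)) w
    refine ⟨v, fun n => ?_, rfl, hsum v⟩
    rcases n with _ | n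
    · exact ⟨T.map_mem hy, rfl⟩
    · exact hw n

/-- The differences `κ = β^n q - x ∈ ℚ(β)` for `q ∈ X` with `T^n q = x`. -/
def E (n : ℕ) (x : ℝ) : Set β.K :=
  {κ | (x + κ) / β.val ^ n ∈ T.X ∧ T.map^[n] ((x + κ) / β.val ^ n) = x}

/-- The set `E n x` for the left-continuous map. -/
def E' (n : ℕ) (x : ℝ) : Set β.K :=
  {κ | (x + κ) / β.val ^ n ∈ T.X' ∧ T.map'^[n] ((x + κ) / β.val ^ n) = x}

theorem E_succ_mem {n : ℕ} {x : ℝ} {κ : β.K} {y : ℝ} (hy : T.map y = x)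
    (hκ : κ ∈ T.E n y) : T.digit y + β.gen * κ ∈ T.E (n + 1) x := by
  have h0 := β.pos.ne'
  have e : (x + (T.digit y + β.gen * κ : β.K)) / β.val ^ (n + 1) = (y + κ) / β.val ^ n := by
    rw [← hy, map]; push_cast; rw [β.coe_gen]; field_simp; ring
  refine ⟨by rw [e]; exact hκ.1, ?_⟩
  rw [e, Function.iterate_succ_apply', hκ.2, hy]

theorem exists_of_mem_E_succ {n : ℕ} {x : ℝ} {κ : β.K} (hκ : κ ∈ T.E (n + 1) x) :
    ∃ y ∈ T.X, T.map y = x ∧ ∃ κ' ∈ T.E n y, κ = T.digit y + β.gen * κ' ∧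
      (x + κ) / β.val ^ (n + 1) = (y + κ') / β.val ^ n := by
  have h0 := β.pos.ne'
  set q := (x + κ) / β.val ^ (n + 1) with hq
  have hyX : T.map^[n] q ∈ T.X := T.iterate_mem hκ.1 n
  have hyx : T.map (T.map^[n] q) = x := by
    rw [← Function.iterate_succ_apply' T.map]; exact hκ.2
  have h3 : β.val * (T.map^[n] q) - T.digit (T.map^[n] q) = x := hyx
  have hc : ((β.gen⁻¹ * (κ - T.digit (T.map^[n] q)) : β.K) : ℝ) =
      β.val ^ n * q - T.map^[n] q := by
    push_cast
    rw [β.coe_gen]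
    have h4 : (κ : ℝ) = β.val ^ (n + 1) * q - x := by rw [hq]; field_simp; ring
    rw [h4, ← h3]; field_simp; ring
  have e : (T.map^[n] q + (β.gen⁻¹ * (κ - T.digit (T.map^[n] q)) : β.K)) / β.val ^ n = q := by
    rw [hc]; field_simp; ring
  refine ⟨_, hyX, hyx, _, ⟨by rw [e]; exact hκ.1, by rw [e]⟩, ?_, e.symm⟩
  rw [mul_inv_cancel_left₀ β.gen_ne_zero, add_sub_cancel]

/-- This is the set equation iterated n times. Up to an error of order ρⁿ, 𝒟_x is thus Φ of the
finite set `E n x`, which can be compared for different x. -/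
theorem mem_D_iff_exists {x : ℝ} (hx : x ∈ T.X) (n : ℕ) {h : β.H} :
    h ∈ T.D x ↔ ∃ κ ∈ T.E n x, ∃ h' ∈ T.D ((x + κ) / β.val ^ n),
      β.Phi κ + (β.contr ^ n) h' = h := by
  induction n generalizing x h with
  | zero =>
    constructor
    · intro hh
      refine ⟨0, ⟨by simpa using hx, by simp⟩, h, by simpa using hh, by simp [β.Phi_zero]⟩
    · rintro ⟨κ, hκ, h', hh', rfl⟩
      have h1 : ((κ : β.K) : ℝ) = 0 := by simpa using hκ.2
      have h2 : κ = 0 := Subtype.ext h1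
      subst h2
      simpa [β.Phi_zero] using hh'
  | succ n ih =>
    have h0 := β.pos.ne'
    have hPhi : ∀ y κ h', β.Phi (T.digit y) + β.contr (β.Phi κ + (β.contr ^ n) h') =
        β.Phi (T.digit y + β.gen * κ) + (β.contr ^ (n + 1)) h' := fun y κ h' => by
      rw [map_add, β.contr_Phi, β.Phi_add, pow_succ', Module.End.mul_apply, add_assoc]
    rw [T.mem_D_iff_exists_preimage hx]
    constructor
    · rintro ⟨y, hy, hyx, h', hh', rfl⟩
      obtain ⟨κ, hκ, h'', hh'', rfl⟩ := (ih hy).mp hh'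
      have e : (x + (T.digit y + β.gen * κ : β.K)) / β.val ^ (n + 1) = (y + κ) / β.val ^ n := by
        rw [← hyx, map]; push_cast; rw [β.coe_gen]; field_simp; ring
      exact ⟨_, T.E_succ_mem hyx hκ, h'', by rwa [e], (hPhi _ _ _).symm⟩
    · rintro ⟨κ, hκ, h', hh', rfl⟩
      obtain ⟨y, hy, hyx, κ', hκ', rfl, e⟩ := T.exists_of_mem_E_succ hκ
      exact ⟨y, hy, hyx, _, (ih hy).mpr ⟨κ', hκ', h', by rwa [← e], rfl⟩, hPhi _ _ _⟩

/-- For fixed x a backward orbit is coded by its digits, and its n-th point depends on n digits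
only. Lying in X_a is therefore a clopen condition on the code, whatever the shape of X_a, and 𝒟_x
is a continuous image of a closed set of codes. -/
theorem isCompact_D {x : ℝ} (hx : x ∈ T.X) : IsCompact (T.D x) := by
  let w : ℕ → (ℕ → T.A) → ℝ := fun n a => Nat.rec x (fun n y => (y + (a n : β.K)) / β.val) n
  have hw0 : ∀ a, w 0 a = x := fun a => rfl
  have hws : ∀ n a, w (n + 1) a = (w n a + (a n : β.K)) / β.val := fun n a => rfl
  have hloc : ∀ n, IsLocallyConstant (w n) := by
    intro n
    induction n with
    | zero => exact IsLocallyConstant.const x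
    | succ n ih =>
      have h1 : IsLocallyConstant fun a : ℕ → T.A => a n :=
        (IsLocallyConstant.iff_continuous _).mpr (continuous_apply n)
      exact ih.comp₂ h1 fun y a => (y + (a : β.K)) / β.val
  let Z : Set (ℕ → T.A) := {a | ∀ n, w (n + 1) a ∈ T.piece (a n)}
  have hZ : IsClosed Z := by
    have : Z = ⋂ n, {a | w (n + 1) a ∈ T.piece (a n)} := by ext a; simp [Z]
    rw [this]
    refine isClosed_iInter fun n => ?_
    have h1 : IsLocallyConstant fun a : ℕ → T.A => a n :=
      (IsLocallyConstant.iff_continuous _).mpr (continuous_apply n)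
    have h2 : IsLocallyConstant fun a : ℕ → T.A => w (n + 1) a ∈ T.piece (a n) :=
      (hloc (n + 1)).comp₂ h1 fun y a => y ∈ T.piece a
    simpa using h2.isClosed_fiber True
  let f : (ℕ → T.A) → β.H := fun a => ∑' n, (β.contr ^ n) (β.Phi (a n))
  have hf : Continuous f := by
    refine continuous_tsum (fun n => ?_) T.summable_bound.summable fun n a =>
      β.norm_contr_pow_le_of_le (T.norm_le_digitBound (a n).2)
    have h1 : Continuous fun a : T.A => (β.contr ^ n) (β.Phi (a : β.K)) :=
      continuous_of_discreteTopology
    exact h1.comp (continuous_apply n)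
  have himg : T.D x = f '' Z := by
    ext h
    rw [T.mem_D_iff hx]
    constructor
    · rintro ⟨v, hv, hv0, rfl⟩
      let a : ℕ → T.A := fun n => ⟨T.digit (v (n + 1)), (T.digit_spec (hv _).1).1⟩
      have hva : ∀ n, w n a = v n := by
        intro n
        induction n with
        | zero => exact hv0.symm
        | succ n ih =>
          rw [hws, ih, ← (hv n).2, map]
          have := β.pos.ne'
          simp only [a]; field_simp; ring
      refine ⟨a, fun n => ?_, rfl⟩
      exact Set.mem_of_eq_of_mem (hva (n + 1)) (T.digit_spec (hv (n + 1)).1).2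
    · rintro ⟨a, ha, rfl⟩
      have hd : ∀ n, T.digit (w (n + 1) a) = a n := fun n => T.digit_eq (a n).2 (ha n)
      refine ⟨fun n => w n a, fun n => ⟨?_, ?_⟩, hw0 a, ?_⟩
      · rcases n with _ | n
        · exact hx
        · exact T.mem_X.mpr ⟨_, (a n).2, ha n⟩
      · change T.map (w (n + 1) a) = w n a
        rw [map, hd, hws]
        have := β.pos.ne'
        field_simp; ring
      · exact tsum_congr fun n => by rw [hd]
  rw [himg]
  exact hZ.isCompact.image hf

end BetaTransformation
end BetaTiling

/-! ### Constancy of 𝒟_x away from 𝒱 -/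

namespace BetaTiling

open MeasureTheory Filter Topology

namespace BetaTransformation

variable {β : PisotUnit} (T : BetaTransformation β)

/-! ### The sets `E n x` near a point -/

/-- Each κ is a polynomial in β with n digits as coefficients. Independence of x turns statements
about single κ into statements about the whole set. -/
theorem exists_finite_superset_E (n : ℕ) : ∃ s : Set β.K, s.Finite ∧ ∀ x, T.E n x ⊆ s := by
  induction n with
  | zero =>
    refine ⟨{0}, Set.finite_singleton _, fun x κ hκ => ?_⟩
    have h1 : ((κ : β.K) : ℝ) = 0 := by simpa using hκ.2
    exact Subtype.ext h1
  | succ n ih =>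
    obtain ⟨s, hs, h⟩ := ih
    refine ⟨Set.image2 (fun a κ => a + β.gen * κ) T.A s, T.A.finite_toSet.image2 _ hs,
      fun x κ hκ => ?_⟩
    obtain ⟨y, hy, -, κ', hκ', rfl, -⟩ := T.exists_of_mem_E_succ hκ
    exact ⟨_, (T.digit_spec hy).1, κ', h y hκ', rfl⟩

/-- With κ fixed, q moves by β⁻ⁿ(s - x), and Tⁿ expands this back to s - x as long as the digits do
not change. -/
theorem mem_E_right (n : ℕ) (κ : β.K) (x : ℝ) :
    ∀ᶠ s in 𝓝[≥] x, (κ ∈ T.E n s ↔ κ ∈ T.E n x) := by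
  have hp : 0 < β.val ^ n := pow_pos β.pos n
  set q := (x + κ) / β.val ^ n with hq
  have ht := tendsto_affine_right x q (β.val ^ n)⁻¹ (inv_pos.mpr hp)
  have e : ∀ s, (s + κ) / β.val ^ n = q + (β.val ^ n)⁻¹ * (s - x) := fun s => by
    rw [hq]; field_simp; ring
  by_cases hqX : q ∈ T.X
  · filter_upwards [ht.eventually (T.X_right q), ht.eventually (T.iterate_right hqX n)]
      with s h1 h2
    simp only [E, Set.mem_ofPred_eq, e s, h1, ← hq, h2, add_sub_cancel_left,
      mul_inv_cancel_left₀ hp.ne']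
    refine and_congr_right fun _ => ?_
    constructor <;> intro h <;> linarith
  · filter_upwards [ht.eventually (T.X_right q)] with s h1
    simp only [E, Set.mem_ofPred_eq, e s, h1, ← hq, hqX, false_and]

theorem mem_E_left (n : ℕ) (κ : β.K) (x : ℝ) :
    ∀ᶠ s in 𝓝[<] x, (κ ∈ T.E n s ↔ κ ∈ T.E' n x) := by
  have hp : 0 < β.val ^ n := pow_pos β.pos n
  set q := (x + κ) / β.val ^ n with hq
  have ht := tendsto_affine_left x q (β.val ^ n)⁻¹ (inv_pos.mpr hp)
  have e : ∀ s, (s + κ) / β.val ^ n = q + (β.val ^ n)⁻¹ * (s - x) := fun s => by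
    rw [hq]; field_simp; ring
  by_cases hqX : q ∈ T.X'
  · filter_upwards [ht.eventually (T.X_left q), ht.eventually (T.iterate_left hqX n)]
      with s h1 h2
    simp only [E, E', Set.mem_ofPred_eq, e s, h1, ← hq, h2, add_sub_cancel_left,
      mul_inv_cancel_left₀ hp.ne']
    refine and_congr_right fun _ => ?_
    constructor <;> intro h <;> linarith
  · filter_upwards [ht.eventually (T.X_left q)] with s h1
    simp only [E, E', Set.mem_ofPred_eq, e s, h1, ← hq, hqX, false_and]

theorem E_right (n : ℕ) (x : ℝ) : ∀ᶠ s in 𝓝[≥] x, T.E n s = T.E n x := by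
  obtain ⟨F, hF, h⟩ := T.exists_finite_superset_E n
  filter_upwards [(Filter.eventually_all_finite hF).mpr fun κ _ => T.mem_E_right n κ x] with s hs
  ext κ
  exact ⟨fun hκ => (hs κ (h s hκ)).mp hκ, fun hκ => (hs κ (h x hκ)).mpr hκ⟩

theorem E_left (n : ℕ) (x : ℝ) : ∀ᶠ s in 𝓝[<] x, T.E n s = T.E' n x := by
  obtain ⟨F, hF, h⟩ := T.exists_finite_superset_E n
  filter_upwards [(Filter.eventually_all_finite hF).mpr fun κ _ => T.mem_E_left n κ x] with s hs
  ext κ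
  refine ⟨fun hκ => (hs κ (h s hκ)).mp hκ, fun hκ => (hs κ ?_).mpr hκ⟩
  obtain ⟨t, ht⟩ := (T.mem_E_left n κ x).exists
  exact h t (ht.mpr hκ)

/-! ### Crossing points outside `𝒱` -/

theorem meet_gt {x : ℝ} {n : ℕ} (h : ∀ m, 1 ≤ m → m ≤ n → T.map'^[m] x ≠ T.map^[m] x) :
    (n : ℕ∞) < T.meet x := by
  have h1 : ((n + 1 : ℕ) : ℕ∞) ≤ T.meet x := by
    refine le_iInf₂ fun m hm => ?_
    have : n + 1 ≤ m := by
      by_contra hlt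
      exact h m hm.1 (by omega) hm.2
    exact_mod_cast this
  exact lt_of_lt_of_le (by exact_mod_cast Nat.lt_succ_self n) h1

/-- If the two orbits of q meet before time n, restart at the meeting point, which again lies in X ∩
X̃; otherwise n < m_q. -/
theorem mem_V_of_iterate_ne {n : ℕ} {q p : ℝ} (hq : q ∈ T.X ∩ T.X') (hp : p ∈ T.X)
    (hor : p = T.map^[n] q ∨ p = T.map'^[n] q) (hne : T.map'^[n] q ≠ T.map^[n] q) : p ∈ T.V := by
  induction n using Nat.strong_induction_on generalizing q with
  | _ n ih =>
    by_cases h : ∃ m, 1 ≤ m ∧ m ≤ n ∧ T.map'^[m] q = T.map^[m] q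
    · obtain ⟨m, hm1, hmn, hm⟩ := h
      have e1 : T.map^[n] q = T.map^[n - m] (T.map^[m] q) := by
        rw [← Function.iterate_add_apply]; congr 2; omega
      have e2 : T.map'^[n] q = T.map'^[n - m] (T.map^[m] q) := by
        rw [← hm, ← Function.iterate_add_apply]; congr 2; omega
      rw [e1, e2] at hor hne
      exact ih (n - m) (by omega) ⟨T.iterate_mem hq.1 m, hm ▸ T.iterate'_mem hq.2 m⟩ hor hne
    · push Not at h
      have hn : 1 ≤ n := by
        by_contra h0
        have : n = 0 := by omega
        subst this
        exact hne rfl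
      refine Or.inr (Set.mem_biUnion hq (Set.mem_biUnion ⟨hn, T.meet_gt h⟩ ⟨?_, hp⟩))
      rcases hor with h1 | h1
      · exact Or.inl h1
      · exact Or.inr h1

/-- A bound for the differences of the iterates of `T̃` and `T`. -/
theorem exists_iterate_sub (k : ℕ) (x : ℝ) : ∃ δ : β.K, (δ : ℝ) = T.map'^[k] x - T.map^[k] x ∧
    ‖β.Phi δ‖ ≤ β.contrConst * (T.digitBound + T.digitBound) / (1 - β.rho) := by
  let δ : ℕ → β.K := fun k => Nat.rec 0
    (fun k d => β.gen * d + (T.digit (T.map^[k] x) - T.digit' (T.map'^[k] x))) k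
  have hδs : ∀ k, δ (k + 1) = β.gen * δ k + (T.digit (T.map^[k] x) - T.digit' (T.map'^[k] x)) :=
    fun k => rfl
  refine ⟨δ k, ?_, ?_⟩
  · induction k with
    | zero => simp [δ]
    | succ k ih =>
      rw [hδs, Function.iterate_succ_apply', Function.iterate_succ_apply', map, map']
      push_cast
      rw [ih, β.coe_gen]; ring
  · have h := β.norm_le_of_recursion (h := fun k => β.Phi (δ k))
      (c := fun k => β.Phi (T.digit (T.map^[k] x) - T.digit' (T.map'^[k] x)))
      (B := T.digitBound + T.digitBound)
      (fun k => by simp only [hδs, β.Phi_add, β.contr_Phi])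
      (fun k => by
        rw [β.Phi_sub]
        exact (norm_sub_le _ _).trans (add_le_add (T.norm_digit_le _) (T.norm_digit'_le _))) k
    have h0 : δ 0 = 0 := rfl
    simpa only [h0, β.Phi_zero, norm_zero, mul_zero, zero_add] using h

/-- Two subsets of `ℚ(β)` whose images under `Φ` have Hausdorff distance at most `c`. -/
def Near (c : ℝ) (S S' : Set β.K) : Prop :=
  (∀ κ ∈ S, ∃ κ' ∈ S', ‖β.Phi κ - β.Phi κ'‖ ≤ c) ∧ ∀ κ' ∈ S', ∃ κ ∈ S, ‖β.Phi κ - β.Phi κ'‖ ≤ c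

variable {T} in
theorem Near.refl {c : ℝ} (hc : 0 ≤ c) (S : Set β.K) : Near c S S :=
  ⟨fun κ h => ⟨κ, h, by simpa using hc⟩, fun κ h => ⟨κ, h, by simpa using hc⟩⟩

variable {T} in
theorem Near.trans {c c' : ℝ} {S S' S'' : Set β.K} (h : Near c S S') (h' : Near c' S' S'') :
    Near (c + c') S S'' := by
  constructor
  · intro κ hκ
    obtain ⟨κ', hκ', h1⟩ := h.1 κ hκ
    obtain ⟨κ'', hκ'', h2⟩ := h'.1 κ' hκ'
    exact ⟨κ'', hκ'', (norm_sub_le_norm_sub_add_norm_sub _ _ _).trans (add_le_add h1 h2)⟩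
  · intro κ'' hκ''
    obtain ⟨κ', hκ', h2⟩ := h'.2 κ'' hκ''
    obtain ⟨κ, hκ, h1⟩ := h.2 κ' hκ'
    exact ⟨κ, hκ, (norm_sub_le_norm_sub_add_norm_sub _ _ _).trans (add_le_add h1 h2)⟩

variable {T} in
theorem Near.mono {c c' : ℝ} {S S' : Set β.K} (h : Near c S S') (hc : c ≤ c') : Near c' S S' :=
  ⟨fun κ hκ => (h.1 κ hκ).imp fun _ h => ⟨h.1, h.2.trans hc⟩,
    fun κ hκ => (h.2 κ hκ).imp fun _ h => ⟨h.1, h.2.trans hc⟩⟩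

/-- The bound for the jumps of `E n`. -/
def jumpBound (n : ℕ) : ℝ := β.contrConst * β.rho ^ n *
  (β.contrConst * (T.digitBound + T.digitBound) / (1 - β.rho))

/-- The points outside `𝒱` where `E n` may jump. -/
def jumps (n : ℕ) : Set ℝ := (T.map^[n] '' (T.X \ T.X')) ∪ (T.map'^[n] '' (T.X' \ T.X))

theorem mem_X'_of_notMem_V {p : ℝ} (hp : p ∈ T.X) (hV : p ∉ T.V) : p ∈ T.X' := by
  by_contra h
  exact hV (Or.inl ⟨hp, h⟩)

/-- A preimage in only one of X and X̃ would make p a jump; a preimage in both that does not serve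
both maps would put p into 𝒱. -/
theorem E_eq_of_notMem_jumps {n : ℕ} {p : ℝ} (hp : p ∈ T.X) (hV : p ∉ T.V) (hJ : p ∉ T.jumps n) :
    T.E' n p = T.E n p := by
  ext κ
  constructor
  · rintro ⟨h1, h2⟩
    have hX : (p + κ) / β.val ^ n ∈ T.X := by
      by_contra hX
      exact hJ (Or.inr ⟨_, ⟨h1, hX⟩, h2⟩)
    refine ⟨hX, ?_⟩
    by_contra hne
    exact hV (T.mem_V_of_iterate_ne ⟨hX, h1⟩ hp (Or.inr h2.symm) fun h => hne (h ▸ h2))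
  · rintro ⟨h1, h2⟩
    have hX : (p + κ) / β.val ^ n ∈ T.X' := by
      by_contra hX
      exact hJ (Or.inl ⟨_, ⟨h1, hX⟩, h2⟩)
    refine ⟨hX, ?_⟩
    by_contra hne
    exact hV (T.mem_V_of_iterate_ne ⟨h1, hX⟩ hp (Or.inl h2.symm) fun h => hne (h.trans h2))

theorem norm_Phi_pow_mul_le (n : ℕ) {δ : β.K}
    (h : ‖β.Phi δ‖ ≤ β.contrConst * (T.digitBound + T.digitBound) / (1 - β.rho)) :
    ‖β.Phi (β.gen ^ n * δ)‖ ≤ T.jumpBound n := by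
  rw [← β.contr_pow_Phi]
  exact β.norm_contr_pow_le_of_le h

/-- Even when a preimage q for one map lies outside the other domain, q is in the forward orbit of
some q' ∈ X ∩ X̃. As p ∉ 𝒱, both orbits of q' reach p at the same time, so the other orbit supplies
a substitute for q. The two preimages differ by δ with Φ(δ) bounded, and κ changes by βⁿδ, which Φ
makes small. -/
theorem near_of_notMem_V {n : ℕ} {p : ℝ} (hp : p ∈ T.X) (hV : p ∉ T.V) :
    Near (T.jumpBound n) (T.E' n p) (T.E n p) := by
  have hp' := T.mem_X'_of_notMem_V hp hV
  have hpow : β.val ^ n ≠ 0 := pow_ne_zero _ β.pos.ne'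
  have hshift : ∀ κ δ : β.K, (p + (κ + β.gen ^ n * δ : β.K)) / β.val ^ n =
      (p + κ) / β.val ^ n + δ := fun κ δ => by
    push_cast; rw [β.coe_gen]; field_simp; ring
  constructor
  · rintro κ ⟨h1, h2⟩
    obtain ⟨k, q', ⟨hq', hq⟩, hk⟩ := exists_iterate_eq_of_mem_inter (f := T.map') (Z := T.X)
      (fun x => T.exists_map'_eq) T.X'_sdiff_finite h1 (n := n)
      (by rwa [h2])
    obtain ⟨δ, hδ, hb⟩ := T.exists_iterate_sub k q'
    have h3 : T.map'^[n + k] q' = p := by rw [Function.iterate_add_apply, hk, h2]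
    have h4 : T.map^[n + k] q' = p := by
      by_contra hne
      exact hV (T.mem_V_of_iterate_ne ⟨hq, hq'⟩ hp (Or.inr h3.symm) fun h => hne (h ▸ h3))
    have e : (p + (κ + β.gen ^ n * -δ : β.K)) / β.val ^ n = T.map^[k] q' := by
      rw [hshift, ← hk]; push_cast; rw [hδ]; ring
    refine ⟨κ + β.gen ^ n * -δ, ⟨?_, ?_⟩, ?_⟩
    · rw [e]; exact T.iterate_mem hq k
    · rw [e, ← Function.iterate_add_apply, h4]
    · rw [← β.Phi_sub, show κ - (κ + β.gen ^ n * -δ) = β.gen ^ n * δ by ring]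
      exact T.norm_Phi_pow_mul_le n hb
  · rintro κ ⟨h1, h2⟩
    obtain ⟨k, q', ⟨hq, hq'⟩, hk⟩ := exists_iterate_eq_of_mem_inter (f := T.map) (Z := T.X')
      (fun x => T.exists_map_eq) T.X_sdiff_finite h1 (n := n)
      (by rwa [h2])
    obtain ⟨δ, hδ, hb⟩ := T.exists_iterate_sub k q'
    have h3 : T.map^[n + k] q' = p := by rw [Function.iterate_add_apply, hk, h2]
    have h4 : T.map'^[n + k] q' = p := by
      by_contra hne
      exact hV (T.mem_V_of_iterate_ne ⟨hq, hq'⟩ hp (Or.inl h3.symm) fun h => hne (h.trans h3))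
    have e : (p + (κ + β.gen ^ n * δ : β.K)) / β.val ^ n = T.map'^[k] q' := by
      rw [hshift, ← hk, hδ]; ring
    refine ⟨κ + β.gen ^ n * δ, ⟨?_, ?_⟩, ?_⟩
    · rw [e]; exact T.iterate'_mem hq' k
    · rw [e, ← Function.iterate_add_apply, h4]
    · rw [← β.Phi_sub, show κ + β.gen ^ n * δ - κ = β.gen ^ n * δ by ring]
      exact T.norm_Phi_pow_mul_le n hb

/-! ### The sets `𝒟_x` are constant between points of `𝒱` -/

theorem digitBound_nonneg : 0 ≤ T.digitBound := (norm_nonneg _).trans (T.norm_digit_le 0)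

theorem jumpBound_nonneg (n : ℕ) : 0 ≤ T.jumpBound n := by
  have := T.digitBound_nonneg
  have h1 := β.contrConst_pos
  have h2 := β.rho_pos
  have h3 : 0 < 1 - β.rho := sub_pos.mpr β.rho_lt_one
  unfold jumpBound
  positivity

theorem jumps_finite (n : ℕ) : (T.jumps n).Finite :=
  (T.X_sdiff_finite.image _).union (T.X'_sdiff_finite.image _)

theorem ncard_jumps_le (n : ℕ) :
    (T.jumps n).ncard ≤ (T.X \ T.X').ncard + (T.X' \ T.X).ncard :=
  (Set.ncard_union_le _ _).trans
    (add_le_add (Set.ncard_image_le T.X_sdiff_finite) (Set.ncard_image_le T.X'_sdiff_finite))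

/-- Move s leftwards from x'. The set `E n s` can change only at a jump, since no point of 𝒱 is met,
and each jump costs at most `jumpBound n`. -/
theorem near_of_disjoint_V (n : ℕ) {x x' : ℝ} (hx' : x' ∈ T.X)
    (hV : Disjoint T.V (Set.Ioc x x')) {s : ℝ} (hs : s ∈ Set.Icc x x') :
    s ∈ T.X ∧ Near (T.jumpBound n * (T.jumps n ∩ Set.Ioc s x').ncard) (T.E n s) (T.E n x') := by
  by_contra hbad
  set P : ℝ → Prop := fun s =>
    s ∈ T.X ∧ Near (T.jumpBound n * (T.jumps n ∩ Set.Ioc s x').ncard) (T.E n s) (T.E n x') with hP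
  let B : Set ℝ := {s | s ∈ Set.Icc x x' ∧ ¬ P s}
  have hB : B.Nonempty := ⟨s, hs, hbad⟩
  have hBdd : BddAbove B := ⟨x', fun t ht => ht.1.2⟩
  -- At the supremum of the bad points the claim holds by right constancy; leaving t to the left
  -- keeps it, so no bad points accumulate at t.
  set t := sSup B with ht
  have htx : x ≤ t := hs.1.trans (le_csSup hBdd ⟨hs, hbad⟩)
  have htx' : t ≤ x' := csSup_le hB fun r hr => hr.1.2
  have hfin : ∀ r, (T.jumps n ∩ Set.Ioc r x').Finite := fun r =>
    (T.jumps_finite n).subset Set.inter_subset_left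
  have hc := T.jumpBound_nonneg n
  have hgood : ∀ r, t < r → r ≤ x' → P r := fun r hr hr' => by
    by_contra h
    exact absurd (le_csSup hBdd (show r ∈ B from ⟨⟨htx.trans hr.le, hr'⟩, h⟩)) (not_le.mpr hr)
  have hPt : P t := by
    rcases htx'.eq_or_lt with h | h
    · rw [h]
      exact ⟨hx', Near.refl (mul_nonneg hc (Nat.cast_nonneg _)) _⟩
    · have h1 : ∀ᶠ r in 𝓝[>] t, r < x' := nhdsWithin_le_nhds (gt_mem_nhds h)
      have h2 : ∀ᶠ r in 𝓝[>] t, t < r := self_mem_nhdsWithin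
      have h3 : 𝓝[>] t ≤ 𝓝[≥] t := nhdsWithin_mono _ Set.Ioi_subset_Ici_self
      obtain ⟨r, hr1, hr2, hr3, hr4⟩ :=
        (h1.and (h2.and (((T.X_right t).filter_mono h3).and ((T.E_right n t).filter_mono h3)))).exists
      obtain ⟨hrX, hrN⟩ := hgood r hr2 hr1.le
      have hr4' : T.E n r = T.E n t := hr4
      refine ⟨hr3.mp hrX, hr4' ▸ hrN.mono (mul_le_mul_of_nonneg_left ?_ hc)⟩
      exact_mod_cast Set.ncard_le_ncard
        (Set.inter_subset_inter_right _ (Set.Ioc_subset_Ioc_left hr2.le)) (hfin t)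
  have htx2 : x < t := by
    refine htx.lt_of_ne fun h => ?_
    have hle := le_csSup hBdd (show s ∈ B from ⟨hs, hbad⟩)
    have : s = t := le_antisymm hle (h ▸ hs.1)
    exact hbad (this ▸ hPt)
  have htV : t ∉ T.V := fun h => Set.disjoint_left.mp hV h ⟨htx2, htx'⟩
  have htX' := T.mem_X'_of_notMem_V hPt.1 htV
  have hleft : ∀ᶠ r in 𝓝[<] t, P r := by
    have h2 : ∀ᶠ r in 𝓝[<] t, r < t := self_mem_nhdsWithin
    filter_upwards [T.X_left t, T.E_left n t, h2] with r hr1 hr2 hr3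
    refine ⟨hr1.mpr htX', hr2 ▸ ?_⟩
    by_cases hJ : t ∈ T.jumps n
    · refine ((T.near_of_notMem_V hPt.1 htV).trans hPt.2).mono ?_
      have hsub : insert t (T.jumps n ∩ Set.Ioc t x') ⊆ T.jumps n ∩ Set.Ioc r x' := by
        rintro y (rfl | hy)
        · exact ⟨hJ, hr3, htx'⟩
        · exact ⟨hy.1, hr3.trans hy.2.1, hy.2.2⟩
      have hcard := Set.ncard_le_ncard hsub (hfin r)
      rw [Set.ncard_insert_of_notMem (fun h => lt_irrefl t h.2.1) (hfin t)] at hcard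
      have hcard' : (((T.jumps n ∩ Set.Ioc t x').ncard + 1 : ℕ) : ℝ) ≤
        (T.jumps n ∩ Set.Ioc r x').ncard := by exact_mod_cast hcard
      push_cast at hcard'
      nlinarith
    · rw [T.E_eq_of_notMem_jumps hPt.1 htV hJ]
      refine hPt.2.mono (mul_le_mul_of_nonneg_left ?_ hc)
      exact_mod_cast Set.ncard_le_ncard
        (Set.inter_subset_inter_right _ (Set.Ioc_subset_Ioc_left hr3.le)) (hfin r)
  obtain ⟨l, hl, hlP⟩ := mem_nhdsLT_iff_exists_Ioo_subset.mp hleft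
  obtain ⟨r, hr, hlr⟩ := exists_lt_of_lt_csSup hB hl
  rcases (le_csSup hBdd hr).eq_or_lt with h | h
  · exact hr.2 (h ▸ hPt)
  · exact hr.2 (hlP ⟨hlr, h⟩)

/-- Closeness of the n-th level sets bounds the distance of 𝒟_x to the closed set 𝒟_{x'} by c_n plus
terms of order ρⁿ. -/
theorem D_subset_of_near {x x' : ℝ} (hx : x ∈ T.X) (hx' : x' ∈ T.X) {c : ℕ → ℝ}
    (hc : Tendsto c atTop (𝓝 0))
    (h : ∀ n, ∀ κ ∈ T.E n x, ∃ κ' ∈ T.E n x', ‖β.Phi κ - β.Phi κ'‖ ≤ c n) : T.D x ⊆ T.D x' := by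
  intro y hy
  rw [← (T.isCompact_D hx').isClosed.closure_eq, Metric.mem_closure_iff]
  intro ε hε
  have ht := hc.add ((β.tendsto_contrConst_mul T.radius).add (β.tendsto_contrConst_mul T.radius))
  rw [add_zero, add_zero] at ht
  obtain ⟨n, hn⟩ := (ht.eventually (gt_mem_nhds hε)).exists
  obtain ⟨κ, hκ, y1, hy1, rfl⟩ := (T.mem_D_iff_exists hx n).mp hy
  obtain ⟨κ', hκ', hle⟩ := h n κ hκ
  obtain ⟨y2, hy2⟩ := T.D_nonempty hκ'.1
  refine ⟨_, (T.mem_D_iff_exists hx' n).mpr ⟨κ', hκ', y2, hy2, rfl⟩, ?_⟩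
  rw [dist_eq_norm, show β.Phi κ + (β.contr ^ n) y1 - (β.Phi κ' + (β.contr ^ n) y2) =
    (β.Phi κ - β.Phi κ') + ((β.contr ^ n) y1 - (β.contr ^ n) y2) by abel]
  refine lt_of_le_of_lt ((norm_add_le _ _).trans (add_le_add hle ((norm_sub_le _ _).trans
    (add_le_add ?_ ?_)))) hn
  · exact β.norm_contr_pow_le_of_le (T.norm_le_radius hκ.1 hy1)
  · exact β.norm_contr_pow_le_of_le (T.norm_le_radius hκ'.1 hy2)

/-- The number of jumps is bounded independently of n while the size of each jump tends to 0. -/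
theorem D_eq_of_disjoint_V {x x' : ℝ} (hxx' : x ≤ x') (hx' : x' ∈ T.X)
    (hV : Disjoint T.V (Set.Ioc x x')) : x ∈ T.X ∧ T.D x = T.D x' := by
  let W : ℝ := ((T.X \ T.X').ncard + (T.X' \ T.X).ncard : ℕ)
  have hx : x ∈ T.X := (T.near_of_disjoint_V 0 hx' hV (Set.left_mem_Icc.mpr hxx')).1
  have hnear : ∀ n, Near (T.jumpBound n * W) (T.E n x) (T.E n x') := fun n => by
    refine (T.near_of_disjoint_V n hx' hV (Set.left_mem_Icc.mpr hxx')).2.mono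
      (mul_le_mul_of_nonneg_left ?_ (T.jumpBound_nonneg n))
    exact Nat.cast_le.mpr ((Set.ncard_le_ncard Set.inter_subset_left (T.jumps_finite n)).trans
      (T.ncard_jumps_le n))
  have ht : Tendsto (fun n => T.jumpBound n * W) atTop (𝓝 0) := by
    have := (β.tendsto_contrConst_mul
      (β.contrConst * (T.digitBound + T.digitBound) / (1 - β.rho))).mul_const W
    rwa [zero_mul] at this
  refine ⟨hx, Set.Subset.antisymm (T.D_subset_of_near hx hx' ht fun n => (hnear n).1)
    (T.D_subset_of_near hx' hx ht fun n κ hκ => ?_)⟩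
  obtain ⟨κ', h1, h2⟩ := (hnear n).2 κ hκ
  exact ⟨κ', h1, by rwa [norm_sub_rev]⟩

theorem D_eq_of_V_inter_Iic_eq {x x' : ℝ} (hx : x ∈ T.X) (hx' : x' ∈ T.X)
    (h : T.V ∩ Set.Iic x = T.V ∩ Set.Iic x') : T.D x = T.D x' := by
  wlog hle : x ≤ x' generalizing x x'
  · exact (this hx' hx h.symm (le_of_not_ge hle)).symm
  refine (T.D_eq_of_disjoint_V hle hx' (Set.disjoint_left.mpr fun v hv hvI => ?_)).2
  have : v ∈ T.V ∩ Set.Iic x := h ▸ ⟨hv, hvI.2⟩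
  exact absurd this.2 (not_le.mpr hvI.1)

theorem finite_range_D (hV : T.V.Finite) : {D | ∃ x ∈ T.X, T.D x = D}.Finite := by
  classical
  let F : Set ℝ → Set β.H := fun S =>
    if h : ∃ x ∈ T.X, T.V ∩ Set.Iic x = S then T.D h.choose else ∅
  refine (hV.finite_subsets.image F).subset ?_
  rintro _ ⟨x, hx, rfl⟩
  refine ⟨T.V ∩ Set.Iic x, Set.inter_subset_left, ?_⟩
  have h : ∃ y ∈ T.X, T.V ∩ Set.Iic y = T.V ∩ Set.Iic x := ⟨x, hx, rfl⟩
  simp only [F, dif_pos h]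
  exact T.D_eq_of_V_inter_Iic_eq h.choose_spec.1 hx h.choose_spec.2

theorem D_right (hV : T.V.Finite) {x : ℝ} (hx : x ∈ T.X) :
    ∀ᶠ y in 𝓝[≥] x, y ∈ T.X ∧ T.D y = T.D x := by
  have h1 : ∀ᶠ y in 𝓝[≥] x, ∀ v ∈ T.V, v ∉ Set.Ioc x y := by
    refine (Filter.eventually_all_finite hV).mpr fun v _ => ?_
    by_cases hv : v ≤ x
    · exact Eventually.of_forall fun y hy => absurd hy.1 (not_lt.mpr hv)
    · filter_upwards [nhdsWithin_le_nhds (gt_mem_nhds (not_le.mp hv))] with y hy hy'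
      exact absurd hy'.2 (not_le.mpr hy)
  filter_upwards [h1, T.X_right x, self_mem_nhdsWithin] with y hy hyX hxy
  exact ⟨hyX.mpr hx, (T.D_eq_of_disjoint_V hxy (hyX.mpr hx) (Set.disjoint_left.mpr hy)).2.symm⟩

end BetaTransformation
end BetaTiling

/-! ### Statement 1: tiles, periodic points and exclusive points -/

namespace BetaTiling

open MeasureTheory Filter Topology

namespace BetaTransformation

variable {β : PisotUnit} (T : BetaTransformation β)

/-! ### Tiles -/

/-- The restriction of `T` to `ℚ(β)`. -/
def mapK (x : β.K) : β.K := β.gen * x - T.digit x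

theorem coe_mapK (x : β.K) : (T.mapK x : ℝ) = T.map x := rfl

theorem coe_mapK_iterate (n : ℕ) (x : β.K) : ((T.mapK^[n] x : β.K) : ℝ) = T.map^[n] x := by
  induction n with
  | zero => rfl
  | succ n ih => rw [Function.iterate_succ_apply', Function.iterate_succ_apply', coe_mapK, ih]

variable {T}

theorem map_mem_ring (hA : ∀ a ∈ T.A, (a : ℝ) ∈ β.ring) {x : ℝ} (hx : x ∈ T.X)
    (hr : x ∈ β.ring) : T.map x ∈ β.ring :=
  sub_mem (mul_mem β.val_mem_ring hr) (hA _ (T.digit_spec hx).1)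

theorem mapK_mem_index (hA : ∀ a ∈ T.A, (a : ℝ) ∈ β.ring) {x : β.K} (hx : x ∈ T.index) :
    T.mapK x ∈ T.index := ⟨map_mem_ring hA hx.2 hx.1, T.map_mem hx.2⟩

theorem iterate_mapK_mem_index (hA : ∀ a ∈ T.A, (a : ℝ) ∈ β.ring) {x : β.K} (hx : x ∈ T.index)
    (n : ℕ) : T.mapK^[n] x ∈ T.index := by
  induction n with
  | zero => exact hx
  | succ n ih => rw [Function.iterate_succ_apply']; exact mapK_mem_index hA ih

/-- `𝒯_x = ⋃ M 𝒯_y`, where `y` runs over the preimages of `x`. -/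
theorem mem_tile_iff (hA : ∀ a ∈ T.A, (a : ℝ) ∈ β.ring) {x : β.K} (hx : x ∈ T.index) {p : β.H} :
    p ∈ T.tile x ↔ ∃ y ∈ T.index, T.mapK y = x ∧ ∃ p' ∈ T.tile y, β.contr p' = p := by
  constructor
  · rintro ⟨h, hh, rfl⟩
    obtain ⟨y, hy, hyx, h', hh', rfl⟩ := (T.mem_D_iff_exists_preimage hx.2).mp hh
    have hd := T.digit_spec hy
    have hyr : y = β.val⁻¹ * (x + T.digit y) := by
      rw [← hyx, map]
      have := β.pos.ne'
      field_simp; ring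
    have hring : y ∈ β.ring := by
      rw [hyr]; exact mul_mem β.inv_val_mem_ring (add_mem hx.1 (hA _ hd.1))
    let y' : β.K := ⟨y, β.ring_le_K hring⟩
    have hy'x : T.mapK y' = x := Subtype.ext hyx
    refine ⟨y', ⟨hring, hy⟩, hy'x, _, ⟨h', hh', rfl⟩, ?_⟩
    have e : β.gen * y' = x + T.digit y := by rw [← hy'x, mapK]; exact (sub_add_cancel _ _).symm
    rw [map_add, β.contr_Phi, e, β.Phi_add, add_assoc]
  · rintro ⟨y, hy, rfl, _, ⟨h', hh', rfl⟩, rfl⟩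
    refine ⟨_, (T.mem_D_iff_exists_preimage (T.map_mem hy.2)).mpr
      ⟨y, hy.2, rfl, h', hh', rfl⟩, ?_⟩
    change β.Phi (T.mapK y) + (β.Phi (T.digit y) + β.contr h') = _
    rw [← add_assoc, ← β.Phi_add, mapK, sub_add_cancel, map_add, β.contr_Phi]

theorem contr_pow_mem_tile (hA : ∀ a ∈ T.A, (a : ℝ) ∈ β.ring) {y : β.K} (hy : y ∈ T.index)
    {p : β.H} (hp : p ∈ T.tile y) (n : ℕ) : (β.contr ^ n) p ∈ T.tile (T.mapK^[n] y) := by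
  induction n with
  | zero => exact hp
  | succ n ih =>
    rw [Function.iterate_succ_apply', pow_succ', Module.End.mul_apply]
    have h := iterate_mapK_mem_index hA hy n
    exact (mem_tile_iff hA (mapK_mem_index hA h)).mpr ⟨_, h, rfl, _, ih, rfl⟩

/-- Every point of a tile comes from a backward orbit. -/
theorem exists_backward_tile (hA : ∀ a ∈ T.A, (a : ℝ) ∈ β.ring) {x : β.K} (hx : x ∈ T.index)
    {p : β.H} (hp : p ∈ T.tile x) : ∃ (w : ℕ → β.K) (v : ℕ → β.H), w 0 = x ∧ v 0 = p ∧
      (∀ n, w n ∈ T.index) ∧ (∀ n, T.mapK (w (n + 1)) = w n) ∧ (∀ n, v n ∈ T.tile (w n)) ∧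
      ∀ n, β.contr (v (n + 1)) = v n := by
  obtain ⟨u, h0, hY, hu⟩ := exists_backward
    (f := fun q : β.K × β.H => (T.mapK q.1, β.contr q.2))
    (Y := {q | q.1 ∈ T.index ∧ q.2 ∈ T.tile q.1}) (x := (x, p)) (by
      rintro ⟨x, p⟩ ⟨hx, hp⟩
      obtain ⟨y, hy, rfl, p', hp', rfl⟩ := (mem_tile_iff hA hx).mp hp
      exact ⟨(y, p'), ⟨hy, hp'⟩, rfl⟩) ⟨hx, hp⟩
  exact ⟨fun n => (u n).1, fun n => (u n).2, by simp [h0], by simp [h0], fun n => (hY n).1,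
    fun n => congrArg Prod.fst (hu n), fun n => (hY n).2, fun n => congrArg Prod.snd (hu n)⟩

theorem norm_sub_le_radius {x : β.K} (hx : x ∈ T.index) {p : β.H} (hp : p ∈ T.tile x) :
    ‖p - β.Phi x‖ ≤ T.radius := by
  obtain ⟨h, hh, rfl⟩ := hp
  rw [add_sub_cancel_left]
  exact T.norm_le_radius hx.2 hh

theorem isCompact_tile {x : β.K} (hx : x ∈ T.index) : IsCompact (T.tile x) :=
  (T.isCompact_D hx.2).image (by fun_prop)

theorem tile_nonempty {x : β.K} (hx : x ∈ T.index) : (T.tile x).Nonempty :=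
  (T.D_nonempty hx.2).image _

-- A tile stays within `radius` of Φ(x) and x is bounded on X, so lattice finiteness applies.
variable (T) in
theorem finite_tiles (R : ℝ) :
    {x ∈ T.index | (T.tile x ∩ Metric.closedBall 0 R).Nonempty}.Finite := by
  obtain ⟨B, -, hB⟩ := T.exists_bound_X
  refine (β.finite_bounded B (R + T.radius)).subset ?_
  rintro x ⟨hx, p, hp, hpR⟩
  refine ⟨hx.1, hB _ hx.2, ?_⟩
  have h1 := norm_sub_le_radius hx hp
  have h2 : ‖p‖ ≤ R := by simpa using hpR
  calc ‖β.Phi x‖ = ‖p - (p - β.Phi x)‖ := by congr 1; abel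
    _ ≤ _ := (norm_sub_le _ _).trans (add_le_add h2 h1)

theorem exists_mem_tile_near (hA : ∀ a ∈ T.A, (a : ℝ) ∈ β.ring) {q : β.K} (hq : q ∈ T.index)
    (n : ℕ) : ∃ p ∈ T.tile (T.mapK^[n] q),
      ‖p - β.Phi (β.gen ^ n * q)‖ ≤ β.contrConst * β.rho ^ n * T.radius := by
  obtain ⟨p, hp⟩ := tile_nonempty hq
  refine ⟨_, contr_pow_mem_tile hA hq hp n, ?_⟩
  rw [← β.contr_pow_Phi, ← map_sub]
  exact β.norm_contr_pow_le_of_le (norm_sub_le_radius hq hp)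

/-- `y + z β^{-n}` as an element of `ℚ(β)`. -/
abbrev shift (y z : β.K) (n : ℕ) : β.K := y + z / β.gen ^ n

theorem coe_shift (y z : β.K) (n : ℕ) : (shift y z n : ℝ) = y + z / β.val ^ n := by
  push_cast; rfl

theorem pow_mul_shift (y z : β.K) (n : ℕ) : β.gen ^ n * shift y z n = β.gen ^ n * y + z := by
  have := β.gen_ne_zero
  rw [shift, mul_add, mul_div_cancel₀ _ (pow_ne_zero _ this)]

theorem div_pow_mem_ring {z : ℝ} (hz : z ∈ β.ring) (n : ℕ) : z / β.val ^ n ∈ β.ring := by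
  rw [div_eq_mul_inv]; exact mul_mem hz (β.inv_pow_mem_ring n)

theorem tendsto_add_div_pow (y : ℝ) {z : ℝ} (hz : 0 ≤ z) :
    Tendsto (fun n : ℕ => y + z / β.val ^ n) atTop (𝓝[≥] y) := by
  refine tendsto_nhdsWithin_iff.mpr ⟨?_, Eventually.of_forall fun n => ?_⟩
  · have h := (tendsto_pow_atTop_nhds_zero_of_lt_one (inv_nonneg.mpr β.pos.le)
      (inv_lt_one_of_one_lt₀ β.one_lt)).const_mul z |>.const_add y
    simpa [div_eq_mul_inv] using h
  · have := div_nonneg hz (pow_nonneg β.pos.le n)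
    simpa using this

theorem tendsto_near (y : β.K) :
    Tendsto (fun n : ℕ => β.contrConst * β.rho ^ n * T.radius +
      β.contrConst * β.rho ^ n * ‖β.Phi y‖) atTop (𝓝 0) := by
  simpa using (β.tendsto_contrConst_mul T.radius).add (β.tendsto_contrConst_mul ‖β.Phi y‖)

/-- A tile which is close to `Φ(z)`. -/
theorem eventually_mem_tile_near (hA : ∀ a ∈ T.A, (a : ℝ) ∈ β.ring) {y z : β.K}
    (hy : y ∈ T.index) (hz : (z : ℝ) ∈ β.ring) (hz0 : 0 ≤ (z : ℝ)) {ε : ℝ} (hε : 0 < ε) :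
    ∀ᶠ n in atTop, shift y z n ∈ T.index ∧
      ∃ p ∈ T.tile (T.mapK^[n] (shift y z n)), ‖p - β.Phi z‖ < ε := by
  filter_upwards [(tendsto_add_div_pow (y : ℝ) hz0).eventually (T.X_right y),
    (tendsto_near (T := T) y).eventually (gt_mem_nhds hε)] with n h1 h2
  have hs : shift y z n ∈ T.index := by
    refine ⟨?_, ?_⟩
    · rw [coe_shift]; exact add_mem hy.1 (div_pow_mem_ring hz n)
    · rw [coe_shift]; exact h1.mpr hy.2
  obtain ⟨p, hp, hpn⟩ := exists_mem_tile_near hA hs n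
  refine ⟨hs, p, hp, lt_of_le_of_lt ?_ h2⟩
  -- Here Φ(βⁿ(y + zβ⁻ⁿ)) = MⁿΦ(y) + Φ(z), and the first term tends to 0.
  rw [pow_mul_shift, β.Phi_add, ← β.contr_pow_Phi] at hpn
  calc ‖p - β.Phi z‖ = ‖(p - ((β.contr ^ n) (β.Phi y) + β.Phi z)) + (β.contr ^ n) (β.Phi y)‖ := by
        congr 1; abel
    _ ≤ _ := (norm_add_le _ _).trans (add_le_add hpn (β.norm_contr_pow_le n _))

/-- A locally finite union of compact tiles is closed. -/
theorem mem_tile_of_forall_near {y : β.H}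
    (h : ∀ ε > 0, ∃ x ∈ T.index, ∃ p ∈ T.tile x, ‖p - y‖ < ε) : ∃ x ∈ T.index, y ∈ T.tile x := by
  have hfin := T.finite_tiles (‖y‖ + 1)
  have hcl : IsClosed (⋃ x ∈ {x ∈ T.index | (T.tile x ∩ Metric.closedBall 0 (‖y‖ + 1)).Nonempty},
      T.tile x) := hfin.isClosed_biUnion fun x hx => (isCompact_tile hx.1).isClosed
  have hy : y ∈ ⋃ x ∈ {x ∈ T.index | (T.tile x ∩ Metric.closedBall 0 (‖y‖ + 1)).Nonempty},
      T.tile x := by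
    rw [← hcl.closure_eq, Metric.mem_closure_iff]
    intro ε hε
    obtain ⟨x, hx, p, hp, hpy⟩ := h (min ε 1) (lt_min hε one_pos)
    refine ⟨p, Set.mem_biUnion ⟨hx, p, hp, ?_⟩ hp, ?_⟩
    · rw [mem_closedBall_zero_iff]
      calc ‖p‖ = ‖y + (p - y)‖ := by congr 1; abel
        _ ≤ _ := (norm_add_le _ _).trans (by
          gcongr
          exact hpy.le.trans (min_le_right _ _))
    · rw [dist_comm, dist_eq_norm]; exact hpy.trans_le (min_le_left _ _)
  simp only [Set.mem_iUnion₂] at hy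
  obtain ⟨x, hx, hyx⟩ := hy
  exact ⟨x, hx.1, hyx⟩

theorem exists_mem_tile (hA : ∀ a ∈ T.A, (a : ℝ) ∈ β.ring) (hne : T.index.Nonempty) (y : β.H) :
    ∃ x ∈ T.index, y ∈ T.tile x := by
  obtain ⟨q, hq⟩ := hne
  refine mem_tile_of_forall_near fun ε hε => ?_
  obtain ⟨z, hz, hz0, hzy⟩ := β.exists_Phi_near y (half_pos hε)
  obtain ⟨n, hs, p, hp, hpz⟩ := (eventually_mem_tile_near hA hq hz hz0 (half_pos hε)).exists
  refine ⟨_, iterate_mapK_mem_index hA hs n, p, hp, ?_⟩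
  calc ‖p - y‖ ≤ ‖p - β.Phi z‖ + ‖β.Phi z - y‖ := norm_sub_le_norm_sub_add_norm_sub _ _ _
    _ < ε := by linarith

/-! ### Purely periodic points -/

theorem iterate_mem_P (hA : ∀ a ∈ T.A, (a : ℝ) ∈ β.ring) {x : β.K} (hx : x ∈ T.P) (n : ℕ) :
    T.mapK^[n] x ∈ T.P := by
  obtain ⟨hxi, N, hN, hper⟩ := hx
  refine ⟨iterate_mapK_mem_index hA hxi n, N, hN, ?_⟩
  rw [coe_mapK_iterate, ← Function.iterate_add_apply, add_comm, Function.iterate_add_apply, hper]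

/-- The tiles which contain `Φ(z)`. -/
theorem eventually_exists_P (hA : ∀ a ∈ T.A, (a : ℝ) ∈ β.ring) {x z : β.K} (hx : x ∈ T.index)
    (hz : (z : ℝ) ∈ β.ring) (hz0 : 0 ≤ (z : ℝ)) (hmem : β.Phi z ∈ T.tile x) :
    ∀ᶠ n : ℕ in atTop, ∃ y ∈ T.P, T.map^[n] (y + z / β.val ^ n) = x := by
  obtain ⟨w, v, rfl, hv0, hwi, hw, hvt, hv⟩ := exists_backward_tile hA hx hmem
  obtain ⟨B, -, hB⟩ := T.exists_bound_X
  -- Removing the shift leaves y_n with Φ(y_n) = Φ(w_n) - v_n bounded, so all y_n lie in a finite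
  -- set F. For large n the shift is too small to change digits on F; hence the y_n form a backward
  -- T-orbit in a finite set, which is periodic.
  let y : ℕ → β.K := fun n => w n - z / β.gen ^ n
  have hwy : ∀ n, (w n : ℝ) = y n + z / β.val ^ n := fun n => by
    simp only [y]; push_cast; rw [β.coe_gen]; ring
  have hvn : ∀ n, v n = β.Phi (z / β.gen ^ n) := fun n => by
    apply β.contr_pow_injective n
    rw [β.contr_pow_Phi, mul_div_cancel₀ _ (pow_ne_zero _ β.gen_ne_zero), ← hv0]
    have := iterate_backward hv n 0
    rw [Module.End.pow_apply]
    simpa using this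
  have hzn : ∀ n : ℕ, 0 ≤ (z : ℝ) / β.val ^ n := fun n => div_nonneg hz0 (pow_nonneg β.pos.le n)
  set F := {x : β.K | (x : ℝ) ∈ β.ring ∧ |(x : ℝ)| ≤ B + z ∧ ‖β.Phi x‖ ≤ T.radius} with hF
  have hFfin : F.Finite := β.finite_bounded _ _
  have hyr : ∀ n, (y n : ℝ) ∈ β.ring := fun n => by
    have : (y n : ℝ) = w n - z / β.val ^ n := by rw [hwy]; ring
    rw [this]; exact sub_mem (hwi n).1 (div_pow_mem_ring hz n)
  have hyF : ∀ n, y n ∈ F := by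
    intro n
    refine ⟨hyr n, ?_, ?_⟩
    · have : (y n : ℝ) = w n - z / β.val ^ n := by rw [hwy]; ring
      rw [this]
      refine (abs_sub _ _).trans (add_le_add (hB _ (hwi n).2) ?_)
      rw [abs_of_nonneg (hzn n)]
      exact div_le_self hz0 (one_le_pow₀ β.one_lt.le)
    · have := norm_sub_le_radius (hwi n) (hvt n)
      rwa [hvn, norm_sub_rev, ← β.Phi_sub] at this
  have hev : ∀ᶠ n : ℕ in atTop, ∀ q ∈ F, ((q + z / β.val ^ n : ℝ) ∈ T.X ↔ (q : ℝ) ∈ T.X) ∧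
      ((q : ℝ) ∈ T.X → T.map (q + z / β.val ^ n) = T.map q + β.val * (z / β.val ^ n)) := by
    refine (Filter.eventually_all_finite hFfin).mpr fun q _ => ?_
    have ht := tendsto_add_div_pow (β := β) (q : ℝ) hz0
    by_cases hq : (q : ℝ) ∈ T.X
    · filter_upwards [ht.eventually (T.X_right q), ht.eventually (T.iterate_right hq 1)]
        with n h1 h2
      refine ⟨h1, fun _ => ?_⟩
      simpa using h2
    · filter_upwards [ht.eventually (T.X_right q)] with n h1
      exact ⟨h1, fun h => absurd h hq⟩
  obtain ⟨n₀, hn₀⟩ := eventually_atTop.mp hev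
  have hyX : ∀ n ≥ n₀, (y n : ℝ) ∈ T.X := fun n hn =>
    (hn₀ n hn _ (hyF n)).1.mp (hwy n ▸ (hwi n).2)
  have hyT : ∀ n ≥ n₀, T.mapK (y (n + 1)) = y n := fun n hn => by
    have h1 := (hn₀ (n + 1) (by omega) _ (hyF (n + 1))).2 (hyX (n + 1) (by omega))
    rw [← hwy, ← coe_mapK, hw, hwy n] at h1
    refine Subtype.ext ?_
    rw [coe_mapK]
    have : β.val * (z / β.val ^ (n + 1)) = z / β.val ^ n := by
      have := β.pos.ne'
      rw [pow_succ]; field_simp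
    linarith
  filter_upwards [eventually_ge_atTop n₀] with n hn
  refine ⟨y n, ⟨⟨hyr n, hyX n hn⟩, ?_⟩, ?_⟩
  · have hback : ∀ k, T.mapK (y (n + (k + 1))) = y (n + k) := fun k => hyT (n + k) (by omega)
    obtain ⟨N, hN, hper⟩ := exists_period_of_backward (w := fun k => y (n + k)) hback
      (hFfin.subset (by rintro _ ⟨k, rfl⟩; exact hyF _))
    refine ⟨N, hN, ?_⟩
    have h1 := iterate_backward (w := fun k => y (n + k)) hback N 0
    simp only [add_zero] at h1 hper
    rw [hper] at h1
    rw [← coe_mapK_iterate, h1]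
  · rw [← hwy, ← coe_mapK_iterate]
    have := iterate_backward hw n 0
    rw [add_zero] at this
    rw [this]

theorem isPeriodicPt {x : β.K} (hx : x ∈ T.P) : ∃ N, 1 ≤ N ∧ ∀ m, T.map^[N * m] (x : ℝ) = x := by
  obtain ⟨-, N, hN, hper⟩ := hx
  exact ⟨N, hN, fun m => Function.IsPeriodicPt.mul_const hper m⟩

/-- This is the case z = 0 of the two links between tiles and orbits. For periodic x, times
divisible by the period return x itself, so 𝒯_x contains points arbitrarily close to 0. -/
theorem zero_mem_tile_iff (hA : ∀ a ∈ T.A, (a : ℝ) ∈ β.ring) {x : β.K} (hx : x ∈ T.index) :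
    0 ∈ T.tile x ↔ x ∈ T.P := by
  constructor
  · intro h
    have h0 : β.Phi 0 ∈ T.tile x := by rwa [β.Phi_zero]
    obtain ⟨n, y, hy, hyx⟩ := (eventually_exists_P hA hx (by simp) (by simp) h0).exists
    have : T.mapK^[n] y = x := Subtype.ext (by rw [coe_mapK_iterate, ← hyx]; simp)
    exact this ▸ iterate_mem_P hA hy n
  · intro h
    obtain ⟨N, hN, hper⟩ := isPeriodicPt h
    rw [← (isCompact_tile hx).isClosed.closure_eq, Metric.mem_closure_iff]
    intro ε hε
    obtain ⟨n₀, hn₀⟩ := eventually_atTop.mp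
      (eventually_mem_tile_near hA hx (z := 0) (by simp) (by simp) hε)
    obtain ⟨-, p, hp, hpz⟩ := hn₀ (N * n₀) (Nat.le_mul_of_pos_left _ hN)
    have e : T.mapK^[N * n₀] (shift x 0 (N * n₀)) = x := Subtype.ext (by
      rw [coe_mapK_iterate, shift, zero_div, add_zero, hper])
    rw [e] at hp
    rw [β.Phi_zero] at hpz
    exact ⟨p, hp, by rwa [dist_comm, dist_eq_norm]⟩

theorem P_finite (hA : ∀ a ∈ T.A, (a : ℝ) ∈ β.ring) : T.P.Finite :=
  (T.finite_tiles 0).subset fun _ hx =>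
    ⟨hx.1, 0, (zero_mem_tile_iff hA hx.1).mpr hx, by simp⟩

/-- Forward orbits stay bounded both in ℝ and under Φ, so they run in a finite subset of ℤ[β]. -/
theorem eventually_mem_P (hA : ∀ a ∈ T.A, (a : ℝ) ∈ β.ring) {x : β.K} (hx : x ∈ T.index) :
    ∀ᶠ n : ℕ in atTop, T.mapK^[n] x ∈ T.P := by
  obtain ⟨B, -, hB⟩ := T.exists_bound_X
  have hi := iterate_mapK_mem_index hA hx
  have hrec := β.norm_le_of_recursion (h := fun n => β.Phi (T.mapK^[n] x))
    (c := fun n => -β.Phi (T.digit (T.mapK^[n] x : β.K))) (B := T.digitBound)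
    (fun n => by
      rw [Function.iterate_succ_apply', mapK, β.Phi_sub, β.contr_Phi, sub_eq_add_neg])
    (fun n => by rw [norm_neg]; exact T.norm_digit_le _)
  have hmaps : Set.MapsTo (fun n => T.mapK^[n] x) Set.univ {y : β.K | (y : ℝ) ∈ β.ring ∧
      |(y : ℝ)| ≤ B ∧ ‖β.Phi y‖ ≤ _} := fun n _ => ⟨(hi n).1, hB _ (hi n).2, hrec n⟩
  obtain ⟨i, -, j, -, hne, h⟩ := Set.infinite_univ.exists_ne_map_eq_of_mapsTo hmaps
    (β.finite_bounded B _)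
  wlog hij : i < j generalizing i j
  · exact this j i hne.symm h.symm (by omega)
  filter_upwards [eventually_ge_atTop i] with n hn
  refine ⟨hi n, j - i, by omega, ?_⟩
  have h' : T.mapK^[i] x = T.mapK^[j] x := h
  rw [← coe_mapK_iterate, ← Function.iterate_add_apply, show j - i + n = (n - i) + j by omega,
    Function.iterate_add_apply, ← h', ← Function.iterate_add_apply, Nat.sub_add_cancel hn]

/-! ### The number `ε` -/

theorem gap_spec {y : ℝ} (hy : y ∈ T.X) :
    0 < T.gap y ∧ ∀ s, y ≤ s → s < y + T.gap y → s ∈ T.piece (T.digit y) := by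
  have hd := T.digit_spec hy
  have hbb : BddBelow {z : ℝ | y < z ∧ z ∉ T.piece (T.digit y)} := ⟨y, fun z hz => hz.1.le⟩
  have hne : {z : ℝ | y < z ∧ z ∉ T.piece (T.digit y)}.Nonempty := by
    obtain ⟨B, -, hB⟩ := T.exists_bound_X
    refine ⟨B + 1, ?_, fun h => ?_⟩
    · have := (le_abs_self _).trans (hB y hy); linarith
    · have := (le_abs_self _).trans (hB _ (T.mem_X.mpr ⟨_, hd.1, h⟩)); linarith
  constructor
  · obtain ⟨u, hu, hsub⟩ := mem_nhdsGE_iff_exists_Ico_subset.mp (T.piece_right (T.digit y) y)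
    have : u ≤ sInf {z : ℝ | y < z ∧ z ∉ T.piece (T.digit y)} := by
      refine le_csInf hne fun z hz => ?_
      by_contra hlt
      exact hz.2 ((hsub ⟨hz.1.le, not_le.mp hlt⟩).mpr hd.2)
    have hu' : y < u := hu
    unfold gap; linarith
  · intro s hs hs'
    rcases hs.eq_or_lt with rfl | h
    · exact hd.2
    · by_contra hn
      have := csInf_le hbb (show s ∈ {z : ℝ | y < z ∧ z ∉ T.piece (T.digit y)} from ⟨h, hn⟩)
      unfold gap at hs'; linarith

theorem eps_pos (hA : ∀ a ∈ T.A, (a : ℝ) ∈ β.ring) (hP : T.P.Nonempty) : 0 < T.eps := by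
  obtain ⟨y, hy, h⟩ := (hP.image fun y : β.K => T.gap y).csInf_mem ((P_finite hA).image _)
  exact mul_pos (h ▸ (gap_spec hy.1.2).1) β.pos

theorem mem_piece_of_lt_eps (hA : ∀ a ∈ T.A, (a : ℝ) ∈ β.ring) {y : β.K} (hy : y ∈ T.P) {s : ℝ}
    (hs : 0 ≤ s) (hs' : β.val * s < T.eps) : y + s ∈ T.piece (T.digit y) := by
  refine (gap_spec hy.1.2).2 _ (by linarith) ?_
  have h1 : sInf ((fun y : β.K => T.gap y) '' T.P) ≤ T.gap y :=
    csInf_le ((P_finite hA).image _).bddBelow ⟨y, hy, rfl⟩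
  have h2 : β.val * s < β.val * sInf ((fun y : β.K => T.gap y) '' T.P) := by
    rw [mul_comm β.val (sInf _)]; exact hs'
  have h3 := lt_of_mul_lt_mul_left h2 β.pos.le
  linarith

/-- Before each application of T the shift is at most z/β < ε/β, hence below the gap at the current
point of P, and the digit is that of the unshifted orbit. -/
theorem iterate_add_of_lt_eps (hA : ∀ a ∈ T.A, (a : ℝ) ∈ β.ring) {y : β.K} (hy : y ∈ T.P)
    {z : ℝ} (hz : 0 ≤ z) (hz' : z < T.eps) (j : ℕ) :
    (y + z / β.val ^ j ∈ T.X) ∧ T.map^[j] (y + z / β.val ^ j) = T.map^[j] y + z := by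
  have h0 := β.pos
  have hstep : ∀ y ∈ T.P, ∀ j : ℕ, (y + z / β.val ^ (j + 1) : ℝ) ∈ T.X ∧
      T.map (y + z / β.val ^ (j + 1)) = T.map y + z / β.val ^ j := by
    intro y hy j
    have e : β.val * (z / β.val ^ (j + 1)) = z / β.val ^ j := by rw [pow_succ]; field_simp
    have h1 := mem_piece_of_lt_eps hA hy (s := z / β.val ^ (j + 1)) (by positivity) (by
      rw [e]; exact (div_le_self hz (one_le_pow₀ β.one_lt.le)).trans_lt hz')
    have hd := T.digit_spec hy.1.2
    refine ⟨T.mem_X.mpr ⟨_, hd.1, h1⟩, ?_⟩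
    rw [map, T.digit_eq hd.1 h1, map, ← e]; ring
  induction j generalizing y with
  | zero =>
    refine ⟨?_, by simp⟩
    -- That y + z ∈ X is seen one step earlier: it is the image of the periodic predecessor of y
    -- shifted by z/β. This is the purpose of the factor β in ε.
    obtain ⟨N, hN, hper⟩ := isPeriodicPt hy
    have h1 := hstep _ (iterate_mem_P hA hy (N - 1)) 0
    have h2 : T.map (T.mapK^[N - 1] y : β.K) = y := by
      rw [coe_mapK_iterate, ← Function.iterate_succ_apply' T.map, Nat.succ_eq_add_one,
        Nat.sub_add_cancel hN]
      simpa using hper 1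
    rw [← h2, ← h1.2]
    exact T.map_mem h1.1
  | succ j ih =>
    have h1 := hstep y hy j
    refine ⟨h1.1, ?_⟩
    have h2 := (ih (iterate_mem_P hA hy 1)).2
    rw [Function.iterate_one, coe_mapK] at h2
    rw [Function.iterate_succ_apply, h1.2, h2, Function.iterate_succ_apply]

/-! ### Exclusive points -/

/-- Points are merged into x one at a time. The requirement Tᵏ(x + z) = x in (W) ensures that the
points already merged remain so when a further, much smaller, translation is added. -/
theorem exists_common (hA : ∀ a ∈ T.A, (a : ℝ) ∈ β.ring) {x : β.K} (hx : x ∈ T.P)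
    (hW : T.WeakFinitenessAt x) (S : Finset β.K) (hS : ∀ y ∈ S, y ∈ T.P) :
    ∃ z : ℝ, z ∈ β.ring ∧ 0 ≤ z ∧ z < T.eps ∧ ∃ k : ℕ, T.map^[k] (x + z) = x ∧
      ∀ y ∈ S, T.map^[k] (y + z) = x := by
  classical
  have hpos : ∀ n : ℕ, 0 < β.val ^ n := pow_pos β.pos
  induction S using Finset.induction_on with
  | empty => exact ⟨0, by simp, le_rfl, eps_pos hA ⟨x, hx⟩, 0, by simp, by simp⟩
  | insert y S hyS ih =>
    obtain ⟨z₁, hz₁r, hz₁, hz₁', k₁, hk₁x, hk₁⟩ := ih fun y hy => hS y (Finset.mem_insert_of_mem hy)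
    have hyP := hS y (Finset.mem_insert_self _ _)
    have hX : ∀ s ∈ T.P, (s + z₁ : ℝ) ∈ T.X := fun s hs => by
      simpa using (iterate_add_of_lt_eps hA hs hz₁ hz₁' 0).1
    let y₁ : β.K := ⟨y + z₁, add_mem y.2 (β.ring_le_K hz₁r)⟩
    have hy₁ : y₁ ∈ T.index := ⟨add_mem hyP.1.1 hz₁r, hX y hyP⟩
    obtain ⟨N, hN, hper⟩ := isPeriodicPt hx
    obtain ⟨n₀, hn₀⟩ := eventually_atTop.mp (eventually_mem_P hA hy₁)
    -- Congruent to k₁ modulo the period of x, so merged points are at x, and late enough for the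
    -- orbit of y + z₁ to be in P.
    set K₀ := N * (n₀ + k₁) + k₁ with hK₀
    have hy₂ : T.mapK^[K₀] y₁ ∈ T.P := hn₀ _ (by nlinarith)
    set y₂ := T.mapK^[K₀] y₁ with hy₂'
    have hKx : ∀ s : ℝ, T.map^[k₁] (s + z₁) = x → T.map^[K₀] (s + z₁) = x := fun s hs => by
      rw [hK₀, Function.iterate_add_apply, hs, hper]
    have hKy : T.map^[K₀] (y + z₁) = y₂ := (T.coe_mapK_iterate K₀ y₁).symm
    obtain ⟨z₂, ⟨hz₂r, hz₂, hz₂'⟩, k₂, hk₂, hk₂x⟩ := hW y₂ hy₂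
    obtain ⟨N₂, hN₂, hper₂⟩ := isPeriodicPt hy₂
    have hev : ∀ᶠ m : ℕ in atTop, z₁ + z₂ / β.val ^ m < T.eps ∧
        ∀ s ∈ insert y (insert x S), T.map^[K₀] ((s + z₁) + z₂ / β.val ^ m) =
          T.map^[K₀] (s + z₁) + β.val ^ K₀ * (z₂ / β.val ^ m) := by
      refine Filter.Eventually.and ?_ ((Filter.eventually_all_finset _).mpr fun s hs => ?_)
      · exact ((tendsto_add_div_pow z₁ hz₂).mono_right nhdsWithin_le_nhds).eventually
          (gt_mem_nhds hz₁')
      · have hsP : s ∈ T.P := by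
          rcases Finset.mem_insert.mp hs with rfl | hs
          · exact hyP
          · rcases Finset.mem_insert.mp hs with rfl | hs
            · exact hx
            · exact hS s (Finset.mem_insert_of_mem hs)
        filter_upwards [(tendsto_add_div_pow (s + z₁ : ℝ) hz₂).eventually
          (T.iterate_right (hX s hsP) K₀)] with m hm
        simpa using hm
    obtain ⟨m, hm⟩ := eventually_atTop.mp hev
    -- A common multiple of the periods of x and y₂: after j more steps both are back and the shift
    -- has grown to exactly z₂.
    set j := N * N₂ * m with hj
    have hjm : m ≤ j := Nat.le_mul_of_pos_left _ (Nat.mul_pos hN hN₂)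
    obtain ⟨hlt, hm⟩ := hm (K₀ + j) (by omega)
    have hcan : β.val ^ K₀ * (z₂ / β.val ^ (K₀ + j)) = z₂ / β.val ^ j := by
      have := hpos K₀
      have := hpos j
      rw [pow_add β.val K₀ j]; field_simp
    have hjx : T.map^[j] (x : ℝ) = x := by rw [hj, mul_assoc]; exact hper _
    have hjy : T.map^[j] (y₂ : ℝ) = y₂ := by rw [hj, mul_comm N, mul_assoc]; exact hper₂ _
    have hfin : ∀ s ∈ insert y (insert x S), ∀ q ∈ T.P, T.map^[K₀] (s + z₁) = q →
        T.map^[j] (q : ℝ) = q → T.map^[k₂] (q + z₂) = x →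
        T.map^[k₂ + (j + K₀)] (s + (z₁ + z₂ / β.val ^ (K₀ + j))) = x := by
      intro s hs q hq h1 h2 h3
      rw [Function.iterate_add_apply, Function.iterate_add_apply, ← add_assoc, hm s hs, h1, hcan,
        (iterate_add_of_lt_eps hA hq hz₂ hz₂' j).2, h2, h3]
    refine ⟨z₁ + z₂ / β.val ^ (K₀ + j), add_mem hz₁r (div_pow_mem_ring hz₂r _),
      add_nonneg hz₁ (div_nonneg hz₂ (hpos _).le), hlt, k₂ + (j + K₀), ?_, fun s hs => ?_⟩
    · exact hfin x (by simp) x hx (hKx x hk₁x) hjx hk₂x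
    · rcases Finset.mem_insert.mp hs with rfl | hs
      · exact hfin s (by simp) y₂ hy₂ hKy hjy hk₂
      · exact hfin s (by simp [hs]) x hx (hKx s (hk₁ s hs)) hjx hk₂x

/-- The point is Φ(βᵏz) with the common z and k. Any tile containing it has index Tⁿ(y + βᵏzβ⁻ⁿ) for
some y ∈ P; after n - k steps this orbit is at a point of P plus z, and k more steps lead to x. -/
theorem hasExclusivePoint_of_weakFinitenessAt (hA : ∀ a ∈ T.A, (a : ℝ) ∈ β.ring) {x : β.K}
    (hx : x ∈ T.P) (hW : T.WeakFinitenessAt x) : T.HasExclusivePoint x := by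
  obtain ⟨z, hzr, hz, hz', k, -, hk⟩ := exists_common hA hx hW (P_finite hA).toFinset
    fun y hy => by simpa using hy
  let z' : β.K := β.gen ^ k * ⟨z, β.ring_le_K hzr⟩
  have hz'c : (z' : ℝ) = β.val ^ k * z := by simp only [z']; push_cast; rfl
  have hz'r : (z' : ℝ) ∈ β.ring := hz'c ▸ mul_mem (β.pow_mem_ring k) hzr
  have hz'0 : 0 ≤ (z' : ℝ) := hz'c ▸ mul_nonneg (pow_nonneg β.pos.le k) hz
  have huniq : ∀ x' ∈ T.index, β.Phi z' ∈ T.tile x' → x' = x := by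
    intro x' hx' hmem
    obtain ⟨n, ⟨y, hy, hyx⟩, hkn⟩ :=
      ((eventually_exists_P hA hx' hz'r hz'0 hmem).and (eventually_ge_atTop k)).exists
    have e : (z' : ℝ) / β.val ^ n = z / β.val ^ (n - k) := by
      have h1 : β.val ^ n = β.val ^ k * β.val ^ (n - k) := by
        rw [← pow_add]; congr 1; omega
      have h2 := pow_pos β.pos k
      have h3 := pow_pos β.pos (n - k)
      rw [hz'c, h1]; field_simp
    have hn : n = k + (n - k) := by omega
    rw [e, hn, Function.iterate_add_apply, show k + (n - k) - k = n - k by omega,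
      (iterate_add_of_lt_eps hA hy hz hz' _).2, ← coe_mapK_iterate,
      hk _ (by simpa using iterate_mem_P hA hy _)] at hyx
    exact Subtype.ext hyx.symm
  obtain ⟨x', hx', hmem⟩ := exists_mem_tile hA ⟨x, hx.1⟩ (β.Phi z')
  have := huniq x' hx' hmem
  subst this
  exact ⟨_, hmem, huniq⟩

/-- Near a point `y`, there are only tiles which contain `y`. -/
theorem exists_ball_of_mem_tile {S : Set β.K} {y : β.H}
    (hy : ∀ x' ∈ T.index, y ∈ T.tile x' → x' ∈ S) :
    ∃ r > 0, ∀ p ∈ Metric.ball y r, ∀ x' ∈ T.index, p ∈ T.tile x' → x' ∈ S := by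
  have hfin := (T.finite_tiles (‖y‖ + 1)).subset
    (Set.sdiff_subset : _ \ S ⊆ _)
  have hcl : IsClosed (⋃ x' ∈ {x' ∈ T.index |
      (T.tile x' ∩ Metric.closedBall 0 (‖y‖ + 1)).Nonempty} \ S, T.tile x') :=
    hfin.isClosed_biUnion fun x hx => (isCompact_tile hx.1.1).isClosed
  have hmem : y ∈ (⋃ x' ∈ {x' ∈ T.index |
      (T.tile x' ∩ Metric.closedBall 0 (‖y‖ + 1)).Nonempty} \ S, T.tile x')ᶜ := by
    simp only [Set.mem_compl_iff, Set.mem_iUnion₂, not_exists]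
    exact fun x' hx' h => hx'.2 (hy x' hx'.1.1 h)
  obtain ⟨r, hr, hsub⟩ := Metric.isOpen_iff.mp hcl.isOpen_compl y hmem
  refine ⟨min r 1, lt_min hr one_pos, fun p hp x' hx' hpx' => ?_⟩
  by_contra hne
  refine hsub (Metric.ball_subset_ball (min_le_left _ _) hp)
    (Set.mem_biUnion ⟨⟨hx', p, hpx', ?_⟩, hne⟩ hpx')
  rw [mem_closedBall_zero_iff]
  have h1 : ‖p - y‖ < 1 := by
    rw [← dist_eq_norm]; exact (Metric.mem_ball.mp hp).trans_le (min_le_right _ _)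
  calc ‖p‖ = ‖y + (p - y)‖ := by congr 1; abel
    _ ≤ _ := (norm_add_le _ _).trans (by linarith)

/-- Put Φ(z) into a ball that meets only 𝒯_x. For large n the orbits of all y + zβ⁻ⁿ must then be at
x at time n, and zβ⁻ⁿ < ε. -/
theorem weakFinitenessAt_of_hasExclusivePoint (hA : ∀ a ∈ T.A, (a : ℝ) ∈ β.ring) {x : β.K}
    (hx : x ∈ T.P) (hE : T.HasExclusivePoint x) : T.WeakFinitenessAt x := by
  obtain ⟨p₀, -, hp₀⟩ := hE
  obtain ⟨r, hr, hball⟩ := exists_ball_of_mem_tile (S := {x}) hp₀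
  obtain ⟨z, hzr, hz, hzp⟩ := β.exists_Phi_near p₀ (half_pos hr)
  have key : ∀ y ∈ T.P, ∀ᶠ n : ℕ in atTop, T.map^[n] (y + z / β.val ^ n) = x := by
    intro y hy
    filter_upwards [eventually_mem_tile_near hA hy.1 hzr hz (half_pos hr)] with n hn
    obtain ⟨hs, p, hp, hpz⟩ := hn
    have h1 := hball p (by
      rw [Metric.mem_ball, dist_eq_norm]
      calc ‖p - p₀‖ ≤ ‖p - β.Phi z‖ + ‖β.Phi z - p₀‖ := norm_sub_le_norm_sub_add_norm_sub _ _ _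
        _ < r := by linarith) _ (iterate_mapK_mem_index hA hs n) hp
    rw [← h1, coe_mapK_iterate, coe_shift]
  intro y hy
  have hev : ∀ᶠ n : ℕ in atTop, 0 + (z : ℝ) / β.val ^ n < T.eps :=
    ((tendsto_add_div_pow 0 hz).mono_right nhdsWithin_le_nhds).eventually
      (gt_mem_nhds (eps_pos hA ⟨x, hx⟩))
  obtain ⟨n, h1, h2, h3⟩ := ((key y hy).and ((key x hx).and hev)).exists
  exact ⟨z / β.val ^ n, ⟨div_pow_mem_ring hzr n, div_nonneg hz (pow_nonneg β.pos.le n),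
    by simpa using h3⟩, n, h1, h2⟩

end BetaTransformation
end BetaTiling

/-! ### Disjointness in measure of the set equation -/

namespace BetaTiling

open MeasureTheory Filter Topology

open scoped ENNReal

/-- If the measure of a finite union is the sum of the measures, then the sets are disjoint up to
a null set. -/
theorem ae_eq_of_sum_measure_le {α ι : Type*} [MeasurableSpace α] {μ : Measure α} (s : Finset ι)
    {B : ι → Set α} (hB : ∀ i ∈ s, MeasurableSet (B i)) {U : Set α} (hU : MeasurableSet U)
    (hsub : U ⊆ ⋃ i ∈ s, B i) (hfin : μ U ≠ ∞) (hle : ∑ i ∈ s, μ (B i) ≤ μ U) :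
    ∀ᵐ p ∂μ, ∀ i ∈ s, ∀ j ∈ s, p ∈ B i → p ∈ B j → p ∈ U → i = j := by
  classical
  let f : α → ℝ≥0∞ := U.indicator 1
  let g : α → ℝ≥0∞ := fun p => ∑ i ∈ s, (B i).indicator 1 p
  have hgm : Measurable g := Finset.measurable_sum _ fun i hi => measurable_one.indicator (hB i hi)
  have hfint : ∫⁻ p, f p ∂μ = μ U := lintegral_indicator_one hU
  have hgint : ∫⁻ p, g p ∂μ = ∑ i ∈ s, μ (B i) := by
    rw [lintegral_finsetSum' _ fun i hi => (measurable_one.indicator (hB i hi)).aemeasurable]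
    exact Finset.sum_congr rfl fun i hi => lintegral_indicator_one (hB i hi)
  have hfg : ∀ p, f p ≤ g p := by
    intro p
    by_cases hp : p ∈ U
    · have := hsub hp
      simp only [Set.mem_iUnion₂] at this
      obtain ⟨i, hi, hpi⟩ := this
      calc f p = (B i).indicator 1 p := by simp [f, hp, hpi]
        _ ≤ g p := Finset.single_le_sum (f := fun i => (B i).indicator (1 : α → ℝ≥0∞) p)
          (fun _ _ => zero_le) hi
    · simp [f, hp]
  -- The indicator of U is at most the sum of the indicators of the B_i, so the reverse inequality
  -- of integrals forces equality almost everywhere; two overlapping sets would make the sum at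
  -- least 2.
  have hae := ae_eq_of_ae_le_of_lintegral_le (Eventually.of_forall hfg) (hfint ▸ hfin)
    hgm.aemeasurable (by rw [hfint, hgint]; exact hle)
  filter_upwards [hae] with p hp i hi j hj hpi hpj hpU
  by_contra hne
  have h1 : g p = 1 := by rw [← hp]; simp [f, hpU]
  have h2 : ∑ k ∈ ({i, j} : Finset ι), (B k).indicator (1 : α → ℝ≥0∞) p ≤ g p :=
    Finset.sum_le_sum_of_subset (by
      intro k hk
      rcases Finset.mem_insert.mp hk with rfl | hk
      · exact hi
      · rw [Finset.mem_singleton.mp hk]; exact hj)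
  rw [Finset.sum_pair hne, h1] at h2
  simp only [Set.indicator_of_mem hpi, Set.indicator_of_mem hpj, Pi.one_apply] at h2
  norm_num at h2

theorem exists_Ico_of_ae {p : ℝ → Prop} (h : ∀ᵐ y, p y) {x : ℝ} {q : ℝ → Prop}
    (hq : ∀ᶠ y in 𝓝[≥] x, q y) : ∃ y, p y ∧ q y := by
  obtain ⟨u, hu, hsub⟩ := mem_nhdsGE_iff_exists_Ico_subset.mp hq
  by_contra! hcon
  have h1 : volume (Set.Ico x u) = 0 :=
    measure_mono_null (fun y hy hpy => hcon y hpy (hsub hy)) h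
  rw [Real.volume_Ico, ENNReal.ofReal_eq_zero] at h1
  have : x < u := hu
  linarith

theorem lintegral_comp_affine {f : ℝ → ℝ≥0∞} (hf : Measurable f) {b : ℝ} (hb : 0 < b) (a : ℝ) :
    ∫⁻ x, f ((x + a) / b) = ENNReal.ofReal b * ∫⁻ y, f y := by
  have h1 : ∫⁻ x, f ((x + a) / b) = ∫⁻ x, f (b⁻¹ * x) := by
    rw [← lintegral_add_right_eq_self (fun x => f (b⁻¹ * x)) a]
    exact lintegral_congr fun x => by rw [div_eq_inv_mul]
  rw [h1, ← lintegral_map hf (measurable_const_mul b⁻¹),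
    Real.map_volume_mul_left (inv_ne_zero hb.ne'), lintegral_smul_measure, inv_inv, abs_of_pos hb,
    smul_eq_mul]

namespace PisotUnit

variable (β : PisotUnit)

instance : β.lebesgueH.IsAddHaarMeasure := by unfold lebesgueH; infer_instance

theorem det_contr_ne_zero : LinearMap.det β.contr ≠ 0 := fun h => by
  have := β.det_contr
  rw [h, abs_zero] at this
  exact (inv_pos.mpr β.pos).ne this

theorem lebesgueH_contr_image (s : Set β.H) :
    β.lebesgueH (β.contr '' s) = ENNReal.ofReal β.val⁻¹ * β.lebesgueH s := by
  rw [Measure.addHaar_image_linearMap, det_contr]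

theorem quasiMeasurePreserving_contr :
    Measure.QuasiMeasurePreserving β.contr β.lebesgueH β.lebesgueH := by
  refine ⟨β.continuous_contr.measurable, Measure.AbsolutelyContinuous.mk fun s hs h => ?_⟩
  rw [Measure.map_apply β.continuous_contr.measurable hs,
    Measure.addHaar_preimage_linearMap _ β.det_contr_ne_zero, h, mul_zero]

/-- A product of an interval and a null set is a null set of `ℝ^d`. -/
theorem volume_image_decomp (s : Set ℝ) {N : Set β.H} (hN : β.lebesgueH N = 0) :
    volume (β.decomp '' (s ×ˢ N)) = 0 := by
  let e := β.decomp.toContinuousLinearEquiv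
  let ν := (volume.prod β.lebesgueH).map e
  have hν : ν.IsAddHaarMeasure := ContinuousLinearEquiv.isAddHaarMeasure_map e _
  have h1 : (volume.prod β.lebesgueH) (s ×ˢ N) = 0 := by
    rw [Measure.prod_prod, hN, mul_zero]
  have h2 : ν (β.decomp '' (s ×ˢ N)) = 0 := by
    have := e.toHomeomorph.toMeasurableEquiv.map_apply (μ := volume.prod β.lebesgueH)
      (β.decomp '' (s ×ˢ N))
    have e1 : (e.toHomeomorph.toMeasurableEquiv : ℝ × β.H → _) ⁻¹' (β.decomp '' (s ×ˢ N)) = s ×ˢ N :=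
      Set.preimage_image_eq _ β.decomp.injective
    rw [e1, h1] at this
    exact this
  exact Measure.absolutelyContinuous_isAddHaarMeasure volume ν h2

end PisotUnit

namespace BetaTransformation

variable {β : PisotUnit} {T : BetaTransformation β}

variable (T) in
/-- The Lebesgue measure of `𝒟_x`. -/
def vol (x : ℝ) : ℝ≥0∞ := β.lebesgueH (T.D x)

theorem vol_le {x : ℝ} (hx : x ∈ T.X) :
    T.vol x ≤ β.lebesgueH (Metric.closedBall 0 T.radius) :=
  measure_mono fun h hh => by
    rw [mem_closedBall_zero_iff]; exact T.norm_le_radius hx hh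

/-- The value depends only on 𝒱 ∩ (-∞, x], which takes finitely many values, each on a measurable
set. -/
theorem measurable_vol (hV : T.V.Finite) : Measurable (T.X.indicator T.vol) := by
  intro U _
  have hcls : ∀ S ⊆ T.V, MeasurableSet {x | x ∈ T.X ∧ T.V ∩ Set.Iic x = S} := by
    intro S hS
    have : {x | x ∈ T.X ∧ T.V ∩ Set.Iic x = S} = T.X ∩ ⋂ v ∈ T.V, {x | v ∈ S ↔ v ≤ x} := by
      ext x
      simp only [Set.mem_ofPred_eq, Set.mem_inter_iff, Set.mem_iInter]
      refine and_congr_right fun _ => ⟨?_, fun h => ?_⟩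
      · rintro rfl v hv
        exact ⟨fun h => h.2, fun h => ⟨hv, h⟩⟩
      · ext v
        exact ⟨fun hv => (h v hv.1).mpr hv.2, fun hv => ⟨hS hv, (h v (hS hv)).mp hv⟩⟩
    rw [this]
    refine T.measurableSet_X.inter (hV.measurableSet_biInter fun v _ => ?_)
    by_cases hv : v ∈ S
    · simp only [hv, true_iff]; exact measurableSet_Ici
    · simp only [hv, false_iff, not_le]; exact measurableSet_Iio
  have hX : MeasurableSet {x | x ∈ T.X ∧ T.vol x ∈ U} := by
    have : {x | x ∈ T.X ∧ T.vol x ∈ U} =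
        ⋃ S ∈ {S | S ⊆ T.V ∧ ∃ x ∈ T.X, T.V ∩ Set.Iic x = S ∧ T.vol x ∈ U},
          {x | x ∈ T.X ∧ T.V ∩ Set.Iic x = S} := by
      ext x
      simp only [Set.mem_iUnion₂]
      constructor
      · rintro ⟨hx, hU⟩
        exact ⟨_, ⟨Set.inter_subset_left, x, hx, rfl, hU⟩, hx, rfl⟩
      · rintro ⟨S, ⟨-, y, hy, rfl, hU⟩, hx, hxy⟩
        exact ⟨hx, by rwa [vol, T.D_eq_of_V_inter_Iic_eq hx hy hxy]⟩
    rw [this]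
    exact (hV.finite_subsets.subset fun S hS => hS.1).measurableSet_biUnion fun S hS => hcls S hS.1
  classical
  rw [Set.indicator_preimage]
  have e : T.X.ite (T.vol ⁻¹' U) (0 ⁻¹' U) =
      {x | x ∈ T.X ∧ T.vol x ∈ U} ∪ ((0 ⁻¹' U) \ T.X) := by
    rw [Set.ite]; congr 1; ext x; exact and_comm
  refine e ▸ hX.union (MeasurableSet.diff ?_ T.measurableSet_X)
  by_cases h0 : (0 : ℝ≥0∞) ∈ U
  · convert MeasurableSet.univ using 1
    ext x; simp [h0]
  · convert MeasurableSet.empty using 1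
    ext x; simp [h0]

variable (T) in
/-- The measure of the part of `𝒟_x` which comes from preimages with digit `a`. -/
def partVol (a : β.K) (y : ℝ) : ℝ≥0∞ :=
  (T.piece a).indicator (fun y => ENNReal.ofReal β.val⁻¹ * T.vol y) y

theorem partVol_eq {a : β.K} (ha : a ∈ T.A) : T.partVol a =
    (T.piece a).indicator fun y => ENNReal.ofReal β.val⁻¹ * T.X.indicator T.vol y := by
  ext y
  by_cases hy : y ∈ T.piece a
  · simp only [partVol, Set.indicator_of_mem hy,
      Set.indicator_of_mem (T.mem_X.mpr ⟨a, ha, hy⟩ : y ∈ T.X)]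
  · simp only [partVol, Set.indicator_of_notMem hy]

theorem measurable_partVol (hV : T.V.Finite) {a : β.K} (ha : a ∈ T.A) :
    Measurable (T.partVol a) := by
  rw [partVol_eq ha]
  exact ((measurable_vol hV).const_mul _).indicator (T.measurableSet_piece a)

theorem vol_le_sum {x : ℝ} (hx : x ∈ T.X) :
    T.vol x ≤ ∑ a ∈ T.A, T.partVol a ((x + a) / β.val) := by
  classical
  let B : β.K → Set β.H := fun a => if (x + a) / β.val ∈ T.piece a then
    (fun h => β.Phi a + h) '' (β.contr '' T.D ((x + a) / β.val)) else ∅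
  have hsub : T.D x ⊆ ⋃ a ∈ T.A, B a := by
    intro h hh
    obtain ⟨y, hy, rfl, h', hh', rfl⟩ := (T.mem_D_iff_exists_preimage hx).mp hh
    have hd := T.digit_spec hy
    have e : (T.map y + T.digit y) / β.val = y := by
      rw [map, sub_add_cancel, mul_div_cancel_left₀ _ β.pos.ne']
    refine Set.mem_biUnion hd.1 ?_
    simp only [B, e, if_pos hd.2]
    exact ⟨_, ⟨h', hh', rfl⟩, rfl⟩
  refine (measure_mono hsub).trans ((measure_biUnion_finset_le _ _).trans
    (Finset.sum_le_sum fun a _ => ?_))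
  by_cases ha : (x + a) / β.val ∈ T.piece a
  · simp only [B, if_pos ha, partVol, Set.indicator_of_mem ha, Set.image_add_left,
      measure_preimage_add, β.lebesgueH_contr_image, vol, le_refl]
  · simp [B, if_neg ha]

/-- Subadditivity gives ≤. Both sides have the same finite integral, because substituting x = βy - a
contributes a factor β that cancels the factor β⁻¹ by which M scales volume. So equality holds
almost everywhere. -/
theorem vol_eq_sum (hV : T.V.Finite) {x : ℝ} (hx : x ∈ T.X) :
    T.vol x = ∑ a ∈ T.A, T.partVol a ((x + a) / β.val) := by
  have hb := β.pos
  let G := T.X.indicator T.vol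
  let R : ℝ → ℝ≥0∞ := fun x => ∑ a ∈ T.A, T.partVol a ((x + a) / β.val)
  have hGm : Measurable G := measurable_vol hV
  have hm : ∀ a ∈ T.A, Measurable fun x : ℝ => T.partVol a ((x + a) / β.val) := fun a ha =>
    (measurable_partVol hV ha).comp ((measurable_id.add_const _).div_const _)
  have hle : ∀ y, G y ≤ R y := by
    intro y
    by_cases hy : y ∈ T.X
    · simp only [G, Set.indicator_of_mem hy]; exact vol_le_sum hy
    · simp [G, hy]
  have hGfin : ∫⁻ y, G y ≠ ∞ := by
    obtain ⟨B, -, hB⟩ := T.exists_bound_X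
    have h1 : ∀ y, G y ≤ (Set.Icc (-B) B).indicator
        (fun _ => β.lebesgueH (Metric.closedBall 0 T.radius)) y := by
      intro y
      by_cases hy : y ∈ T.X
      · have hyI : y ∈ Set.Icc (-B) B := abs_le.mp (hB y hy)
        rw [Set.indicator_of_mem hyI]
        simp only [G, Set.indicator_of_mem hy]
        exact vol_le hy
      · simp [G, hy]
    refine ne_top_of_le_ne_top ?_ (lintegral_mono h1)
    rw [lintegral_indicator_const measurableSet_Icc, Real.volume_Icc]
    exact ENNReal.mul_ne_top (isCompact_closedBall _ _).measure_ne_top ENNReal.ofReal_ne_top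
  have hcb : ENNReal.ofReal β.val * ENNReal.ofReal β.val⁻¹ = 1 := by
    rw [← ENNReal.ofReal_mul hb.le, mul_inv_cancel₀ hb.ne', ENNReal.ofReal_one]
  have hR : ∫⁻ y, R y = ∫⁻ y, G y := by
    have h1 : ∀ a ∈ T.A, ∫⁻ x : ℝ, T.partVol a ((x + a) / β.val) =
        ∫⁻ y in T.piece a, T.vol y := by
      intro a ha
      rw [lintegral_comp_affine (measurable_partVol hV ha) hb, partVol_eq ha,
        lintegral_indicator (T.measurableSet_piece a), lintegral_const_mul _ hGm, ← mul_assoc, hcb,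
        one_mul]
      refine setLIntegral_congr_fun (T.measurableSet_piece a) fun y hy => ?_
      exact Set.indicator_of_mem (T.mem_X.mpr ⟨a, ha, hy⟩) _
    rw [lintegral_finsetSum' _ fun a ha => (hm a ha).aemeasurable, Finset.sum_congr rfl h1,
      lintegral_indicator T.measurableSet_X, X, lintegral_biUnion_finset]
    · exact fun a ha a' ha' hne => T.disjoint a ha a' ha' hne
    · exact fun a _ => T.measurableSet_piece a
  have hae : ∀ᵐ y, G y = R y := ae_eq_of_ae_le_of_lintegral_le (Eventually.of_forall hle) hGfin
    (Finset.measurable_sum _ hm).aemeasurable hR.le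
  have hpart : ∀ᶠ y in 𝓝[≥] x, ∀ a ∈ T.A,
      T.partVol a ((y + a) / β.val) = T.partVol a ((x + a) / β.val) := by
    refine (Filter.eventually_all_finset _).mpr fun a ha => ?_
    have ht := tendsto_affine_right x ((x + a) / β.val) β.val⁻¹ (inv_pos.mpr hb)
    have e : ∀ y : ℝ, (y + a) / β.val = (x + a) / β.val + β.val⁻¹ * (y - x) := fun y => by
      field_simp; ring
    by_cases hmem : (x + a) / β.val ∈ T.piece a
    · filter_upwards [ht.eventually (T.piece_right a _),
        ht.eventually (T.D_right hV (T.mem_X.mpr ⟨a, ha, hmem⟩))] with y h1 h2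
      rw [← e] at h1 h2
      simp only [partVol, Set.indicator_of_mem hmem, Set.indicator_of_mem (h1.mpr hmem), vol, h2.2]
    · filter_upwards [ht.eventually (T.piece_right a _)] with y h1
      rw [← e] at h1
      simp only [partVol, Set.indicator_of_notMem hmem,
        Set.indicator_of_notMem (fun h => hmem (h1.mp h))]
  -- Both sides are constant on some [x, x + δ), which contains a point of equality.
  obtain ⟨y, hy, hD, hp⟩ := exists_Ico_of_ae hae ((T.D_right hV hx).and hpart)
  have h1 : G y = T.vol x := by
    simp only [G, Set.indicator_of_mem hD.1, vol, hD.2]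
  rw [← h1, hy]
  exact Finset.sum_congr rfl hp

theorem lebesgueH_tile (x : β.K) : β.lebesgueH (T.tile x) = T.vol x := by
  rw [tile, Set.image_add_left, measure_preimage_add, vol]

/-- The sets `M 𝒯_y`, where `y` runs over the preimages of `x`, are disjoint in measure. -/
theorem ae_unique_preimage (hA : ∀ a ∈ T.A, (a : ℝ) ∈ β.ring) (hV : T.V.Finite) {x : β.K}
    (hx : x ∈ T.index) : ∀ᵐ p ∂β.lebesgueH, ∀ y ∈ T.index, ∀ y' ∈ T.index, T.mapK y = x →
      T.mapK y' = x → p ∈ β.contr '' T.tile y → p ∈ β.contr '' T.tile y' → y = y' := by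
  classical
  let pre : β.K → β.K := fun a => (x + a) / β.gen
  have hpre : ∀ a, (pre a : ℝ) = (x + a) / β.val := fun a => by simp only [pre]; push_cast; rfl
  let B : β.K → Set β.H := fun a =>
    if (x + a) / β.val ∈ T.piece a then β.contr '' T.tile (pre a) else ∅
  have hBc : ∀ a ∈ T.A, IsCompact (B a) := by
    intro a ha
    by_cases hmem : (x + a) / β.val ∈ T.piece a
    · simp only [B, if_pos hmem]
      have : IsCompact (T.tile (pre a)) := by
        refine (T.isCompact_D ?_).image (by fun_prop)
        rw [hpre]; exact T.mem_X.mpr ⟨a, ha, hmem⟩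
      exact this.image β.continuous_contr
    · simp only [B, if_neg hmem, isCompact_empty]
  have hpreim : ∀ y ∈ T.index, T.mapK y = x → T.digit y ∈ T.A ∧ pre (T.digit y) = y ∧
      B (T.digit y) = β.contr '' T.tile y := by
    intro y hy hyx
    have hd := T.digit_spec hy.2
    have e : pre (T.digit y) = y := by
      simp only [pre]
      rw [← hyx, mapK, sub_add_cancel, mul_div_cancel_left₀ _ β.gen_ne_zero]
    have h2 : ((x : ℝ) + T.digit y) / β.val ∈ T.piece (T.digit y) := by
      rw [← hpre, e]; exact hd.2
    exact ⟨hd.1, e, by simp only [B, if_pos h2, e]⟩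
  have hsub : T.tile x ⊆ ⋃ a ∈ T.A, B a := by
    intro p hp
    obtain ⟨y, hy, hyx, hpy⟩ := (mem_tile_iff hA hx).mp hp
    obtain ⟨h1, -, h3⟩ := hpreim y hy hyx
    exact Set.mem_biUnion h1 (h3 ▸ hpy)
  have hsum : ∑ a ∈ T.A, β.lebesgueH (B a) ≤ β.lebesgueH (T.tile x) := by
    rw [lebesgueH_tile, vol_eq_sum hV hx.2]
    refine Finset.sum_le_sum fun a _ => ?_
    by_cases hmem : (x + a) / β.val ∈ T.piece a
    · simp only [B, if_pos hmem, partVol, Set.indicator_of_mem hmem, β.lebesgueH_contr_image,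
        lebesgueH_tile, hpre, le_refl]
    · simp [B, if_neg hmem]
  have hae := ae_eq_of_sum_measure_le T.A (fun a ha => (hBc a ha).measurableSet)
    (isCompact_tile hx).measurableSet hsub (isCompact_tile hx).measure_ne_top hsum
  filter_upwards [hae] with p hp y hy y' hy' hyx hyx' hpy hpy'
  obtain ⟨h1, h2, h3⟩ := hpreim y hy hyx
  obtain ⟨h1', h2', h3'⟩ := hpreim y' hy' hyx'
  rw [← h2, ← h2', hp _ h1 _ h1' (h3 ▸ hpy) (h3' ▸ hpy')
    ((mem_tile_iff hA hx).mpr ⟨y, hy, hyx, hpy⟩)]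

end BetaTransformation
end BetaTiling

/-! ### Statement 2: from one exclusive point to a tiling -/

namespace BetaTiling

open MeasureTheory Filter Topology

open scoped ENNReal Pointwise

namespace BetaTransformation

variable {β : PisotUnit} {T : BetaTransformation β}

/-! ### Points which lie in at most one tile -/

variable (T) in
theorem index_countable : T.index.Countable := by
  refine (Set.countable_iUnion fun n : ℕ => (T.finite_tiles n).countable).mono fun x hx => ?_
  obtain ⟨p, hp⟩ := tile_nonempty hx
  obtain ⟨n, hn⟩ := exists_nat_ge ‖p‖
  exact Set.mem_iUnion.mpr ⟨n, hx, p, hp, by simpa using hn⟩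

variable (T) in
/-- The set of points of `H` which lie in at most one tile. -/
def uniqueSet : Set β.H :=
  {p | ∀ x ∈ T.index, ∀ x' ∈ T.index, p ∈ T.tile x → p ∈ T.tile x' → x = x'}

/-- If p lies in 𝒯_y and 𝒯_{y'}, then Mp lies in the tiles of Ty and Ty', so Ty = Ty'; disjointness
in measure of the set equation gives y = y'. -/
theorem ae_mem_uniqueSet_of_contr (hA : ∀ a ∈ T.A, (a : ℝ) ∈ β.ring) (hV : T.V.Finite) :
    ∀ᵐ p ∂β.lebesgueH, β.contr p ∈ T.uniqueSet → p ∈ T.uniqueSet := by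
  have h := (ae_ball_iff T.index_countable).mpr fun x hx => ae_unique_preimage hA hV hx
  filter_upwards [β.quasiMeasurePreserving_contr.ae h] with p hp hQ y hy y' hy' hpy hpy'
  have h1 := contr_pow_mem_tile hA hy hpy 1
  have h2 := contr_pow_mem_tile hA hy' hpy' 1
  rw [pow_one, Function.iterate_one] at h1 h2
  have hi := mapK_mem_index hA hy
  have e := hQ _ hi _ (mapK_mem_index hA hy') h1 h2
  exact hp _ hi y hy y' hy' rfl e.symm ⟨p, hpy, rfl⟩ ⟨p, hpy', rfl⟩

theorem ae_mem_uniqueSet_of_contr_pow (hA : ∀ a ∈ T.A, (a : ℝ) ∈ β.ring) (hV : T.V.Finite)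
    (n : ℕ) : ∀ᵐ p ∂β.lebesgueH, (β.contr ^ n) p ∈ T.uniqueSet → p ∈ T.uniqueSet := by
  induction n with
  | zero => exact Eventually.of_forall fun p hp => hp
  | succ n ih =>
    filter_upwards [β.quasiMeasurePreserving_contr.ae ih, ae_mem_uniqueSet_of_contr hA hV]
      with p h1 h2 hp
    rw [pow_succ, Module.End.mul_apply] at hp
    exact h2 (h1 hp)

/-- If a ball consists of points which lie in at most one tile, then so do almost all points. -/
theorem ae_mem_uniqueSet (hA : ∀ a ∈ T.A, (a : ℝ) ∈ β.ring) (hV : T.V.Finite) {u : β.H} {r : ℝ}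
    (hr : 0 < r) (hu : Metric.ball u r ⊆ T.uniqueSet) :
    ∀ᵐ p ∂β.lebesgueH, p ∈ T.uniqueSet := by
  suffices h : ∀ R : ℕ, ∀ᵐ p ∂β.lebesgueH, ‖p‖ ≤ R → p ∈ T.uniqueSet by
    filter_upwards [ae_all_iff.mpr h] with p hp
    obtain ⟨n, hn⟩ := exists_nat_ge ‖p‖
    exact hp n hn
  intro R
  obtain ⟨z, hzr, hz, hzu⟩ := β.exists_Phi_near u (half_pos hr)
  -- Finitely many tiles meet the ball of radius R, so one n makes 𝒟 unchanged when all their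
  -- indices move by zβ⁻ⁿ. The translated patch is then made of tiles again, and Mⁿ brings it close
  -- to Φ(z), hence into the given ball.
  have h1 : ∀ᶠ n : ℕ in atTop,
      ∀ x ∈ {x ∈ T.index | (T.tile x ∩ Metric.closedBall 0 (R : ℝ)).Nonempty},
        shift x z n ∈ T.index ∧ T.D (shift x z n : β.K) = T.D x := by
    refine (Filter.eventually_all_finite (T.finite_tiles R)).mpr fun x hx => ?_
    filter_upwards [(tendsto_add_div_pow (x : ℝ) hz).eventually (T.D_right hV hx.1.2)] with n hn
    rw [← coe_shift] at hn
    refine ⟨⟨?_, hn.1⟩, hn.2⟩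
    rw [coe_shift]; exact add_mem hx.1.1 (div_pow_mem_ring hzr n)
  obtain ⟨n, hn, hnr⟩ :=
    (h1.and ((β.tendsto_contrConst_mul R).eventually (gt_mem_nhds (half_pos hr)))).exists
  filter_upwards [(measurePreserving_add_right β.lebesgueH
    (β.Phi (z / β.gen ^ n))).quasiMeasurePreserving.ae (ae_mem_uniqueSet_of_contr_pow hA hV n)]
    with p hp hpR
  have hin : p + β.Phi (z / β.gen ^ n) ∈ T.uniqueSet := by
    refine hp (hu ?_)
    rw [map_add, β.contr_pow_Phi, mul_div_cancel₀ _ (pow_ne_zero _ β.gen_ne_zero),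
      Metric.mem_ball, dist_eq_norm, add_sub_assoc]
    calc _ ≤ ‖(β.contr ^ n) p‖ + ‖β.Phi z - u‖ := norm_add_le _ _
      _ < r := by linarith [β.norm_contr_pow_le_of_le (n := n) hpR]
  have hmem : ∀ x ∈ T.index, p ∈ T.tile x → shift x z n ∈ T.index ∧
      p + β.Phi (z / β.gen ^ n) ∈ T.tile (shift x z n) := by
    intro x hx hpx
    obtain ⟨h1, h2⟩ := hn x ⟨hx, p, hpx, by simpa using hpR⟩
    obtain ⟨h, hh, rfl⟩ := hpx
    refine ⟨h1, h, h2 ▸ hh, ?_⟩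
    change β.Phi (x + z / β.gen ^ n) + h = β.Phi x + h + _
    rw [β.Phi_add]; abel
  intro x hx x' hx' hpx hpx'
  obtain ⟨h1, h2⟩ := hmem x hx hpx
  obtain ⟨h1', h2'⟩ := hmem x' hx' hpx'
  exact add_right_cancel (hin _ h1 _ h1' h2 h2')

theorem HasExclusivePoint.exists_ball {x : β.K} (hE : T.HasExclusivePoint x) :
    ∃ u, ∃ r > 0, ∀ p ∈ Metric.ball u r, ∀ x' ∈ T.index, p ∈ T.tile x' → x' = x := by
  obtain ⟨u, -, hu⟩ := hE
  obtain ⟨r, hr, h⟩ := exists_ball_of_mem_tile (S := {x}) hu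
  exact ⟨u, r, hr, h⟩

/-! ### The support of `μ` -/

/-- The series telescopes, since each digit is βTⁿx - Tⁿ⁺¹x. -/
theorem value_eq {x : ℝ} (hx : x ∈ T.X) {u : ℤ → β.K}
    (hu : ∀ n : ℕ, u (n + 1) = T.expansion x n) : value u = x := by
  have h0 := β.pos
  obtain ⟨B, hB0, hB⟩ := T.exists_bound_X
  let f : ℕ → ℝ := fun n => T.map^[n] x * (β.val ^ n)⁻¹
  have hf : ∀ n, |f n| ≤ B * β.val⁻¹ ^ n := fun n => by
    rw [abs_mul, inv_pow, abs_of_pos (inv_pos.mpr (pow_pos h0 n))]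
    exact mul_le_mul_of_nonneg_right (hB _ (T.iterate_mem hx n)) (inv_pos.mpr (pow_pos h0 n)).le
  have hgeo := summable_geometric_of_lt_one (inv_nonneg.mpr h0.le) (inv_lt_one_of_one_lt₀ β.one_lt)
  have hfs : Summable f := (hgeo.mul_left B).of_norm_bounded hf
  have hterm : ∀ n : ℕ, (u (n + 1) : ℝ) * (β.val ^ (n + 1))⁻¹ = f n - f (n + 1) := fun n => by
    simp only [f, hu, expansion, Function.iterate_succ_apply', map, pow_succ]
    field_simp; ring
  have hfs' : Summable fun n => f (n + 1) := (summable_nat_add_iff 1).mpr hfs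
  rw [value, tsum_congr hterm, hfs.tsum_sub hfs', hfs.tsum_eq_zero_add, add_sub_cancel_right]
  simp [f]

theorem proj_psi (u : ℤ → β.K) : β.proj (psi u) = value u := by
  rw [psi, map_sub, map_smul, β.proj_v₁, β.proj_H]; simp

/-- The part of X̂ above s lies in the product of s and -N. -/
theorem mu_eq_zero {s : Set ℝ} (hs : MeasurableSet s) {N : Set β.H}
    (hN : β.lebesgueH N = 0) (h : ∀ x ∈ T.X, x ∈ s → T.D x = N) : T.mu s = 0 := by
  have hm : Measurable β.proj := (LinearMap.continuous_of_finiteDimensional β.proj).measurable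
  rw [mu, Measure.map_apply hm hs, Measure.restrict_apply (hm hs)]
  have hN' : β.lebesgueH (-N) = 0 := by rwa [Measure.measure_neg]
  refine measure_mono_null ?_ (β.volume_image_decomp s hN')
  rintro _ ⟨hps, u, hu, rfl⟩
  obtain ⟨x, hx, hux⟩ := hu 1
  have hux' : ∀ n : ℕ, u (n + 1) = T.expansion x n := fun n => by rw [← hux, add_comm]
  have hv := value_eq hx hux'
  have hxs : x ∈ s := by
    have : β.proj (psi u) ∈ s := hps
    rwa [proj_psi, hv] at this
  refine ⟨(x, -phi u), ⟨hxs, ?_⟩, ?_⟩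
  · rw [Set.neg_mem_neg, ← h x hx hxs]
    exact ⟨u, hu, hux', rfl⟩
  · rw [β.decomp_apply, psi, hv, Submodule.coe_neg, sub_eq_add_neg]

/-- As 𝒟 is constant just to the right of x, a null set 𝒟_x would make an open interval of points of
X null for μ. -/
theorem lebesgueH_D_ne_zero (hV : T.V.Finite) (hsupp : T.mu.support = closure T.X) {x : ℝ}
    (hx : x ∈ T.X) : β.lebesgueH (T.D x) ≠ 0 := by
  intro h0
  obtain ⟨u, hu, hsub⟩ := mem_nhdsGE_iff_exists_Ico_subset.mp (T.D_right hV hx)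
  have hxu : x < u := hu
  obtain ⟨y, hxy, hyu⟩ := exists_between hxu
  have hy : y ∈ T.mu.support := hsupp ▸ subset_closure (hsub ⟨hxy.le, hyu⟩).1
  have h1 : T.mu (Set.Ioo x u) = 0 :=
    mu_eq_zero measurableSet_Ioo h0 fun q _ hq => (hsub ⟨hq.1.le, hq.2⟩).2
  exact ((Measure.mem_support_iff_forall y).mp hy _ (Ioo_mem_nhds hxy hyu)).ne' h1

/-! ### Tilings -/

/-- Positive measure gives an exclusive point; the ball around it that no other tile meets is
covered, hence contained in 𝒯_x. -/
theorem interior_tile_nonempty (hA : ∀ a ∈ T.A, (a : ℝ) ∈ β.ring) (hV : T.V.Finite)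
    (hsupp : T.mu.support = closure T.X) (hQ : ∀ᵐ p ∂β.lebesgueH, p ∈ T.uniqueSet) {x : β.K}
    (hx : x ∈ T.index) : (interior (T.tile x)).Nonempty := by
  have h0 : β.lebesgueH (T.tile x) ≠ 0 := by
    rw [lebesgueH_tile]; exact lebesgueH_D_ne_zero hV hsupp hx.2
  obtain ⟨p, hp, hpQ⟩ := nonempty_of_measure_ne_zero
    (show β.lebesgueH (T.tile x ∩ T.uniqueSet) ≠ 0 by rwa [measure_inter_conull (t := T.uniqueSet) hQ])
  have hE : T.HasExclusivePoint x := ⟨p, hp, fun x' hx' h => hpQ x' hx' x hx h hp⟩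
  obtain ⟨u, r, hr, hu⟩ := hE.exists_ball
  refine ⟨u, mem_interior.mpr ⟨_, fun q hq => ?_, Metric.isOpen_ball, Metric.mem_ball_self hr⟩⟩
  obtain ⟨x', hx', hqx'⟩ := exists_mem_tile hA ⟨x, hx⟩ q
  exact hu q hq x' hx' hqx' ▸ hqx'

/-- Every point of 𝒯_x lies in subtiles Mⁿ𝒯_w of arbitrarily small diameter, and each has interior
points because M is open. -/
theorem closure_interior_tile (hA : ∀ a ∈ T.A, (a : ℝ) ∈ β.ring)
    (hint : ∀ x ∈ T.index, (interior (T.tile x)).Nonempty) {x : β.K} (hx : x ∈ T.index) :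
    closure (interior (T.tile x)) = T.tile x := by
  have hcl := (isCompact_tile hx).isClosed
  refine (closure_minimal interior_subset hcl).antisymm fun p hp => ?_
  rw [Metric.mem_closure_iff]
  intro ε hε
  obtain ⟨w, v, rfl, rfl, hw, hmap, hvt, hv⟩ := exists_backward_tile hA hx hp
  obtain ⟨n, hn⟩ := ((β.tendsto_contrConst_mul (T.radius + T.radius)).eventually
    (gt_mem_nhds hε)).exists
  obtain ⟨q, hq⟩ := hint _ (hw n)
  have hwn : T.mapK^[n] (w n) = w 0 := iterate_backward hmap n 0
  have hvn : (β.contr ^ n) (v n) = v 0 := by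
    rw [Module.End.pow_apply]; exact iterate_backward hv n 0
  refine ⟨(β.contr ^ n) q, ?_, ?_⟩
  · refine mem_interior.mpr ⟨(β.contr ^ n) '' interior (T.tile (w n)), ?_, ?_, ⟨q, hq, rfl⟩⟩
    · rintro _ ⟨q', hq', rfl⟩
      exact hwn ▸ contr_pow_mem_tile hA (hw n) (interior_subset hq') n
    · exact (LinearMap.isOpenMap_of_finiteDimensional _ (β.contr_pow_surjective n)) _ isOpen_interior
  · rw [← hvn, dist_eq_norm, ← map_sub]
    refine (β.norm_contr_pow_le_of_le ?_).trans_lt hn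
    calc ‖v n - q‖ = ‖(v n - β.Phi (w n)) - (q - β.Phi (w n))‖ := by congr 1; abel
      _ ≤ _ := (norm_sub_le _ _).trans (add_le_add (norm_sub_le_radius (hw n) (hvt n))
        (norm_sub_le_radius (hw n) (interior_subset hq)))

theorem closure_interior_D {x : β.K} (h : closure (interior (T.tile x)) = T.tile x) :
    closure (interior (T.D x)) = T.D x := by
  let e := Homeomorph.addLeft (β.Phi x)
  have h1 : e '' closure (interior (T.D x)) = e '' T.D x := by
    rw [e.image_closure, e.image_interior]; exact h
  exact e.injective.image_injective h1

theorem isTiling_of_weakFiniteness (hA : ∀ a ∈ T.A, (a : ℝ) ∈ β.ring) (hV : T.V.Finite)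
    (hsupp : T.mu.support = closure T.X) (hW : T.WeakFiniteness) : T.IsTiling := by
  obtain ⟨x₀, hx₀, hW⟩ := hW
  have hE := hasExclusivePoint_of_weakFinitenessAt hA hx₀ hW
  obtain ⟨u, r, hr, hu⟩ := hE.exists_ball
  have hQ : ∀ᵐ p ∂β.lebesgueH, p ∈ T.uniqueSet := ae_mem_uniqueSet hA hV hr
    fun p hp x hx x' hx' h h' => (hu p hp x hx h).trans (hu p hp x' hx' h').symm
  have hcov := exists_mem_tile hA ⟨x₀, hx₀.1⟩
  refine ⟨?_, fun x hx => T.isCompact_D hx.2, fun y => ?_, hcov, fun x hx => ?_, le_rfl, ?_⟩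
  · exact (T.finite_range_D hV).subset fun _ ⟨x, hx, h⟩ => ⟨x, hx.2, h⟩
  · refine ⟨1, one_pos, (T.finite_tiles (‖y‖ + 1)).subset ?_⟩
    rintro x ⟨hx, p, hp, hpy⟩
    refine ⟨hx, p, hp, Metric.closedBall_subset_closedBall' ?_ (Metric.ball_subset_closedBall hpy)⟩
    rw [dist_zero_right, add_comm]
  · exact closure_interior_D (closure_interior_tile hA
      (fun x hx => interior_tile_nonempty hA hV hsupp hQ hx) hx)
  · filter_upwards [hQ] with y hy
    obtain ⟨x, hx, hyx⟩ := hcov y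
    rw [Nat.cast_one, Set.encard_eq_one]
    refine ⟨x, Set.eq_singleton_iff_unique_mem.mpr ⟨⟨hx, hyx⟩, fun x' hx' => ?_⟩⟩
    exact hy _ hx'.1 _ hx hx'.2 hyx

/-- Near 0 only tiles with index in P occur, and almost every point there lies in exactly one of
them. -/
theorem weakFiniteness_of_isTiling (hA : ∀ a ∈ T.A, (a : ℝ) ∈ β.ring) (hT : T.IsTiling) :
    T.WeakFiniteness := by
  obtain ⟨r, hr, hball⟩ := exists_ball_of_mem_tile (S := T.P) (y := 0)
    fun x hx h => (zero_mem_tile_iff hA hx).mp h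
  have h0 : β.lebesgueH (Metric.ball 0 r) ≠ 0 := (Metric.measure_ball_pos _ _ hr).ne'
  obtain ⟨p, hp, hdeg⟩ := nonempty_of_measure_ne_zero
    (show β.lebesgueH (Metric.ball 0 r ∩ {y | {x ∈ T.index | y ∈ T.tile x}.encard = (1 : ℕ)}) ≠ 0
      by rwa [measure_inter_conull hT.degree])
  obtain ⟨x, hx⟩ := Set.encard_eq_one.mp (hdeg.trans Nat.cast_one)
  obtain ⟨⟨hxi, hpx⟩, huniq⟩ := Set.eq_singleton_iff_unique_mem.mp hx
  have hxP := hball p hp x hxi hpx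
  exact ⟨x, hxP, weakFinitenessAt_of_hasExclusivePoint hA hxP
    ⟨p, hpx, fun x' hx' h => huniq x' ⟨hx', h⟩⟩⟩

end BetaTransformation
end BetaTiling

end

theorem corollaryc (β : BetaTiling.PisotUnit) (T : BetaTiling.BetaTransformation β)
    (hA : ∀ a ∈ T.A, (a : ℝ) ∈ β.ring) (hV : T.V.Finite) :
    (∀ x ∈ T.P, (T.HasExclusivePoint x ↔ T.WeakFinitenessAt x)) ∧
      (T.mu.support = closure T.X → (T.IsTiling ↔ T.WeakFiniteness)) :=
  ⟨fun _ hx => ⟨BetaTiling.BetaTransformation.weakFinitenessAt_of_hasExclusivePoint hA hx,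
    BetaTiling.BetaTransformation.hasExclusivePoint_of_weakFinitenessAt hA hx⟩,
  fun hsupp => ⟨BetaTiling.BetaTransformation.weakFiniteness_of_isTiling hA,
    BetaTiling.BetaTransformation.isTiling_of_weakFiniteness hA hV hsupp⟩⟩
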